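/- All graphs are finite and simple. A connected graph is called 2-connected if it has no cut vertex (a vertex whose removal disconnects it; one-vertex graphs and single edges count as 2-connected). A block of a graph is an inclusion-maximal 2-connected induced subgraph, and a block graph is a (not necessarily connected) graph all of whose blocks are cliques. The distance to block of a graph $G$ is the minimal number of vertices whose removal from $G$ leaves a block graph. An instance of POHPP (Partially Ordered Hamiltonian Path Problem) or POHCP (Partially Ordered Hamiltonian Cycle Problem) consists of a graph $G$ on $n$ vertices and a partial order $\pi$ on $V(G)$. POHPP asks whether there is an ordered Hamiltonian path $(v_1,\dots,v_n)$ of $G$ such that $(v_i,v_j)\in\pi$ implies $i\le j$ for all $i,j\in\{1,\dots,n\}$. POHCP asks whether there is such a path for which, in addition, $v_1$ and $v_n$ are adjacent. Theorem. There are a constant $c$ and, for each of POHPP and POHCP, an algorithm (a program for a unit-cost random access machine with addition and subtraction but no multiplication, which gets $n$, the adjacency matrix of $G$ and the matrix of $\pi$ as input) that solves the problem correctly on every instance $(G,\pi)$ and that halts after at most $n^{c\cdot\max\{k,1\}}$ steps whenever $G$ has $n\ge 2$ vertices and distance to block $k$, and after at most $2^{c\cdot\max\{k,1\}}$ steps if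 $n\le 1$. That is, if the distance to block of a graph $G$ with $n$ vertices is $k$, then POHPP and POHCP can be solved in $n^{\mathcal O(k)}$ time (in $n^{\mathcal O(1)}$ time if $k=0$). -/

import Mathlib

namespace POHam

/-! ### Block graphs and the distance to block -/

/-- A cut vertex of a (connected) graph: its removal disconnects the graph. -/
def IsCutVertex {V : Type*} (G : SimpleGraph V) (v : V) : Prop :=
  ¬ (G.induce ({v}ᶜ : Set V)).Preconnected

/-- Connected without a cut vertex. One-vertex graphs and single edges are included,
so that isolated vertices and bridges are blocks, as usual. -/
def IsTwoConnected {V : Type*} (G : SimpleGraph V) : Prop :=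
  G.Connected ∧ ∀ v, ¬ IsCutVertex G v

/-- A block: an inclusion-maximal 2-connected induced subgraph (given by its vertex set). -/
def IsBlock {V : Type*} (G : SimpleGraph V) (B : Set V) : Prop :=
  Maximal (fun S : Set V => IsTwoConnected (G.induce S)) B

/-- A block graph: every block is a clique (the graph need not be connected). -/
def IsBlockGraph {V : Type*} (G : SimpleGraph V) : Prop :=
  ∀ B : Set V, IsBlock G B → G.IsClique B

/-- The minimal number of vertices whose removal leaves a block graph. -/
noncomputable def distanceToBlock {V : Type*} (G : SimpleGraph V) : ℕ :=
  sInf {k : ℕ | ∃ W : Finset V, W.card = k ∧ IsBlockGraph (G.induce ((W : Set V)ᶜ))}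

/-- On a finite graph the minimum in `distanceToBlock` is attained. -/
theorem exists_card_eq_distanceToBlock {V : Type*} [Finite V] (G : SimpleGraph V) :
    ∃ W : Finset V, W.card = distanceToBlock G ∧ IsBlockGraph (G.induce ((W : Set V)ᶜ)) := by
  classical
  have := Fintype.ofFinite V
  refine Nat.sInf_mem (s := {k : ℕ | ∃ W : Finset V, W.card = k ∧
    IsBlockGraph (G.induce ((W : Set V)ᶜ))}) ⟨_, Finset.univ, rfl, ?_⟩
  rintro B - ⟨x, hx⟩
  exact absurd (Finset.mem_coe.2 (Finset.mem_univ x)) hx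

/-! ### The two problems -/

/-- The vertex order of the ordered path `p` respects `π`: if `(v_i, v_j) ∈ π` then `i ≤ j`. -/
def Extends {V : Type*} {G : SimpleGraph V} {u v : V} (p : G.Walk u v) (π : V → V → Prop) : Prop :=
  ∀ i j : Fin p.support.length, π (p.support.get i) (p.support.get j) → i ≤ j

/-- The question of the Partially Ordered Hamiltonian Path Problem. -/
def POHPP {V : Type*} [DecidableEq V] (G : SimpleGraph V) (π : V → V → Prop) : Prop :=
  ∃ (u v : V) (p : G.Walk u v), p.IsHamiltonian ∧ Extends p π

/-- The question of the Partially Ordered Hamiltonian Cycle Problem: the first and the last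
vertex of the ordered Hamiltonian path have to be adjacent. -/
def POHCP {V : Type*} [DecidableEq V] (G : SimpleGraph V) (π : V → V → Prop) : Prop :=
  ∃ (u v : V) (p : G.Walk u v), p.IsHamiltonian ∧ G.Adj u v ∧ Extends p π

/-! ### The machine model

A random access machine, programmed in structured form, with scalar registers `x₀, x₁, …` and
arrays `A₀, A₁, …` whose cells hold natural numbers. A program is a finite object and so names
finitely many registers and arrays. The arithmetic operations are addition and truncated
subtraction (no multiplication), so that every operation has unit cost in the standard sense:
the bit length of the numbers grows by at most one per operation. -/

/-- A memory state: the contents of the registers and of the arrays. -/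
structure State where
  reg : ℕ → ℕ
  arr : ℕ → ℕ → ℕ

/-- Expressions. -/
inductive Expr where
  | const (m : ℕ)
  | var (x : ℕ)
  | get (a : ℕ) (i : Expr)
  | add (e f : Expr)
  | sub (e f : Expr)
  | lt (e f : Expr)
  | eq (e f : Expr)

/-- The value of an expression; comparisons give `1` or `0`. -/
def Expr.eval (s : State) : Expr → ℕ
  | .const m => m
  | .var x => s.reg x
  | .get a i => s.arr a (i.eval s)
  | .add e f => e.eval s + f.eval s
  | .sub e f => e.eval s - f.eval s
  | .lt e f => if e.eval s < f.eval s then 1 else 0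
  | .eq e f => if e.eval s = f.eval s then 1 else 0

/-- The number of unit-cost operations spent on evaluating an expression. -/
def Expr.cost : Expr → ℕ
  | .const _ => 1
  | .var _ => 1
  | .get _ i => i.cost + 1
  | .add e f => e.cost + f.cost + 1
  | .sub e f => e.cost + f.cost + 1
  | .lt e f => e.cost + f.cost + 1
  | .eq e f => e.cost + f.cost + 1

/-- Programs. -/
inductive Prog where
  | skip
  | assign (x : ℕ) (e : Expr)
  | store (a : ℕ) (i e : Expr)
  | seq (p q : Prog)
  | ite (e : Expr) (p q : Prog)
  | loop (e : Expr) (p : Prog)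

/-- `Exec p s t s'`: started in state `s`, the program `p` halts after exactly `t` steps in
state `s'`. `loop e p` repeats `p` as long as `e` is nonzero. -/
inductive Exec : Prog → State → ℕ → State → Prop where
  | skip (s : State) : Exec .skip s 1 s
  | assign (x : ℕ) (e : Expr) (s : State) :
      Exec (.assign x e) s (e.cost + 1) ⟨Function.update s.reg x (e.eval s), s.arr⟩
  | store (a : ℕ) (i e : Expr) (s : State) :
      Exec (.store a i e) s (i.cost + e.cost + 1)
        ⟨s.reg, Function.update s.arr a (Function.update (s.arr a) (i.eval s) (e.eval s))⟩
  | seq {p q : Prog} {s s' s'' : State} {t t' : ℕ} :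
      Exec p s t s' → Exec q s' t' s'' → Exec (.seq p q) s (t + t') s''
  | ite_true {e : Expr} {p q : Prog} {s s' : State} {t : ℕ} :
      e.eval s ≠ 0 → Exec p s t s' → Exec (.ite e p q) s (e.cost + 1 + t) s'
  | ite_false {e : Expr} {p q : Prog} {s s' : State} {t : ℕ} :
      e.eval s = 0 → Exec q s t s' → Exec (.ite e p q) s (e.cost + 1 + t) s'
  | loop_true {e : Expr} {p : Prog} {s s' s'' : State} {t t' : ℕ} :
      e.eval s ≠ 0 → Exec p s t s' → Exec (.loop e p) s' t' s'' →
      Exec (.loop e p) s (e.cost + 1 + t + t') s''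
  | loop_false {e : Expr} {p : Prog} {s : State} :
      e.eval s = 0 → Exec (.loop e p) s (e.cost + 1) s

open Classical in
/-- The row-major 0/1 matrix of a relation on `{0, …, n - 1}`: cell `u * n + v` holds `1`
if `R u v`; all other cells hold `0`. -/
noncomputable def matrixArray {n : ℕ} (R : Fin n → Fin n → Prop) (i : ℕ) : ℕ :=
  if ∃ u v : Fin n, i = (u : ℕ) * n + (v : ℕ) ∧ R u v then 1 else 0

/-- The initial state on the instance `(G, π)`: register `0` holds the number `n` of vertices,
array `0` the adjacency matrix of `G`, array `1` the matrix of `π`; the rest is `0`. -/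
noncomputable def input {n : ℕ} (G : SimpleGraph (Fin n)) (π : Fin n → Fin n → Prop) : State where
  reg x := if x = 0 then n else 0
  arr a := if a = 0 then matrixArray G.Adj else if a = 1 then matrixArray π else fun _ => 0

/-- The program `P` solves the problem `Q`: on every graph `G` with a partial order `π` on its
vertex set it halts after at most `T n G` steps, with register `0` holding the answer
(`1` for yes, `0` for no). -/
def SolvesInTime (P : Prog)
    (Q : ∀ n : ℕ, SimpleGraph (Fin n) → (Fin n → Fin n → Prop) → Prop)
    (T : ∀ n : ℕ, SimpleGraph (Fin n) → ℕ) : Prop :=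
  ∀ (n : ℕ) (G : SimpleGraph (Fin n)) (π : Fin n → Fin n → Prop), IsPartialOrder (Fin n) π →
    ∃ (t : ℕ) (s : State), Exec P (input G π) t s ∧ t ≤ T n G ∧
      (Q n G π → s.reg 0 = 1) ∧ (¬ Q n G π → s.reg 0 = 0)

end POHam

/-! Let W be a set of k vertices whose deletion leaves a block graph. At most 3k + 2 positions of a
solution are special: the first, the last, those of W and the positions next to these. Guess W and
the vertices at these anchors; a guess is a number below n^(4k+2), read as 4k + 2 digits in base n.
Between consecutive anchors the solution is a single edge or avoids W altogether, so it remains to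
reconstruct paths inside a block graph.

The only fact used about block graphs is `LeavesBlocks`: two neighbours of s that are connected
without s are adjacent, because the connecting path closes to a cycle through s, and this cycle lies
in one block (`IsBlockGraph.adj_of_reflTransGen`). Consider a segment from s to t that avoids W. Its
last vertex adjacent to s is a neighbour f of s from which t can be reached while avoiding W, s and
all other neighbours of s (`exists_isNext`). Conversely, the segment must run through every such f,
and before f it meets only common neighbours of s and f (`IsNext.mem_path`). Searching for f, and
then continuing from f, yields a route: a subsequence of the solution in which each gap is an edge
or contains only common neighbours of its two ends, outside of W (`route_spec`).

The remaining common neighbours of two vertices outside of W are pairwise adjacent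
(`LeavesBlocks.adj_of_common`). Adjacency therefore does not restrict their order, and a gap can be
filled greedily: insert each common neighbour off the route as soon as all its predecessors are
placed. Placing a vertex earlier than the solution does is harmless: by induction, everything that
stands before a route vertex in the solution has been placed when that vertex is due. For a right
guess the result is a solution (`fill_spec`), though perhaps a different one. Every sequence is
verified before the answer is yes, so wrong guesses do no harm.

As k is not given, sizes 0, 1, … are tried until some set passes the test for `LeavesBlocks`, at the
latest at the distance to block. All loops are counting loops with bounds polynomial in n and k or
equal to the number of guesses, and `Cmd.exec` turns this into the running time. -/

namespace POHam
open Relation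

/-! ### Programs with bounded loops -/

/-- Commands: programs whose only loops are counting loops `for x < b`. -/
inductive Cmd where
  | skip
  | assign (x : ℕ) (e : Expr)
  | store (a : ℕ) (i e : Expr)
  | seq (c d : Cmd)
  | ite (e : Expr) (c d : Cmd)
  | for (x b : ℕ) (c : Cmd)

/-- Writing a register. -/
def State.setR (s : State) (x v : ℕ) : State := ⟨Function.update s.reg x v, s.arr⟩

/-- Writing an array cell. -/
def State.setA (s : State) (a i v : ℕ) : State :=
  ⟨s.reg, Function.update s.arr a (Function.update (s.arr a) i v)⟩

@[simp] theorem State.setR_reg (s : State) (x v y : ℕ) :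
    (s.setR x v).reg y = if y = x then v else s.reg y := by
  simp [State.setR, Function.update_apply]

@[simp] theorem State.setR_arr (s : State) (x v : ℕ) : (s.setR x v).arr = s.arr := rfl

@[simp] theorem State.setA_reg (s : State) (a i v : ℕ) : (s.setA a i v).reg = s.reg := rfl

theorem State.setA_arr (s : State) (a i v b j : ℕ) :
    (s.setA a i v).arr b j = if b = a ∧ j = i then v else s.arr b j := by
  by_cases h : b = a
  · subst h; simp [State.setA, Function.update_apply]
  · simp [State.setA, h]

@[simp] theorem State.setA_arr_self (s : State) (a i v j : ℕ) :
    (s.setA a i v).arr a j = if j = i then v else s.arr a j := by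
  simp [State.setA_arr]

theorem State.setA_arr_of_ne (s : State) {a b : ℕ} (i v : ℕ) (h : b ≠ a) :
    (s.setA a i v).arr b = s.arr b := by
  simp [State.setA, h]

/-- The states at the beginnings of the rounds of a counting loop. -/
def loopState (f : State → State) (x : ℕ) (s : State) : ℕ → State
  | 0 => s.setR x 0
  | i + 1 => (f (loopState f x s i)).setR x (i + 1)

namespace Cmd

/-- The underlying program. -/
def compile : Cmd → Prog
  | skip => .skip
  | assign x e => .assign x e
  | store a i e => .store a i e
  | seq c d => .seq c.compile d.compile
  | ite e c d => .ite e c.compile d.compile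
  | .for x b c => .seq (.assign x (.const 0)) (.loop (.lt (.var x) (.var b))
      (.seq c.compile (.assign x (.add (.var x) (.const 1)))))

/-- The state transformation computed by a command. -/
def run : Cmd → State → State
  | skip, s => s
  | assign x e, s => s.setR x (e.eval s)
  | store a i e, s => s.setA a (i.eval s) (e.eval s)
  | seq c d, s => d.run (c.run s)
  | ite e c d, s => if e.eval s ≠ 0 then c.run s else d.run s
  | .for x b c, s => loopState c.run x s (s.reg b)

/-- Does the command write register `y`? -/
def wreg (y : ℕ) : Cmd → Bool
  | skip => false
  | assign x _ => x == y
  | store _ _ _ => false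
  | seq c d => c.wreg y || d.wreg y
  | ite _ c d => c.wreg y || d.wreg y
  | .for x _ c => x == y || c.wreg y

/-- Does the command write array `y`? -/
def warr (y : ℕ) : Cmd → Bool
  | skip => false
  | assign _ _ => false
  | store a _ _ => a == y
  | seq c d => c.warr y || d.warr y
  | ite _ c d => c.warr y || d.warr y
  | .for _ _ c => c.warr y

/-- Loop variables and loop bounds are not written inside the loop. -/
def wf : Cmd → Bool
  | seq c d => c.wf && d.wf
  | ite _ c d => c.wf && d.wf
  | .for x b c => x != b && !c.wreg x && !c.wreg b && c.wf
  | _ => true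

/-- Every loop bound met during the run from `s` is at most `M`. -/
def Bnd (M : ℕ) : Cmd → State → Prop
  | seq c d, s => c.Bnd M s ∧ d.Bnd M (c.run s)
  | ite e c d, s => (e.eval s ≠ 0 → c.Bnd M s) ∧ (e.eval s = 0 → d.Bnd M s)
  | .for x b c, s => s.reg b ≤ M ∧ ∀ i < s.reg b, c.Bnd M (loopState c.run x s i)
  | _, _ => True

/-- All loop bounds are registers from `l`, and these are never written. -/
def boundsIn (l : List ℕ) : Cmd → Bool
  | assign x _ => !l.contains x
  | seq c d => c.boundsIn l && d.boundsIn l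
  | ite _ c d => c.boundsIn l && d.boundsIn l
  | .for x b c => l.contains b && !l.contains x && c.boundsIn l
  | _ => true

/-- The constant factor of the running time. -/
def weight : Cmd → ℕ
  | skip => 1
  | assign _ e => e.cost + 1
  | store _ i e => i.cost + e.cost + 1
  | seq c d => c.weight + d.weight
  | ite e c d => e.cost + 1 + c.weight + d.weight
  | .for _ _ c => c.weight + 14

/-- The degree of the running time. -/
def depth : Cmd → ℕ
  | seq c d => c.depth + d.depth
  | ite _ c d => c.depth + d.depth
  | .for _ _ c => c.depth + 1
  | _ => 0

/-! ### What a command leaves unchanged -/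

theorem run_reg {y : ℕ} : ∀ (c : Cmd) (s : State), c.wreg y = false → (c.run s).reg y = s.reg y
  | skip, s, _ => rfl
  | assign x e, s, h => by
      have : y ≠ x := by rintro rfl; simp [wreg] at h
      simp [run, this]
  | store a i e, s, _ => rfl
  | seq c d, s, h => by
      simp only [wreg, Bool.or_eq_false_iff] at h
      rw [run, run_reg d _ h.2, run_reg c _ h.1]
  | ite e c d, s, h => by
      simp only [wreg, Bool.or_eq_false_iff] at h
      rw [run]; split_ifs
      · exact run_reg c _ h.1
      · exact run_reg d _ h.2
  | .for x b c, s, h => by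
      simp only [wreg, Bool.or_eq_false_iff, beq_eq_false_iff_ne] at h
      have : ∀ i, (loopState c.run x s i).reg y = s.reg y := by
        intro i
        induction i with
        | zero => simp [loopState, h.1.symm]
        | succ i ih => simp [loopState, h.1.symm, run_reg c _ h.2, ih]
      exact this _

theorem run_arr {y : ℕ} : ∀ (c : Cmd) (s : State), c.warr y = false → (c.run s).arr y = s.arr y
  | skip, s, _ => rfl
  | assign x e, s, h => rfl
  | store a i e, s, h => by
      have : y ≠ a := by rintro rfl; simp [warr] at h
      exact State.setA_arr_of_ne _ _ _ this
  | seq c d, s, h => by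
      simp only [warr, Bool.or_eq_false_iff] at h
      rw [run, run_arr d _ h.2, run_arr c _ h.1]
  | ite e c d, s, h => by
      simp only [warr, Bool.or_eq_false_iff] at h
      rw [run]; split_ifs
      · exact run_arr c _ h.1
      · exact run_arr d _ h.2
  | .for x b c, s, h => by
      simp only [warr] at h
      have : ∀ i, (loopState c.run x s i).arr y = s.arr y := by
        intro i
        induction i with
        | zero => simp [loopState]
        | succ i ih => simp [loopState, run_arr c _ h, ih]
      exact this _

theorem loopState_reg_self (f : State → State) (x : ℕ) (s : State) (i : ℕ) :
    (loopState f x s i).reg x = i := by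
  cases i <;> simp [loopState]

/-- `s'` agrees with `s` on what a loop over `x` with body `c` does not write. -/
structure Frame (c : Cmd) (x : ℕ) (s s' : State) : Prop where
  reg' : ∀ y, y ≠ x → c.wreg y = false → s'.reg y = s.reg y
  arr' : ∀ a, c.warr a = false → s'.arr a = s.arr a

theorem Frame.reg {c : Cmd} {x : ℕ} {s s' : State} (h : Frame c x s s') (y : ℕ)
    (hy : (y != x && !c.wreg y) = true := by rfl) : s'.reg y = s.reg y := by
  simp only [Bool.and_eq_true, bne_iff_ne, Bool.not_eq_true'] at hy
  exact h.reg' y hy.1 hy.2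

theorem Frame.arr {c : Cmd} {x : ℕ} {s s' : State} (h : Frame c x s s') (y : ℕ)
    (hy : c.warr y = false := by rfl) : s'.arr y = s.arr y := h.arr' y hy

theorem frame_loopState (c : Cmd) (x : ℕ) (s : State) (i : ℕ) :
    Frame c x s (loopState c.run x s i) := by
  induction i with
  | zero => exact ⟨fun y hy _ => by simp [loopState, hy], fun a _ => rfl⟩
  | succ i ih =>
    exact ⟨fun y hy h => by simp [loopState, hy, run_reg c _ h, ih.reg' y hy h],
      fun a h => by simp [loopState, run_arr c _ h, ih.arr' a h]⟩

/-- The invariant rule for counting loops. -/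
theorem run_for_inv (I : ℕ → State → Prop) {c : Cmd} {x b : ℕ} {s : State}
    (h0 : I 0 (s.setR x 0))
    (hs : ∀ i s', i < s.reg b → s'.reg x = i → Frame c x s s' → I i s' →
      I (i + 1) ((c.run s').setR x (i + 1))) :
    I (s.reg b) ((Cmd.for x b c).run s) := by
  have : ∀ i, i ≤ s.reg b → I i (loopState c.run x s i) := by
    intro i
    induction i with
    | zero => exact fun _ => h0
    | succ i ih =>
      exact fun hi => hs i _ hi (loopState_reg_self _ _ _ _) (frame_loopState _ _ _ _)
        (ih (by omega))
  exact this _ le_rfl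

/-- Serves the outermost loop, whose body changes the loop bounds `x₁` and `x₂` from size to size:
they can only be bounded with the help of an invariant. -/
theorem Bnd_for {M : ℕ} (I : ℕ → State → Prop) {c : Cmd} {x b : ℕ} {s : State}
    (hb : s.reg b ≤ M) (h0 : I 0 (s.setR x 0))
    (hs : ∀ i s', i < s.reg b → s'.reg x = i → Frame c x s s' → I i s' →
      c.Bnd M s' ∧ I (i + 1) ((c.run s').setR x (i + 1))) :
    (Cmd.for x b c).Bnd M s := by
  have : ∀ i, i ≤ s.reg b → I i (loopState c.run x s i) := by
    intro i
    induction i with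
    | zero => exact fun _ => h0
    | succ i ih =>
      exact fun hi => (hs i _ hi (loopState_reg_self _ _ _ _) (frame_loopState _ _ _ _)
        (ih (by omega))).2
  exact ⟨hb, fun i hi => (hs i _ hi (loopState_reg_self _ _ _ _) (frame_loopState _ _ _ _)
    (this i hi.le)).1⟩

theorem wreg_of_boundsIn {l : List ℕ} {r : ℕ} (hr : r ∈ l) :
    ∀ c : Cmd, c.boundsIn l = true → c.wreg r = false
  | skip, _ => rfl
  | assign x e, h => by
      simp only [boundsIn, Bool.not_eq_true', List.contains_eq_mem, decide_eq_false_iff_not] at h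
      simp only [wreg, beq_eq_false_iff_ne]
      rintro rfl; exact h hr
  | store _ _ _, _ => rfl
  | seq c d, h => by
      simp only [boundsIn, Bool.and_eq_true] at h
      simp [wreg, wreg_of_boundsIn hr c h.1, wreg_of_boundsIn hr d h.2]
  | ite e c d, h => by
      simp only [boundsIn, Bool.and_eq_true] at h
      simp [wreg, wreg_of_boundsIn hr c h.1, wreg_of_boundsIn hr d h.2]
  | .for x b c, h => by
      simp only [boundsIn, Bool.and_eq_true, Bool.not_eq_true', List.contains_eq_mem,
        decide_eq_false_iff_not] at h
      simp only [wreg, wreg_of_boundsIn hr c h.2, Bool.or_false, beq_eq_false_iff_ne]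
      rintro rfl; exact h.1.2 hr

/-- Where the bounding registers are never written, a syntactic check suffices: bounding them at the
start bounds every loop. -/
theorem Bnd_of_boundsIn {l : List ℕ} {M : ℕ} :
    ∀ (c : Cmd) (s : State), c.boundsIn l = true → (∀ r ∈ l, s.reg r ≤ M) → c.Bnd M s
  | skip, _, _, _ => trivial
  | assign _ _, _, _, _ => trivial
  | store _ _ _, _, _, _ => trivial
  | seq c d, s, h, hl => by
      simp only [boundsIn, Bool.and_eq_true] at h
      refine ⟨Bnd_of_boundsIn c s h.1 hl, Bnd_of_boundsIn d _ h.2 fun r hr => ?_⟩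
      rw [run_reg c s (wreg_of_boundsIn hr c h.1)]; exact hl r hr
  | ite e c d, s, h, hl => by
      simp only [boundsIn, Bool.and_eq_true] at h
      exact ⟨fun _ => Bnd_of_boundsIn c s h.1 hl, fun _ => Bnd_of_boundsIn d s h.2 hl⟩
  | .for x b c, s, h, hl => by
      simp only [boundsIn, Bool.and_eq_true, Bool.not_eq_true', List.contains_eq_mem,
        decide_eq_true_eq, decide_eq_false_iff_not] at h
      refine ⟨hl b h.1.1, fun i _ => Bnd_of_boundsIn c _ h.2 fun r hr => ?_⟩
      rw [(frame_loopState c x s i).reg' r (by rintro rfl; exact h.1.2 hr)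
        (wreg_of_boundsIn hr c h.2)]
      exact hl r hr

/-- Running time: a command with loop bounds at most `M` takes polynomially many steps. -/
theorem exec {M : ℕ} : ∀ (c : Cmd) (s : State), c.wf = true → c.Bnd M s →
    ∃ t, Exec c.compile s t (c.run s) ∧ t ≤ c.weight * (M + 1) ^ c.depth
  | skip, s, _, _ => ⟨1, .skip s, by simp [weight, depth]⟩
  | assign x e, s, _, _ => ⟨_, .assign x e s, by simp [weight, depth]⟩
  | store a i e, s, _, _ => ⟨_, .store a i e s, by simp [weight, depth]⟩
  | seq c d, s, h, hb => by
      simp only [wf, Bool.and_eq_true] at h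
      obtain ⟨t, ht, htb⟩ := exec c s h.1 hb.1
      obtain ⟨t', ht', htb'⟩ := exec d _ h.2 hb.2
      refine ⟨_, .seq ht ht', ?_⟩
      have h1 : (M + 1) ^ c.depth ≤ (M + 1) ^ (c.depth + d.depth) :=
        Nat.pow_le_pow_right (by omega) (by omega)
      have h2 : (M + 1) ^ d.depth ≤ (M + 1) ^ (c.depth + d.depth) :=
        Nat.pow_le_pow_right (by omega) (by omega)
      calc t + t' ≤ c.weight * (M + 1) ^ c.depth + d.weight * (M + 1) ^ d.depth := by omega
        _ ≤ c.weight * (M + 1) ^ (c.depth + d.depth) + d.weight * (M + 1) ^ (c.depth + d.depth) := by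
            gcongr
        _ = _ := by simp only [weight, depth]; ring
  | ite e c d, s, h, hb => by
      simp only [wf, Bool.and_eq_true] at h
      have h1 : (M + 1) ^ c.depth ≤ (M + 1) ^ (c.depth + d.depth) :=
        Nat.pow_le_pow_right (by omega) (by omega)
      have h2 : (M + 1) ^ d.depth ≤ (M + 1) ^ (c.depth + d.depth) :=
        Nat.pow_le_pow_right (by omega) (by omega)
      have h3 : 1 ≤ (M + 1) ^ (c.depth + d.depth) := Nat.one_le_pow _ _ (by omega)
      by_cases he : e.eval s = 0
      · obtain ⟨t, ht, htb⟩ := exec d s h.2 (hb.2 he)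
        refine ⟨e.cost + 1 + t, ?_, ?_⟩
        · rw [run, if_neg (by simpa using he)]; exact .ite_false he ht
        · have := htb.trans (Nat.mul_le_mul_left d.weight h2)
          simp only [weight, depth]
          nlinarith [Nat.zero_le (c.weight * (M + 1) ^ (c.depth + d.depth)),
            Nat.mul_le_mul_left (e.cost + 1) h3]
      · obtain ⟨t, ht, htb⟩ := exec c s h.1 (hb.1 he)
        refine ⟨e.cost + 1 + t, ?_, ?_⟩
        · rw [run, if_pos he]; exact .ite_true he ht
        · have := htb.trans (Nat.mul_le_mul_left c.weight h1)
          simp only [weight, depth]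
          nlinarith [Nat.zero_le (d.weight * (M + 1) ^ (c.depth + d.depth)),
            Nat.mul_le_mul_left (e.cost + 1) h3]
  | .for x b c, s, h, hb => by
      simp only [wf, Bool.and_eq_true, bne_iff_ne, Bool.not_eq_true'] at h
      obtain ⟨⟨⟨hxb, hx⟩, hb'⟩, hc⟩ := h
      set T := c.weight * (M + 1) ^ c.depth with hT
      -- `j` counts the rounds still to come. A round costs 4 for the test, 4 for the increment and
      -- at most `T` for the body; the final, failing test costs 4.
      have key : ∀ j i, i + j = s.reg b → ∃ t,
          Exec (.loop (.lt (.var x) (.var b))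
            (.seq c.compile (.assign x (.add (.var x) (.const 1)))))
            (loopState c.run x s i) t (loopState c.run x s (s.reg b)) ∧ t ≤ 4 + j * (8 + T) := by
        intro j
        induction j with
        | zero =>
          intro i hi
          have hi' : i = s.reg b := by omega
          refine ⟨4, ?_, by simp⟩
          rw [← hi']
          refine .loop_false ?_
          have := (frame_loopState c x s i).reg' b hxb.symm hb'
          simp only [Expr.eval, loopState_reg_self, this]
          simp [hi']
        | succ j ih =>
          intro i hi
          obtain ⟨t, ht, htb⟩ := ih (i + 1) (by omega)
          obtain ⟨u, hu, hub⟩ := exec c (loopState c.run x s i) hc (hb.2 i (by omega))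
          refine ⟨_, .loop_true ?_ (.seq hu (.assign x _ _)) (s'' := loopState c.run x s (s.reg b))
            (t' := t) ?_, ?_⟩
          · simp [Expr.eval, loopState_reg_self,
              (frame_loopState c x s i).reg' b hxb.symm hb']; omega
          · convert ht using 1
            simp [loopState, State.setR, Expr.eval, run_reg c _ hx, loopState_reg_self]
          · simp only [Expr.cost]
            nlinarith
      obtain ⟨t, ht, htb⟩ := key (s.reg b) 0 (by omega)
      refine ⟨_, .seq (.assign x (.const 0) s) ht, ?_⟩
      have hM := hb.1
      have h1 : s.reg b * (8 + T) ≤ M * (8 + T) := Nat.mul_le_mul_right _ hM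
      have h2 : 1 ≤ (M + 1) ^ c.depth := Nat.one_le_pow _ _ (by omega)
      simp only [weight, depth, Expr.cost, pow_succ]
      -- With 2 steps for the initialization the total is at most 6 + M * (8 + T); the 14 in
      -- `weight` covers 6 + 8M.
      have h3 : (M + 1) * 14 ≤ (M + 1) * 14 * (M + 1) ^ c.depth := Nat.le_mul_of_pos_right _ h2
      nlinarith

end Cmd

/-! ### Structure of block graphs -/

theorem reflTransGen_of_steps {α : Type*} {r : α → α → Prop} (x : ℕ → α) {a b : ℕ} (hab : a ≤ b)
    (h : ∀ i, a ≤ i → i < b → r (x i) (x (i + 1))) : ReflTransGen r (x a) (x b) := by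
  induction b, hab using Nat.le_induction with
  | base => exact .refl
  | succ b hab ih => exact (ih fun i h1 h2 => h i h1 (by omega)).tail (h b hab (by omega))

theorem reflTransGen_of_steps_down {α : Type*} {r : α → α → Prop} (x : ℕ → α) {a b : ℕ}
    (hab : a ≤ b) (h : ∀ i, a ≤ i → i < b → r (x (i + 1)) (x i)) :
    ReflTransGen r (x b) (x a) := by
  induction b, hab using Nat.le_induction with
  | base => exact .refl
  | succ b hab ih => exact .head (h b hab (by omega)) (ih fun i h1 h2 => h i h1 (by omega))

theorem preconnected_induce_of_reflTransGen {V : Type*} (G : SimpleGraph V) (S : Set V) {r : V}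
    (hr : r ∈ S) (h : ∀ y ∈ S, ReflTransGen (fun a b => G.Adj a b ∧ b ∈ S) r y) :
    (G.induce S).Preconnected := by
  have key : ∀ y, ReflTransGen (fun a b => G.Adj a b ∧ b ∈ S) r y → ∃ hy : y ∈ S,
      (G.induce S).Reachable ⟨r, hr⟩ ⟨y, hy⟩ := by
    intro y hy
    induction hy with
    | refl => exact ⟨hr, .rfl⟩
    | @tail b c _ hbc ih =>
      obtain ⟨hb, hreach⟩ := ih
      have : (G.induce S).Adj ⟨b, hb⟩ ⟨c, hbc.2⟩ := hbc.1
      exact ⟨hbc.2, hreach.trans this.reachable⟩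
  intro a b
  exact (key a (h a a.2)).2.symm.trans (key b (h b b.2)).2

/-- In a block graph, two neighbours of `s` that are connected without `s` are adjacent. -/
theorem IsBlockGraph.adj_of_reflTransGen {V : Type*} [Finite V] {G : SimpleGraph V}
    (hG : IsBlockGraph G) {s u v : V} (hsu : G.Adj s u) (hsv : G.Adj s v) (huv : u ≠ v)
    (h : ReflTransGen (fun a b => G.Adj a b ∧ b ≠ s) u v) : G.Adj u v := by
  classical
  -- `G` without the edges at `s`. Keeping the vertex type lets a path in `H` be used in `G`
  -- directly.
  let H : SimpleGraph V :=
    { Adj := fun a b => G.Adj a b ∧ a ≠ s ∧ b ≠ s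
      symm := ⟨fun a b h => ⟨h.1.symm, h.2.2, h.2.1⟩⟩
      loopless := ⟨fun a h => G.loopless.irrefl a h.1⟩ }
  have key : ∀ y, ReflTransGen (fun a b => G.Adj a b ∧ b ≠ s) u y → y ≠ s ∧ H.Reachable u y := by
    intro y hy
    induction hy with
    | refl => exact ⟨hsu.ne', .rfl⟩
    | @tail b c _ hbc ih =>
      have : H.Adj b c := ⟨hbc.1, ih.1, hbc.2⟩
      exact ⟨hbc.2, ih.2.trans this.reachable⟩
  obtain ⟨q, hq⟩ := (key v h).2.exists_isPath
  set l := q.length with hl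
  set x := q.getVert with hx
  have hadj : ∀ i < l, H.Adj (x i) (x (i + 1)) := fun i hi => q.adj_getVert_succ hi
  have hx0 : x 0 = u := q.getVert_zero
  have hxl : x l = v := q.getVert_length
  have hinj : ∀ i j, i ≤ l → j ≤ l → x i = x j → i = j := fun i j hi hj hij =>
    hq.getVert_injOn hi hj hij
  have hxs : ∀ i ≤ l, x i ≠ s := by
    intro i hi
    cases i with
    | zero => rw [hx0]; exact hsu.ne'
    | succ i => exact (hadj i hi).2.2
  -- The path from `u` to `v` closes to a cycle through `s`, and a cycle is 2-connected.
  let S : Set V := {y | y = s ∨ ∃ i ≤ l, y = x i}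
  have hxS : ∀ i ≤ l, x i ∈ S := fun i hi => Or.inr ⟨i, hi, rfl⟩
  have hsS : s ∈ S := Or.inl rfl
  have hS : IsTwoConnected (G.induce S) := by
    refine ⟨?_, ?_⟩
    · have : Nonempty S := ⟨⟨s, hsS⟩⟩
      refine ⟨preconnected_induce_of_reflTransGen G S hsS ?_⟩
      rintro y (rfl | ⟨j, hj, rfl⟩)
      · exact .refl
      · refine .head ⟨hx0 ▸ hsu, hxS 0 (by omega)⟩ (reflTransGen_of_steps x (Nat.zero_le j) ?_)
        exact fun i _ hi => ⟨(hadj i (by omega)).1, hxS _ (by omega)⟩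
    -- If `s` is removed, the path remains. If a path vertex is removed, the earlier ones are
    -- reached from `s` through `u` and the later ones through `v`.
    · rintro ⟨c, hcS⟩
      let X : ℕ → S := fun i => if h : i ≤ l then ⟨x i, hxS i h⟩ else ⟨s, hsS⟩
      have hX : ∀ i (h : i ≤ l), X i = ⟨x i, hxS i h⟩ := fun i h => dif_pos h
      unfold IsCutVertex
      rw [not_not]
      have hXadj : ∀ i < l, (G.induce S).Adj (X i) (X (i + 1)) := by
        intro i hi
        rw [hX i hi.le, hX (i + 1) hi]; exact (hadj i hi).1
      have hXne : ∀ i ≤ l, ∀ w : S, x i ≠ w → X i ∈ ({w}ᶜ : Set S) := by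
        intro i hi w hw h
        apply hw; rw [← Set.mem_singleton_iff.1 h, hX i hi]
      rcases id hcS with hc | ⟨k, hk, hc⟩
      · refine preconnected_induce_of_reflTransGen _ _ (r := X 0)
          (hXne 0 (by omega) _ (hc ▸ hxs 0 (by omega))) ?_
        rintro ⟨y, hyS⟩ hy
        rcases id hyS with rfl | ⟨j, hj, rfl⟩
        · exact absurd (Subtype.ext hc.symm) hy
        · rw [← hX j hj]
          refine reflTransGen_of_steps X (Nat.zero_le j) fun i _ hi => ⟨hXadj i (by omega), ?_⟩
          refine hXne _ (by omega) _ ?_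
          exact fun h => hxs (i + 1) (by omega) (h.trans hc)
      · have hcs : c ≠ s := by rw [hc]; exact hxs k hk
        refine preconnected_induce_of_reflTransGen _ _ (r := ⟨s, hsS⟩)
          (fun h => hcs (congrArg Subtype.val h).symm) ?_
        rintro ⟨y, hyS⟩ hy
        rcases id hyS with rfl | ⟨j, hj, rfl⟩
        · exact .refl
        · have hjk : j ≠ k := by
            rintro rfl; exact hy (Subtype.ext hc.symm)
          rw [← hX j hj]
          have hne : ∀ i ≤ l, i ≠ k → X i ∈ ({⟨c, hcS⟩}ᶜ : Set S) :=
            fun i hi hik => hXne i hi _ fun h => hik (hinj i k hi hk (h.trans hc))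
          rcases lt_or_gt_of_ne hjk with hlt | hlt
          · refine .head ⟨?_, hne 0 (by omega) (by omega)⟩
              (reflTransGen_of_steps X (Nat.zero_le j) fun i _ hi =>
                ⟨hXadj i (by omega), hne _ (by omega) (by omega)⟩)
            rw [hX 0 (by omega)]
            change G.Adj s (x 0)
            rw [hx0]; exact hsu
          · refine .head ⟨?_, hne l (by omega) (by omega)⟩
              (reflTransGen_of_steps_down X hj fun i _ hi =>
                ⟨(hXadj i (by omega)).symm, hne _ (by omega) (by omega)⟩)
            rw [hX l le_rfl]
            change G.Adj s (x l)
            rw [hxl]; exact hsv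
  -- The cycle lies in a block, and the block is a clique that contains `u` and `v`.
  obtain ⟨B, hSB, hB⟩ := Finite.exists_le_maximal
    (p := fun S : Set V => IsTwoConnected (G.induce S)) hS
  refine hG B hB (hSB ?_) (hSB ?_) huv
  · exact hx0 ▸ hxS 0 (by omega)
  · exact hxl ▸ hxS l le_rfl

/-- A relation on `{0, …, n - 1}` as a relation on the natural numbers. -/
def natRel {n : ℕ} (R : Fin n → Fin n → Prop) (u v : ℕ) : Prop :=
  ∃ (hu : u < n) (hv : v < n), R ⟨u, hu⟩ ⟨v, hv⟩

/-- Deleting the set `W` leaves a graph in which any two neighbours of a vertex `s` that are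
connected without `s` are adjacent. -/
def LeavesBlocks (A : ℕ → ℕ → Prop) (W : ℕ → Prop) : Prop :=
  ∀ s u v, ¬ W s → ¬ W u → ¬ W v → A s u → A s v → u ≠ v →
    ReflTransGen (fun a b => A a b ∧ ¬ W b ∧ b ≠ s) u v → A u v

/-- The rest of the proof uses only this consequence of being a block graph, and the program tests
it instead of the definition. No converse is needed: the program may stop at any set with this
property. -/
theorem leavesBlocks_of_isBlockGraph {n : ℕ} {G : SimpleGraph (Fin n)} {X : Finset (Fin n)}
    (hX : IsBlockGraph (G.induce ((X : Set (Fin n))ᶜ))) {W : ℕ → Prop}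
    (hW : ∀ x : Fin n, W x ↔ x ∈ X) : LeavesBlocks (natRel G.Adj) W := by
  rintro s u v hs hu hv ⟨hsn, hun, hsu⟩ ⟨_, hvn, hsv⟩ huv h
  have hmem : ∀ (y : ℕ) (hy : y < n), ¬ W y → (⟨y, hy⟩ : Fin n) ∈ ((X : Set (Fin n))ᶜ) :=
    fun y hy hWy hmem => hWy ((hW ⟨y, hy⟩).2 hmem)
  have key : ∀ y, ReflTransGen (fun a b => natRel G.Adj a b ∧ ¬ W b ∧ b ≠ s) u y →
      ∃ (hy : y < n) (hWy : ¬ W y), ReflTransGen (fun a b : ((X : Set (Fin n))ᶜ : Set (Fin n)) =>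
        (G.induce ((X : Set (Fin n))ᶜ)).Adj a b ∧ b ≠ ⟨⟨s, hsn⟩, hmem s hsn hs⟩)
        ⟨⟨u, hun⟩, hmem u hun hu⟩ ⟨⟨y, hy⟩, hmem y hy hWy⟩ := by
    intro y hy
    induction hy with
    | refl => exact ⟨hun, hu, .refl⟩
    | @tail b c _ hbc ih =>
      obtain ⟨hb, hWb, hr⟩ := ih
      obtain ⟨⟨_, hc, hadj⟩, hWc, hcs⟩ := hbc
      exact ⟨hc, hWc, hr.tail ⟨hadj, fun h => hcs (congrArg (fun z => (z.1 : ℕ)) h)⟩⟩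
  obtain ⟨_, _, hr⟩ := key v h
  exact ⟨hun, hvn, hX.adj_of_reflTransGen (s := ⟨⟨s, hsn⟩, hmem s hsn hs⟩)
    (u := ⟨⟨u, hun⟩, hmem u hun hu⟩) (v := ⟨⟨v, hvn⟩, hmem v hvn hv⟩) hsu hsv
    (fun h => huv (congrArg (fun z => (z.1 : ℕ)) h)) hr⟩

/-- `f` is a neighbour of `s` from which `t` can be reached without meeting `W`, `s` or another
neighbour of `s`. -/
def IsNext (A : ℕ → ℕ → Prop) (W : ℕ → Prop) (s t f : ℕ) : Prop :=
  A s f ∧ ¬ W f ∧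
    ReflTransGen (fun a b => A a b ∧ (b = f ∨ ¬ W b ∧ b ≠ s ∧ ¬ A s b)) f t

/-- The last neighbour of `p a` on the segment qualifies, since the segment meets neither `p a` nor
a neighbour of it afterwards. -/
theorem exists_isNext {A : ℕ → ℕ → Prop} {W : ℕ → Prop} {p : ℕ → ℕ} {a b : ℕ} (hab : a < b)
    (hinj : ∀ i, a ≤ i → i ≤ b → p i = p a → i = a)
    (hA : ∀ i, a ≤ i → i < b → A (p i) (p (i + 1))) (hW : ∀ i, a ≤ i → i ≤ b → ¬ W (p i)) :
    ∃ f, IsNext A W (p a) (p b) f := by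
  classical
  have hex : ∃ i, a < i ∧ i ≤ b ∧ A (p a) (p i) := ⟨a + 1, by omega, hab, hA a le_rfl hab⟩
  obtain ⟨i, ⟨hai, hib, hi⟩, hmax⟩ : ∃ i, (a < i ∧ i ≤ b ∧ A (p a) (p i)) ∧
      ∀ j, i < j → j ≤ b → ¬ A (p a) (p j) := by
    obtain ⟨i₀, hi₀⟩ := hex
    have hspec := Nat.findGreatest_spec (P := fun i => a < i ∧ i ≤ b ∧ A (p a) (p i)) hi₀.2.1 hi₀
    refine ⟨_, hspec, fun j hj hjb hA' => ?_⟩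
    have := Nat.le_findGreatest (P := fun i => a < i ∧ i ≤ b ∧ A (p a) (p i)) hjb
      ⟨hspec.1.trans hj, hjb, hA'⟩
    omega
  refine ⟨p i, hi, hW i hai.le hib, reflTransGen_of_steps p hib fun j h1 h2 =>
    ⟨hA j (by omega) h2, Or.inr ⟨hW _ (by omega) (by omega), fun h => ?_,
      hmax _ (by omega) (by omega)⟩⟩⟩
  have := hinj (j + 1) (by omega) (by omega) h
  omega

/-- A path through the remaining graph passes through the next vertex, and up to there it only
meets common neighbours. -/
theorem IsNext.mem_path {A : ℕ → ℕ → Prop} {W : ℕ → Prop} {p : ℕ → ℕ} {a b f : ℕ}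
    (hsymm : ∀ u v, A u v → A v u) (hirr : ∀ u, ¬ A u u)
    (hL : LeavesBlocks A W) (hab : a < b)
    (hinj : ∀ i j, a ≤ i → i ≤ b → a ≤ j → j ≤ b → p i = p j → i = j)
    (hA : ∀ i, a ≤ i → i < b → A (p i) (p (i + 1))) (hW : ∀ i, a ≤ i → i ≤ b → ¬ W (p i))
    (hf : IsNext A W (p a) (p b) f) :
    ∃ i, a < i ∧ i ≤ b ∧ p i = f ∧ ∀ j, a < j → j < i → A (p a) (p j) ∧ A (p j) f := by
  obtain ⟨haf, hWf, hft⟩ := hf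
  have hfa : f ≠ p a := by rintro rfl; exact hirr _ haf
  -- from `f` to `p b` avoiding a vertex of the closed neighbourhood of `p a` other than `f`
  have avoid : ∀ c, (c = p a ∨ A (p a) c) → c ≠ f →
      ReflTransGen (fun a b => A a b ∧ ¬ W b ∧ b ≠ c) f (p b) := by
    intro c hc hcf
    refine ReflTransGen.mono (fun x y hxy => ⟨hxy.1, ?_⟩) _ _ hft
    rcases hxy.2 with rfl | ⟨h1, h2, h3⟩
    · exact ⟨hWf, hcf.symm⟩
    · refine ⟨h1, ?_⟩
      rintro rfl
      exact hc.elim h2 h3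
  -- The path visits `p i` only once, so its part after position `i`, walked backwards from `p b`,
  -- avoids `p i`.
  have back : ∀ i j, a ≤ i → i < j → j ≤ b →
      ReflTransGen (fun a b => A a b ∧ ¬ W b ∧ b ≠ p i) (p b) (p j) := by
    intro i j hai hij hjb
    refine reflTransGen_of_steps_down p hjb fun m h1 h2 =>
      ⟨hsymm _ _ (hA m (by omega) h2), hW _ (by omega) (by omega), fun h => ?_⟩
    have := hinj _ _ (by omega) (by omega) hai (by omega) h
    omega
  -- As long as `f` has not occurred, the walk from `f` to `p b` and back to `p (j + 1)` avoids `p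
  -- j`. As `f`, `p a` and `p (j + 1)` are neighbours of `p j`, this makes `p (j + 1)` adjacent to
  -- the other two.
  have main : ∀ j, a < j → j ≤ b → (∃ i, a < i ∧ i ≤ j ∧ p i = f) ∨
      (A (p a) (p j) ∧ A (p j) f) := by
    intro j haj
    induction j, haj using Nat.le_induction with
    | base =>
      intro hjb
      have h1 := hA a le_rfl hab
      by_cases hpf : p (a + 1) = f
      · exact Or.inl ⟨a + 1, by omega, le_rfl, hpf⟩
      · refine Or.inr ⟨h1, ?_⟩
        exact hsymm _ _ (hL (p a) f (p (a + 1)) (hW a le_rfl hab.le) hWf (hW _ (by omega) hjb) haf h1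
          (Ne.symm hpf) ((avoid _ (Or.inl rfl) hfa.symm).trans (back a _ le_rfl (by omega) hjb)))
    | succ j haj ih =>
      intro hjb
      rcases ih (by omega) with ⟨i, h1, h2, h3⟩ | ⟨h1, h2⟩
      · exact Or.inl ⟨i, h1, by omega, h3⟩
      by_cases hpf : p (j + 1) = f
      · exact Or.inl ⟨j + 1, by omega, le_rfl, hpf⟩
      have haj' : a < j := haj
      have hWj := hW j haj'.le (by omega)
      have hstep := hA j haj'.le (by omega)
      have hjf : p j ≠ f := by rintro h; rw [h] at h2; exact hirr _ h2
      have hr := (avoid (p j) (Or.inr h1) hjf).trans (back j (j + 1) haj'.le (by omega) hjb)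
      have hW' := hW (j + 1) (by omega) hjb
      refine Or.inr ⟨?_, ?_⟩
      · refine hL (p j) _ _ hWj (hW a le_rfl hab.le) hW' (hsymm _ _ h1) hstep (fun h => ?_)
          (.head ⟨haf, hWf, hjf.symm⟩ hr)
        have := hinj _ _ le_rfl (by omega) (by omega) hjb h
        omega
      · exact hsymm _ _ (hL (p j) _ _ hWj hWf hW' h2 hstep (Ne.symm hpf) hr)
  -- If `f` did not occur, `p b` would be adjacent to both `p a` and `f`. But the walk that
  -- witnesses `IsNext` ends in `f` or in a non-neighbour of `p a`.
  have hbf : ∃ i, a < i ∧ i ≤ b ∧ p i = f := by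
    rcases main b hab le_rfl with h | ⟨h1, h2⟩
    · exact h
    · exfalso
      rcases ReflTransGen.cases_tail hft with h | ⟨c, _, _, h | h⟩
      · rw [h] at h2; exact hirr _ h2
      · rw [h] at h2; exact hirr _ h2
      · exact h.2.2 h1
  obtain ⟨i, hai, hib, hi⟩ := hbf
  refine ⟨i, hai, hib, hi, fun j haj hji => ?_⟩
  rcases main j haj (by omega) with ⟨m, h1, h2, h3⟩ | h
  · have := hinj m i (by omega) (by omega) (by omega) hib (h3.trans hi.symm)
    omega
  · exact h

/-- The walk from `u` over `t` to `v` avoids `s`. It follows that the common neighbours of `s` and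
`t` outside of `W` form a clique, which is why a gap can be filled in any order. -/
theorem LeavesBlocks.adj_of_common {A : ℕ → ℕ → Prop} {W : ℕ → Prop} (hL : LeavesBlocks A W)
    (hirr : ∀ u, ¬ A u u) {s t u v : ℕ} (hs : ¬ W s)
    (ht : ¬ W t) (hu : ¬ W u) (hv : ¬ W v) (hsu : A s u) (hsv : A s v)
    (hut : A u t) (htv : A t v) (huv : u ≠ v) (hst : t ≠ s) : A u v :=
  hL s u v hs hu hv hsu hsv huv
    (.head ⟨hut, ht, hst⟩ (.single ⟨htv, hv, by rintro rfl; exact hirr _ hsv⟩))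

/-! ### Solutions as sequences -/

/-- The sequence `p 0, …, p (n - 1)` is a path in `A` that respects `P`. If `P` is reflexive, its
vertices are distinct. -/
structure IsSolution (n : ℕ) (A P : ℕ → ℕ → Prop) (cyc : Prop) (p : ℕ → ℕ) : Prop where
  lt : ∀ i < n, p i < n
  adj : ∀ i, i + 1 < n → A (p i) (p (i + 1))
  ord : ∀ i j, i < j → j < n → ¬ P (p j) (p i)
  closed : cyc → A (p (n - 1)) (p 0)

theorem IsSolution.inj {n : ℕ} {A P : ℕ → ℕ → Prop} {cyc : Prop} {p : ℕ → ℕ}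
    (h : IsSolution n A P cyc p) (hP : ∀ u < n, P u u) {i j : ℕ} (hi : i < n) (hj : j < n)
    (hij : p i = p j) : i = j := by
  rcases lt_trichotomy i j with h1 | h1 | h1
  · exact absurd (hij ▸ hP _ (h.lt i hi)) (h.ord i j h1 hj)
  · exact h1
  · exact absurd (hij ▸ hP _ (h.lt i hi)) (h.ord j i h1 hi)

theorem exists_isSolution_of_walk {n : ℕ} {G : SimpleGraph (Fin n)} {π : Fin n → Fin n → Prop}
    {u v : Fin n} (p : G.Walk u v) (hp : p.IsHamiltonian) (he : Extends p π) (cyc : Prop)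
    (hc : cyc → G.Adj u v) :
    ∃ q, IsSolution n (natRel G.Adj) (natRel π) cyc q := by
  have hlen : p.length + 1 = n := by
    have := hp.length_support; simpa using this
  refine ⟨fun i => (p.getVert i : ℕ), fun i _ => (p.getVert i).2, ?_, ?_, ?_⟩
  · exact fun i hi => ⟨Fin.is_lt _, Fin.is_lt _, p.adj_getVert_succ (by omega)⟩
  · rintro i j hij hj ⟨_, _, h⟩
    have hli : i < p.support.length := by simp; omega
    have hlj : j < p.support.length := by simp; omega
    have := he ⟨j, hlj⟩ ⟨i, hli⟩ (by
      simpa [SimpleGraph.Walk.support_getElem_eq_getVert] using h)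
    simp at this
    omega
  · intro h
    have h1 : n - 1 = p.length := by omega
    refine ⟨Fin.is_lt _, Fin.is_lt _, ?_⟩
    simpa [h1] using (hc h).symm

/-- Reflexivity of `π` makes `q` injective, and an injective self-map of a finite type is
surjective, so the path visits every vertex exactly once. -/
theorem exists_walk_of_isSolution {n : ℕ} (hn : 0 < n) {G : SimpleGraph (Fin n)}
    {π : Fin n → Fin n → Prop} (hπ : ∀ x, π x x) {cyc : Prop} {q : ℕ → ℕ}
    (h : IsSolution n (natRel G.Adj) (natRel π) cyc q) :
    ∃ (u v : Fin n) (p : G.Walk u v), p.IsHamiltonian ∧ (cyc → G.Adj u v) ∧ Extends p π := by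
  let f : Fin n → Fin n := fun i => ⟨q i, h.lt i i.2⟩
  have hf : Function.Injective f := by
    intro i j hij
    exact Fin.ext (h.inj (fun u hu => ⟨hu, hu, hπ _⟩) i.2 j.2 (congrArg Fin.val hij))
  have hne : List.ofFn f ≠ [] := by
    intro h0; have := congrArg List.length h0; simp at this; omega
  have hch : (List.ofFn f).IsChain G.Adj := by
    rw [List.isChain_iff_getElem]
    intro i hi
    simp only [List.length_ofFn] at hi
    obtain ⟨_, _, h'⟩ := h.adj i hi
    simpa [f] using h'
  refine ⟨_, _, SimpleGraph.Walk.ofSupport _ hne hch, ?_, ?_, ?_⟩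
  · intro a
    rw [SimpleGraph.Walk.support_ofSupport]
    refine List.count_eq_one_of_mem (List.nodup_ofFn.2 hf) ?_
    rw [List.mem_ofFn]
    exact (Finite.surjective_of_injective hf) a
  · intro hc
    obtain ⟨_, _, h'⟩ := h.closed hc
    have h1 : (List.ofFn f).head hne = f ⟨0, hn⟩ := by
      rw [List.head_eq_getElem]; simp
    have h2 : (List.ofFn f).getLast hne = f ⟨n - 1, by omega⟩ := by
      rw [List.getLast_eq_getElem]; simp
    rw [h1, h2]
    exact h'.symm
  · intro i j hij
    by_contra hlt
    push Not at hlt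
    have hi := i.2
    simp only [SimpleGraph.Walk.support_ofSupport, List.length_ofFn] at hi
    refine h.ord j i hlt hi ⟨h.lt _ hi, h.lt _ (by omega), ?_⟩
    simpa [SimpleGraph.Walk.support_ofSupport, f] using hij

/-- One step between positions `a` and `b` of a guessed subsequence of the sequence `p`. -/
def AnchorStep (W : ℕ → Prop) (p : ℕ → ℕ) (a b : ℕ) : Prop :=
  b = a ∨ b = a + 1 ∨ (a < b ∧ ∀ i, a ≤ i → i ≤ b → ¬ W (p i))

/-- The positions of the vertices of `W`, of their neighbours in the sequence, and of the first
and the last vertex. -/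
theorem exists_anchors {n k : ℕ} (hn : 0 < n) {W : ℕ → Prop} {w p : ℕ → ℕ}
    (hW : ∀ i < n, W (p i) → ∃ j < k, w j = p i) (hinj : ∀ i j, i < n → j < n → p i = p j → i = j) :
    ∃ a : ℕ → ℕ, a 0 = 0 ∧ a (3 * k + 1) = n - 1 ∧ (∀ j, a j < n) ∧
      ∀ j, AnchorStep W p (a j) (a (j + 1)) := by
  classical
  -- The positions of `W`. There are at most `k`, since distinct positions carry distinct vertices,
  -- all among the values of `w` below `k`.
  let Y := (Finset.range n).filter fun i => W (p i)
  have hY : Y.card ≤ k := by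
    have h1 : (Y.image p).card = Y.card := Finset.card_image_of_injOn fun i hi j hj hij =>
      hinj i j (by simp [Y] at hi; exact hi.1) (by simp [Y] at hj; exact hj.1) hij
    have h2 : Y.image p ⊆ (Finset.range k).image w := by
      intro x hx
      obtain ⟨i, hi, rfl⟩ := Finset.mem_image.1 hx
      obtain ⟨j, hj, hjx⟩ := hW i (Finset.mem_range.1 (Finset.mem_filter.1 hi).1)
        (Finset.mem_filter.1 hi).2
      exact Finset.mem_image.2 ⟨j, Finset.mem_range.2 hj, hjx⟩
    have h3 := Finset.card_le_card h2
    have h4 : ((Finset.range k).image w).card ≤ (Finset.range k).card := Finset.card_image_le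
    rw [Finset.card_range] at h4
    omega
  -- Both ends, and each position of `W` with the two next to it: at most 3k + 2 in all. The filter
  -- discards `i + 1` when `i` is the last position.
  let X := ({0, n - 1} ∪ (Y ∪ (Y.image (· + 1) ∪ Y.image (· - 1)))).filter (· < n)
  have hXc : X.card ≤ 3 * k + 2 := by
    have h1 : X.card ≤ ({0, n - 1} ∪ (Y ∪ (Y.image (· + 1) ∪ Y.image (· - 1)))).card :=
      Finset.card_filter_le _ _
    have h2 := Finset.card_union_le ({0, n - 1} : Finset ℕ)
      (Y ∪ (Y.image (· + 1) ∪ Y.image (· - 1)))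
    have h3 := Finset.card_union_le Y (Y.image (· + 1) ∪ Y.image (· - 1))
    have h4 := Finset.card_union_le (Y.image (· + 1)) (Y.image (· - 1))
    have h5 : (Y.image (· + 1)).card ≤ Y.card := Finset.card_image_le
    have h6 : (Y.image (· - 1)).card ≤ Y.card := Finset.card_image_le
    have h7 : ({0, n - 1} : Finset ℕ).card ≤ 2 := Finset.card_le_two
    omega
  have hX0 : 0 ∈ X := by simp [X, hn]
  have hX1 : n - 1 ∈ X := by simp [X, hn]
  have hXn : ∀ x ∈ X, x < n := fun x hx => (Finset.mem_filter.1 hx).2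
  have hXW : ∀ i < n, W (p i) → i ∈ X ∧ (i + 1 < n → i + 1 ∈ X) ∧ (i - 1 ∈ X) := by
    intro i hi hWi
    have hiY : i ∈ Y := by simp [Y, hi, hWi]
    refine ⟨?_, fun h => ?_, ?_⟩
    · simp [X, hi, hiY]
    · simp [X, h, hiY]
    · refine Finset.mem_filter.2 ⟨?_, by omega⟩
      simp only [Finset.mem_union, Finset.mem_image]
      exact Or.inr (Or.inr (Or.inr ⟨i, hiY, rfl⟩))
  set c := X.card with hc
  have hcpos : 0 < c := Finset.card_pos.2 ⟨0, hX0⟩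
  let e := X.orderEmbOfFin rfl
  have hsurj : ∀ x ∈ X, ∃ i, e i = x := by
    intro x hx
    have : x ∈ Set.range e := by rw [Finset.range_orderEmbOfFin]; exact hx
    exact this
  have hmem : ∀ i, e i ∈ X := fun i => Finset.orderEmbOfFin_mem _ _ _
  -- `X` in increasing order. If it has fewer than 3k + 2 elements, the last one is repeated, as the
  -- clause `b = a` of `AnchorStep` permits.
  refine ⟨fun j => e ⟨min j (c - 1), by omega⟩, ?_, ?_, fun j => hXn _ (hmem _), ?_⟩
  · change e ⟨min 0 (c - 1), _⟩ = 0
    obtain ⟨i, hi⟩ := hsurj 0 hX0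
    have : e ⟨min 0 (c - 1), by omega⟩ ≤ e i := e.monotone (Fin.mk_le_of_le_val (by omega))
    omega
  · change e ⟨min (3 * k + 1) (c - 1), _⟩ = n - 1
    obtain ⟨i, hi⟩ := hsurj (n - 1) hX1
    have : e i ≤ e ⟨min (3 * k + 1) (c - 1), by omega⟩ :=
      e.monotone (Fin.le_iff_val_le_val.2 (by have := i.2; simp only [← hc] at this ⊢; omega))
    have := hXn _ (hmem ⟨min (3 * k + 1) (c - 1), by omega⟩)
    omega
  · intro j
    by_cases hj : c - 1 ≤ j
    · left
      have h1 : min (j + 1) (c - 1) = min j (c - 1) := by omega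
      simp only [h1]
    · right
      beta_reduce
      set a := e ⟨min j (c - 1), by omega⟩ with ha
      set b := e ⟨min (j + 1) (c - 1), by omega⟩ with hb
      have hab : a < b := e.strictMono (Fin.lt_def.2 (by simp only; omega))
      have haX : a ∈ X := hmem _
      have hbX : b ∈ X := hmem _
      have hbn := hXn _ hbX
      have hbetween : ∀ x ∈ X, a < x → x < b → False := by
        intro x hx h1 h2
        obtain ⟨i, rfl⟩ := hsurj x hx
        have h1' := Fin.lt_def.1 (e.lt_iff_lt.1 h1)
        have h2' := Fin.lt_def.1 (e.lt_iff_lt.1 h2)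
        simp only at h1' h2'
        omega
      by_cases hab' : b = a + 1
      · exact Or.inl hab'
      -- A position of `W` between the anchors would be a further anchor strictly in between; at an
      -- end, the position next to it would be one.
      · refine Or.inr ⟨hab, fun i h1 h2 hWi => ?_⟩
        obtain ⟨hi1, hi2, hi3⟩ := hXW i (by omega) hWi
        by_cases h3 : i = a
        · exact hbetween _ (hi2 (by omega)) (by omega) (by omega)
        · by_cases h4 : i = b
          · exact hbetween _ hi3 (by omega) (by omega)
          · exact hbetween _ hi1 (by omega) (by omega)

/-! ### Conditions -/

/-- The expression is true, that is, nonzero. -/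
def Expr.Holds (e : Expr) (s : State) : Prop := e.eval s ≠ 0

instance (e : Expr) (s : State) : Decidable (e.Holds s) := inferInstanceAs (Decidable (_ ≠ _))

/-- Negation. -/
def Expr.not (e : Expr) : Expr := .eq e (.const 0)

/-- Conjunction. -/
def Expr.and (e f : Expr) : Expr := .not (.add (.not e) (.not f))

/-- The adjacency matrix; array `2` holds the multiples of the number of vertices. -/
def adjE (u v : Expr) : Expr := .get 0 (.add (.get 2 u) v)

/-- The matrix of the partial order. -/
def ordE (u v : Expr) : Expr := .get 1 (.add (.get 2 u) v)

/-! ### Values and truth of expressions -/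

@[simp] theorem Expr.eval_const (s : State) (m : ℕ) : (Expr.const m).eval s = m := rfl
@[simp] theorem Expr.eval_var (s : State) (x : ℕ) : (Expr.var x).eval s = s.reg x := rfl
@[simp] theorem Expr.eval_get (s : State) (a : ℕ) (i : Expr) :
    (Expr.get a i).eval s = s.arr a (i.eval s) := rfl
@[simp] theorem Expr.eval_add (s : State) (e f : Expr) :
    (Expr.add e f).eval s = e.eval s + f.eval s := rfl
@[simp] theorem Expr.eval_sub (s : State) (e f : Expr) :
    (Expr.sub e f).eval s = e.eval s - f.eval s := rfl

@[simp] theorem Expr.holds_get (s : State) (a : ℕ) (i : Expr) :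
    (Expr.get a i).Holds s ↔ s.arr a (i.eval s) ≠ 0 := Iff.rfl
@[simp] theorem Expr.holds_const (s : State) (m : ℕ) : (Expr.const m).Holds s ↔ m ≠ 0 := Iff.rfl
@[simp] theorem Expr.holds_var (s : State) (x : ℕ) : (Expr.var x).Holds s ↔ s.reg x ≠ 0 := Iff.rfl
@[simp] theorem Expr.holds_lt (s : State) (e f : Expr) :
    (Expr.lt e f).Holds s ↔ e.eval s < f.eval s := by
  simp [Expr.Holds, Expr.eval]
@[simp] theorem Expr.holds_eq (s : State) (e f : Expr) :
    (Expr.eq e f).Holds s ↔ e.eval s = f.eval s := by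
  simp [Expr.Holds, Expr.eval]
@[simp] theorem Expr.holds_add (s : State) (e f : Expr) :
    (Expr.add e f).Holds s ↔ e.Holds s ∨ f.Holds s := by
  simp only [Expr.Holds, Expr.eval]; omega
@[simp] theorem Expr.holds_not (s : State) (e : Expr) : (Expr.not e).Holds s ↔ ¬ e.Holds s := by
  rw [Expr.not, Expr.holds_eq]; simp [Expr.Holds]
@[simp] theorem Expr.holds_and (s : State) (e f : Expr) :
    (Expr.and e f).Holds s ↔ e.Holds s ∧ f.Holds s := by
  rw [Expr.and, Expr.holds_not, Expr.holds_add, Expr.holds_not, Expr.holds_not]; tauto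

namespace Cmd

@[simp] theorem run_assign (x : ℕ) (e : Expr) (s : State) :
    (Cmd.assign x e).run s = s.setR x (e.eval s) := rfl
@[simp] theorem run_store (a : ℕ) (i e : Expr) (s : State) :
    (Cmd.store a i e).run s = s.setA a (i.eval s) (e.eval s) := rfl
@[simp] theorem run_seq (c d : Cmd) (s : State) : (Cmd.seq c d).run s = d.run (c.run s) := rfl

/-- A conditional without alternative. -/
def when (e : Expr) (c : Cmd) : Cmd := .ite e c .skip

@[simp] theorem run_when (e : Expr) (c : Cmd) (s : State) :
    (Cmd.when e c).run s = if e.Holds s then c.run s else s := rfl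

/-- A loop that fills an array. -/
theorem run_for_fill {a x b : ℕ} {e : Expr} {s : State} (g : ℕ → ℕ)
    (hg : ∀ i s', i < s.reg b → s'.reg x = i → Frame (.store a (.var x) e) x s s' →
      e.eval s' = g i) (j : ℕ) :
    ((Cmd.for x b (.store a (.var x) e)).run s).arr a j =
      if j < s.reg b then g j else s.arr a j := by
  refine run_for_inv (fun i s' => s'.arr a j = if j < i then g j else s.arr a j) (by simp) ?_
  intro i s' hi hx hf ih
  simp only [run_store, State.setR_arr, State.setA_arr_self, Expr.eval_var, hx, ih]
  rw [hg i s' hi hx hf]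
  split_ifs <;> first | rfl | omega | (subst_vars; rfl)

/-- A loop in which every round may withdraw a flag. -/
theorem run_for_flag {fl x b : ℕ} {c : Cmd} {s : State} (hfx : fl ≠ x) (Q : ℕ → Prop)
    (hQ : ∀ i s', i < s.reg b → s'.reg x = i → Frame c x s s' →
      ((c.run s').reg fl ≠ 0 ↔ s'.reg fl ≠ 0 ∧ Q i)) :
    ((Cmd.for x b c).run s).reg fl ≠ 0 ↔ s.reg fl ≠ 0 ∧ ∀ i < s.reg b, Q i := by
  refine run_for_inv (fun i s' => s'.reg fl ≠ 0 ↔ s.reg fl ≠ 0 ∧ ∀ j < i, Q j) ?_ ?_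
  · simp [hfx]
  · intro i s' hi hx hf ih
    rw [State.setR_reg, if_neg hfx, hQ i s' hi hx hf, ih, and_assoc]
    refine and_congr_right fun _ => ⟨fun h j hj => ?_, fun h => ⟨fun j hj => h j (by omega), h i (by omega)⟩⟩
    rcases Nat.lt_succ_iff_lt_or_eq.1 hj with h1 | rfl
    · exact h.1 j h1
    · exact h.2

end Cmd

open Cmd

/-! ### The instance in memory -/

/-- A loopless undirected graph on `{0, …, n - 1}` and a reflexive relation. -/
structure Inst (n : ℕ) (A P : ℕ → ℕ → Prop) : Prop where
  lt : ∀ u v, A u v → u < n ∧ v < n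
  symm : ∀ u v, A u v → A v u
  irrefl : ∀ u, ¬ A u u
  ordLt : ∀ u v, P u v → u < n ∧ v < n
  refl : ∀ u < n, P u u

/-- The memory holds the instance. -/
structure Ctx (n : ℕ) (A P : ℕ → ℕ → Prop) (s : State) : Prop where
  inst : Inst n A P
  num : s.reg 0 = n
  adj : ∀ u v, u < n → v < n → (s.arr 0 (s.arr 2 u + v) ≠ 0 ↔ A u v)
  ord : ∀ u v, u < n → v < n → (s.arr 1 (s.arr 2 u + v) ≠ 0 ↔ P u v)

section Ctx
variable {n : ℕ} {A P : ℕ → ℕ → Prop} {s s' : State}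

/-- The command leaves the instance alone. -/
def Cmd.keepsInst (c : Cmd) : Bool := !c.wreg 0 && !c.warr 0 && !c.warr 1 && !c.warr 2

theorem Ctx.congr (h : Ctx n A P s) (h0 : s'.reg 0 = s.reg 0) (h1 : s'.arr 0 = s.arr 0)
    (h2 : s'.arr 1 = s.arr 1) (h3 : s'.arr 2 = s.arr 2) : Ctx n A P s' :=
  ⟨h.inst, h0.trans h.num, by rw [h1, h3]; exact h.adj, by rw [h2, h3]; exact h.ord⟩

theorem Ctx.run (h : Ctx n A P s) (c : Cmd) (hc : c.keepsInst = true := by rfl) :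
    Ctx n A P (c.run s) := by
  simp only [Cmd.keepsInst, Bool.and_eq_true, Bool.not_eq_true'] at hc
  exact h.congr (run_reg c s hc.1.1.1) (run_arr c s hc.1.1.2) (run_arr c s hc.1.2)
    (run_arr c s hc.2)

theorem Ctx.frame (h : Ctx n A P s) {c : Cmd} {x : ℕ} (hf : Frame c x s s')
    (hc : (c.keepsInst && 0 != x) = true := by rfl) : Ctx n A P s' := by
  simp only [Cmd.keepsInst, Bool.and_eq_true, Bool.not_eq_true', bne_iff_ne] at hc
  exact h.congr (hf.reg' 0 hc.2 hc.1.1.1.1) (hf.arr' 0 hc.1.1.1.2) (hf.arr' 1 hc.1.1.2)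
    (hf.arr' 2 hc.1.2)

theorem Ctx.setR (h : Ctx n A P s) (x v : ℕ) (hx : (0 != x) = true := by rfl) :
    Ctx n A P (s.setR x v) := by
  have : 0 ≠ x := by simpa using hx
  exact h.congr (by simp [this]) rfl rfl rfl

theorem Ctx.holds_adjE (h : Ctx n A P s) {u v : Expr} (hu : u.eval s < n) (hv : v.eval s < n) :
    (adjE u v).Holds s ↔ A (u.eval s) (v.eval s) := h.adj _ _ hu hv

theorem Ctx.holds_ordE (h : Ctx n A P s) {u v : Expr} (hu : u.eval s < n) (hv : v.eval s < n) :
    (ordE u v).Holds s ↔ P (u.eval s) (v.eval s) := h.ord _ _ hu hv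

end Ctx

/-! ### Reachability -/

/-- One step of the search: mark vertex `x₂₄` if it is an admissible neighbour of a marked
vertex `x₂₃`. -/
def reachStep : Cmd :=
  .when (.and (.get 6 (.var 23)) (.and (adjE (.var 23) (.var 24)) (.get 5 (.var 24))))
    (.store 6 (.var 24) (.const 1))

/-- One round of the search. -/
def reachRound : Cmd := .for 23 0 (.for 24 0 reachStep)

/-- Mark in array `6` all vertices reachable from `x₂₀` through vertices marked in array `5`. -/
def reach : Cmd :=
  .seq (.for 21 0 (.store 6 (.var 21) (.const 0)))
    (.seq (.store 6 (.var 20) (.const 1)) (.for 22 0 reachRound))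

section
variable {n : ℕ} {A P : ℕ → ℕ → Prop} {s : State}

/-- `Q` stands for reachability; soundness needs only that it is closed under admissible steps.
Marks set during the round may already be used in it, so progress is claimed only from the vertices
marked at its beginning. -/
theorem reachRound_spec (h : Ctx n A P s) (Q : ℕ → Prop)
    (hQ : ∀ u v, Q u → A u v → s.arr 5 v ≠ 0 → Q v) (hs : ∀ v, s.arr 6 v ≠ 0 → Q v) :
    (∀ v, s.arr 6 v ≠ 0 → (reachRound.run s).arr 6 v ≠ 0) ∧
    (∀ v, (reachRound.run s).arr 6 v ≠ 0 → Q v) ∧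
    (∀ u v, s.arr 6 u ≠ 0 → A u v → s.arr 5 v ≠ 0 → (reachRound.run s).arr 6 v ≠ 0) := by
  classical
  have outer := run_for_inv (c := .for 24 0 reachStep) (x := 23) (b := 0) (s := s)
    (fun i s' => (∀ v, s.arr 6 v ≠ 0 → s'.arr 6 v ≠ 0) ∧ (∀ v, s'.arr 6 v ≠ 0 → Q v) ∧
      (∀ u v, u < i → s.arr 6 u ≠ 0 → A u v → s.arr 5 v ≠ 0 → s'.arr 6 v ≠ 0))
    ⟨by simp, by simpa using hs, by simp⟩ ?_
  · rw [h.num] at outer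
    exact ⟨outer.1, outer.2.1, fun u v h1 h2 h3 => outer.2.2 u v (h.inst.lt u v h2).1 h1 h2 h3⟩
  intro i s₁ hi hx hf ⟨ih1, ih2, ih3⟩
  have hc := h.frame hf
  rw [h.num] at hi
  have inner := run_for_inv (c := reachStep) (x := 24) (b := 0) (s := s₁)
    (fun j s' => (∀ v, s₁.arr 6 v ≠ 0 → s'.arr 6 v ≠ 0) ∧ (∀ v, s'.arr 6 v ≠ 0 → Q v) ∧
      (∀ v, v < j → s.arr 6 i ≠ 0 → A i v → s.arr 5 v ≠ 0 → s'.arr 6 v ≠ 0))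
    ⟨by simp, by simpa using ih2, by simp⟩ ?_
  · rw [hc.num] at inner
    refine ⟨fun v hv => inner.1 v (ih1 v hv), inner.2.1, fun u v hu h1 h2 h3 => ?_⟩
    rcases Nat.lt_succ_iff_lt_or_eq.1 hu with h4 | rfl
    · exact inner.1 v (ih3 u v h4 h1 h2 h3)
    · exact inner.2.2 v (h.inst.lt _ v h2).2 h1 h2 h3
  intro j s₂ hj hx2 hf2 ⟨jh1, jh2, jh3⟩
  have hc2 := hc.frame hf2
  rw [hc.num] at hj
  have e23 : s₂.reg 23 = i := (hf2.reg 23).trans hx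
  have e5 : s₂.arr 5 = s.arr 5 := (hf2.arr 5).trans (hf.arr 5)
  have hadj : (adjE (.var 23) (.var 24)).Holds s₂ ↔ A i j := by
    rw [hc2.holds_adjE (by simpa [e23] using hi) (by simpa [hx2] using hj)]
    simp [e23, hx2]
  simp only [reachStep, run_when, Expr.holds_and, Expr.holds_get, Expr.eval_var, hadj, e23, hx2, e5,
    State.setR_arr, run_store, Expr.eval_const]
  split_ifs with hcond
  · simp only [State.setA_arr_self]
    refine ⟨fun v hv => ?_, fun v => ?_, fun v hv h1 h2 h3 => ?_⟩
    · split_ifs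
      · simp
      · exact jh1 v hv
    · split_ifs with hvj
      · subst hvj; exact fun _ => hQ i v (jh2 i hcond.1) hcond.2.1 hcond.2.2
      · exact jh2 v
    · split_ifs with hvj
      · simp
      · exact jh3 v (by omega) h1 h2 h3
  · refine ⟨jh1, jh2, fun v hv h1 h2 h3 => ?_⟩
    rcases Nat.lt_succ_iff_lt_or_eq.1 hv with h4 | rfl
    · exact jh3 v h4 h1 h2 h3
    · exact absurd ⟨jh1 i (ih1 i h1), h2, h3⟩ hcond

theorem reach_spec (h : Ctx n A P s) (hsrc : s.reg 20 < n) (v : ℕ) (hv : v < n) :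
    (reach.run s).arr 6 v ≠ 0 ↔
      ReflTransGen (fun a b => A a b ∧ s.arr 5 b ≠ 0) (s.reg 20) v := by
  classical
  set Q := fun v => ReflTransGen (fun a b => A a b ∧ s.arr 5 b ≠ 0) (s.reg 20) v with hQdef
  have hQn : ∀ y, Q y → y < n := by
    intro y hy
    rcases hy.cases_tail with h1 | ⟨c, _, h1, _⟩
    · omega
    · exact (h.inst.lt _ _ h1).2
  set s₁ := (Cmd.for 21 0 (.store 6 (.var 21) (.const 0))).run s with hs₁
  have h6 : ∀ j, s₁.arr 6 j = if j < n then 0 else s.arr 6 j := by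
    intro j
    rw [hs₁, run_for_fill (fun _ => 0) (fun _ _ _ _ _ => rfl), h.num]
  have hc₁ : Ctx n A P s₁ := h.run _
  have e20 : s₁.reg 20 = s.reg 20 := run_reg _ _ rfl
  have e5 : s₁.arr 5 = s.arr 5 := run_arr _ _ rfl
  set s₂ := s₁.setA 6 (s.reg 20) 1 with hs₂
  have hc₂ : Ctx n A P s₂ := hc₁.congr rfl (State.setA_arr_of_ne _ _ _ (by decide))
    (State.setA_arr_of_ne _ _ _ (by decide)) (State.setA_arr_of_ne _ _ _ (by decide))
  have e5' : s₂.arr 5 = s.arr 5 := (State.setA_arr_of_ne _ _ _ (by decide)).trans e5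
  have hrun : reach.run s = (Cmd.for 22 0 reachRound).run s₂ := by
    simp [reach, ← hs₁, hs₂, e20]
  -- After `i` rounds the marked set is complete or has at least `i + 1` elements; after `n` rounds
  -- the second alternative is impossible.
  let mk := fun s' : State => (Finset.range n).filter fun v => s'.arr 6 v ≠ 0
  have key := run_for_inv (c := reachRound) (x := 22) (b := 0) (s := s₂)
    (fun i s' => s'.arr 6 (s.reg 20) ≠ 0 ∧ (∀ v < n, s'.arr 6 v ≠ 0 → Q v) ∧
      ((∀ v, Q v → s'.arr 6 v ≠ 0) ∨ i + 1 ≤ (mk s').card)) ?_ ?_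
  · rw [← hrun, hc₂.num] at key
    obtain ⟨_, k2, k3⟩ := key
    refine ⟨k2 v hv, fun hq => ?_⟩
    rcases k3 with k3 | k3
    · exact k3 v hq
    · have := Finset.card_filter_le (Finset.range n) fun v => (reach.run s).arr 6 v ≠ 0
      rw [Finset.card_range] at this
      simp only [mk] at k3
      omega
  · refine ⟨by simp [hs₂], ?_, Or.inr ?_⟩
    · intro v hv
      simp only [hs₂, State.setR_arr, State.setA_arr_self, h6, if_pos hv]
      split_ifs with h1
      · subst h1; exact fun _ => .refl
      · simp
    · exact Finset.card_pos.2 ⟨s.reg 20, by simp [mk, hsrc, hs₂]⟩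
  · intro i s' hi hx hf ⟨ih1, ih2, ih3⟩
    have hc := hc₂.frame hf
    have e5s : s'.arr 5 = s.arr 5 := (hf.arr 5).trans e5'
    obtain ⟨r1, r2, r3⟩ := reachRound_spec hc (fun v => v < n → Q v)
      (fun u v hu hA h5 _ => (hu (h.inst.lt _ _ hA).1).tail ⟨hA, by rwa [e5s] at h5⟩)
      (fun v hv hn => ih2 v hn hv)
    rw [e5s] at r3
    simp only [State.setR_arr]
    refine ⟨r1 _ ih1, fun v hn hv => r2 v hv hn, ?_⟩
    rcases ih3 with ih3 | ih3
    · exact Or.inl fun v hv => r1 v (ih3 v hv)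
    -- If a round marks nothing new, the marked set is closed under admissible steps and hence
    -- complete.
    by_cases hsub : ∀ v < n, (reachRound.run s').arr 6 v ≠ 0 → s'.arr 6 v ≠ 0
    · left
      intro v hv
      induction hv with
      | refl => exact r1 _ ih1
      | tail _ hbc ih => exact r3 _ _ (hsub _ (h.inst.lt _ _ hbc.1).1 ih) hbc.1 hbc.2
    · right
      push Not at hsub
      obtain ⟨w, hw, hw1, hw2⟩ := hsub
      have : mk s' ⊂ mk ((reachRound.run s').setR 22 (i + 1)) := by
        refine Finset.ssubset_iff_of_subset ?_ |>.2
          ⟨w, Finset.mem_filter.2 ⟨Finset.mem_range.2 hw, hw1⟩, by simp [mk, hw2]⟩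
        intro v hv
        have hv' := Finset.mem_filter.1 hv
        exact Finset.mem_filter.2 ⟨hv'.1, r1 v hv'.2⟩
      have := Finset.card_lt_card this
      omega

end

/-! ### The test for block graphs -/

/-- Admit the vertices outside of the deleted set (array `4`) other than `x₃₁`. -/
def testMask : Cmd :=
  .for 33 0 (.store 5 (.var 33) (.and (.not (.get 4 (.var 33))) (.not (.eq (.var 33) (.var 31)))))

/-- Reject if `x₃₂` reaches a neighbour of `x₃₁` that is not its own neighbour. -/
def testNeighbors : Cmd :=
  .for 34 0 (.when (.and (.get 6 (.var 34)) (.and (adjE (.var 31) (.var 34))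
    (.and (.not (.eq (.var 34) (.var 32))) (.not (adjE (.var 32) (.var 34)))))) (.assign 30 (.const 0)))

/-- The test for the edge from `x₃₁` to `x₃₂`. -/
def testEdge : Cmd :=
  .when (.and (.not (.get 4 (.var 31))) (.and (.not (.get 4 (.var 32))) (adjE (.var 31) (.var 32))))
    (.seq testMask (.seq (.assign 20 (.var 32)) (.seq reach testNeighbors)))

/-- Set `x₃₀` to a nonzero value if deleting the set given by array `4` leaves a block graph. -/
def testBlocks : Cmd := .seq (.assign 30 (.const 1)) (.for 31 0 (.for 32 0 testEdge))

section
variable {n : ℕ} {A P : ℕ → ℕ → Prop} {s : State}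

/-- The edge plays the part of `s` and `u` in `LeavesBlocks`: one search from `u` that avoids `s`
settles the condition for all `v` at once. -/
theorem testEdge_spec (h : Ctx n A P s) (h31 : s.reg 31 < n) (h32 : s.reg 32 < n) :
    (testEdge.run s).reg 30 ≠ 0 ↔ s.reg 30 ≠ 0 ∧
      (s.arr 4 (s.reg 31) = 0 → s.arr 4 (s.reg 32) = 0 → A (s.reg 31) (s.reg 32) →
        ∀ v < n, ReflTransGen (fun a b => A a b ∧ ¬ s.arr 4 b ≠ 0 ∧ b ≠ s.reg 31) (s.reg 32) v →
          A (s.reg 31) v → v ≠ s.reg 32 → A (s.reg 32) v) := by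
  classical
  have hadj := h.holds_adjE (u := .var 31) (v := .var 32) h31 h32
  simp only [Expr.eval_var] at hadj
  simp only [testEdge, run_when, Expr.holds_and, Expr.holds_not, Expr.holds_get, Expr.eval_var,
    hadj, run_seq, run_assign]
  split_ifs with hcond
  swap
  · refine ⟨fun h1 => ⟨h1, fun h2 h3 h4 => absurd ⟨not_not.2 h2, not_not.2 h3, h4⟩ hcond⟩, fun h1 => h1.1⟩
  set s₁ := testMask.run s with hs₁
  have hc₁ : Ctx n A P s₁ := h.run _
  have hm : ∀ v < n, s₁.arr 5 v ≠ 0 ↔ ¬ s.arr 4 v ≠ 0 ∧ v ≠ s.reg 31 := by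
    intro v hv
    rw [hs₁, testMask, run_for_fill
      (fun v => if ¬ s.arr 4 v ≠ 0 ∧ v ≠ s.reg 31 then 1 else 0), h.num, if_pos hv]
    · simp
    · intro i s' _ hx hf
      have e4 := hf.arr 4
      have e31 := hf.reg 31
      have : (Expr.and (.not (.get 4 (.var 33))) (.not (.eq (.var 33) (.var 31)))).Holds s' ↔
          ¬ s.arr 4 i ≠ 0 ∧ i ≠ s.reg 31 := by
        simp [hx, e4, e31]
      split_ifs with h1
      · have := this.2 h1
        rw [Expr.Holds, Expr.and, Expr.not] at this
        simp only [Expr.and, Expr.not, Expr.eval] at this ⊢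
        split_ifs at this ⊢ <;> simp_all
      · exact not_not.1 fun h2 => h1 (this.1 h2)
  set s₂ := s₁.setR 20 (s₁.reg 32) with hs₂
  have hc₂ : Ctx n A P s₂ := hc₁.setR _ _
  have e32 : s₁.reg 32 = s.reg 32 := run_reg _ _ rfl
  have e20 : s₂.reg 20 = s.reg 32 := by simp [hs₂, e32]
  set s₃ := reach.run s₂ with hs₃
  have hc₃ : Ctx n A P s₃ := hc₂.run _
  have hr : ∀ v < n, s₃.arr 6 v ≠ 0 ↔
      ReflTransGen (fun a b => A a b ∧ ¬ s.arr 4 b ≠ 0 ∧ b ≠ s.reg 31) (s.reg 32) v := by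
    intro v hv
    rw [hs₃, reach_spec hc₂ (by rw [e20]; exact h32) v hv, e20]
    have : (fun a b => A a b ∧ s₂.arr 5 b ≠ 0) =
        fun a b => A a b ∧ ¬ s.arr 4 b ≠ 0 ∧ b ≠ s.reg 31 := by
      funext a b
      exact propext (and_congr_right fun hab => hm b (h.inst.lt a b hab).2)
    rw [this]
  have f31 : s₃.reg 31 = s.reg 31 := by
    rw [hs₃, run_reg _ _ rfl, hs₂, State.setR_reg, if_neg (by decide), hs₁, run_reg _ _ rfl]
  have f32 : s₃.reg 32 = s.reg 32 := by
    rw [hs₃, run_reg _ _ rfl, hs₂, State.setR_reg, if_neg (by decide), hs₁, run_reg _ _ rfl]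
  have f30 : s₃.reg 30 = s.reg 30 := by
    rw [hs₃, run_reg _ _ rfl, hs₂, State.setR_reg, if_neg (by decide), hs₁, run_reg _ _ rfl]
  rw [testNeighbors, run_for_flag (by decide)
    (fun v => ReflTransGen (fun a b => A a b ∧ ¬ s.arr 4 b ≠ 0 ∧ b ≠ s.reg 31) (s.reg 32) v →
          A (s.reg 31) v → v ≠ s.reg 32 → A (s.reg 32) v), f30, hc₃.num]
  · refine and_congr_right fun _ => ⟨fun h1 _ _ _ => h1, fun h1 =>
      h1 (not_not.1 hcond.1) (not_not.1 hcond.2.1) hcond.2.2⟩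
  · intro v s' hv hx hf
    have hc' := hc₃.frame hf
    rw [hc₃.num] at hv
    have g31 := (hf.reg 31).trans f31
    have g32 := (hf.reg 32).trans f32
    have g6 := hf.arr 6
    have a1 := hc'.holds_adjE (u := .var 31) (v := .var 34) (by simpa [g31] using h31)
      (by simpa [hx] using hv)
    have a2 := hc'.holds_adjE (u := .var 32) (v := .var 34) (by simpa [g32] using h32)
      (by simpa [hx] using hv)
    simp only [Expr.eval_var, g31, g32, hx] at a1 a2
    simp only [run_when, Expr.holds_and, Expr.holds_not, Expr.holds_get, Expr.eval_var, a1, a2,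
      Expr.holds_eq, g32, hx, g6, hr v hv, run_assign, Expr.eval_const]
    split_ifs with h1
    · simp only [State.setR_reg, if_true, ne_eq, not_true_eq_false, false_iff]
      exact fun h2 => h1.2.2.2 (h2.2 h1.1 h1.2.1 h1.2.2.1)
    · refine ⟨fun h2 => ⟨h2, fun h3 h4 h5 => ?_⟩, fun h2 => h2.1⟩
      by_contra h6
      exact h1 ⟨h3, h4, h5, h6⟩

theorem testBlocks_spec (h : Ctx n A P s) :
    (testBlocks.run s).reg 30 ≠ 0 ↔ LeavesBlocks A (fun v => s.arr 4 v ≠ 0) := by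
  let Q := fun a b => (s.arr 4 a = 0 → s.arr 4 b = 0 → A a b →
        ∀ v < n, ReflTransGen (fun c d => A c d ∧ ¬ s.arr 4 d ≠ 0 ∧ d ≠ a) b v →
          A a v → v ≠ b → A b v)
  rw [testBlocks, run_seq, run_assign]
  set s₀ := s.setR 30 (Expr.eval s (.const 1)) with hs₀
  have hc₀ : Ctx n A P s₀ := h.setR _ _
  rw [run_for_flag (by decide) (fun a => ∀ b < n, Q a b), hc₀.num]
  · have h30 : s₀.reg 30 ≠ 0 := by simp [hs₀]
    constructor
    · rintro ⟨_, hQ⟩ a u v ha hu hv hau hav huv hr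
      obtain ⟨h1, h2⟩ := h.inst.lt _ _ hau
      obtain ⟨_, h3⟩ := h.inst.lt _ _ hav
      exact hQ a h1 u h2 (not_not.1 ha) (not_not.1 hu) hau v h3 hr hav huv.symm
    · refine fun hL => ⟨h30, fun a _ b _ h1 h2 h3 v _ h4 h5 h6 => ?_⟩
      refine hL a b v (not_not.2 h1) (not_not.2 h2) ?_ h3 h5 h6.symm h4
      -- `testNeighbors` does not look up whether `v` is deleted: a vertex other than the start is
      -- reached only if it is admitted.
      rcases h4.cases_tail with h7 | ⟨_, _, _, h7, _⟩
      · exact absurd h7 h6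
      · exact h7
  · intro a s₁ ha hx hf
    have hc₁ := hc₀.frame hf
    rw [hc₀.num] at ha
    rw [run_for_flag (by decide) (fun b => Q a b), hc₁.num]
    intro b s₂ hb hx2 hf2
    have hc₂ := hc₁.frame hf2
    rw [hc₁.num] at hb
    have e31 : s₂.reg 31 = a := (hf2.reg 31).trans hx
    have e4 : s₂.arr 4 = s.arr 4 := (hf2.arr 4).trans (hf.arr 4)
    rw [testEdge_spec hc₂ (by rw [e31]; exact ha) (by rw [hx2]; exact hb), e31, hx2, e4]

/-! ### The route through the guessed vertices -/

/-- Admit `x₄₆` and the remaining vertices that are neither equal nor adjacent to `x₄₁`. -/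
def nextMask : Cmd :=
  .for 47 0 (.store 5 (.var 47) (.add (.eq (.var 47) (.var 46))
    (.and (.not (.get 4 (.var 47))) (.and (.not (.eq (.var 47) (.var 41)))
      (.not (adjE (.var 41) (.var 47)))))))

/-- Try `x₄₆` as the next vertex on the way from `x₄₁` to `x₄₃`. -/
def nextTry : Cmd :=
  .when (.and (.not (.get 4 (.var 46))) (adjE (.var 41) (.var 46)))
    (.seq nextMask (.seq (.assign 20 (.var 46)) (.seq reach
      (.when (.get 6 (.var 43)) (.assign 45 (.var 46))))))

/-- Let `x₄₅` be the next vertex on the way from `x₄₁` to `x₄₃`. -/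
def findNext : Cmd :=
  .seq (.assign 45 (.var 43))
    (.when (.and (.not (.get 4 (.var 41))) (.not (.get 4 (.var 43)))) (.for 46 0 nextTry))

theorem nextTry_spec (h : Ctx n A P s) (h41 : s.reg 41 < n) (h43 : s.reg 43 < n)
    (h46 : s.reg 46 < n) :
    (IsNext A (fun v => s.arr 4 v ≠ 0) (s.reg 41) (s.reg 43) (s.reg 46) →
      (nextTry.run s).reg 45 = s.reg 46) ∧
    (¬ IsNext A (fun v => s.arr 4 v ≠ 0) (s.reg 41) (s.reg 43) (s.reg 46) →
      (nextTry.run s).reg 45 = s.reg 45) := by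
  classical
  have hadj := h.holds_adjE (u := .var 41) (v := .var 46) h41 h46
  simp only [Expr.eval_var] at hadj
  simp only [nextTry, run_when, Expr.holds_and, Expr.holds_not, Expr.holds_get, Expr.eval_var,
    hadj, run_seq, run_assign, not_not]
  by_cases hcond : s.arr 4 (s.reg 46) = 0 ∧ A (s.reg 41) (s.reg 46)
  swap
  · rw [if_neg hcond]
    exact ⟨fun h1 => absurd ⟨not_not.1 h1.2.1, h1.1⟩ hcond, fun _ => rfl⟩
  rw [if_pos hcond]
  set s₁ := nextMask.run s with hs₁
  have hc₁ : Ctx n A P s₁ := h.run _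
  have hm : ∀ v < n, s₁.arr 5 v ≠ 0 ↔ v = s.reg 46 ∨
      ¬ s.arr 4 v ≠ 0 ∧ v ≠ s.reg 41 ∧ ¬ A (s.reg 41) v := by
    intro v hv
    -- The entry depends only on the loop variable and on data that the loop does not write, so it
    -- can be evaluated in `s` with that register set.
    have hfill := run_for_fill (a := 5) (x := 47) (b := 0) (s := s)
      (e := .add (.eq (.var 47) (.var 46))
        (.and (.not (.get 4 (.var 47))) (.and (.not (.eq (.var 47) (.var 41)))
        (.not (adjE (.var 41) (.var 47))))))
      (fun i => Expr.eval (s.setR 47 i) (.add (.eq (.var 47) (.var 46))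
        (.and (.not (.get 4 (.var 47))) (.and (.not (.eq (.var 47) (.var 41)))
        (.not (adjE (.var 41) (.var 47))))))) (by
          intro i s' _ hx hf
          simp [Expr.eval, Expr.not, Expr.and, adjE, hx, hf.reg 41, hf.reg 46, hf.arr 4, hf.arr 0,
            hf.arr 2]) v
    rw [h.num, if_pos hv] at hfill
    have hc' : Ctx n A P (s.setR 47 v) := h.setR _ _
    have ha := hc'.holds_adjE (u := .var 41) (v := .var 47) (by simpa using h41) (by simpa using hv)
    rw [hs₁, nextMask, hfill]
    refine (Expr.holds_add _ _ _).trans ?_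
    simp only [Expr.holds_and, Expr.holds_not, Expr.holds_eq, Expr.holds_get, ha]
    simp
  set s₂ := s₁.setR 20 (s₁.reg 46) with hs₂
  have hc₂ : Ctx n A P s₂ := hc₁.setR _ _
  have e46 : s₁.reg 46 = s.reg 46 := run_reg _ _ rfl
  have e20 : s₂.reg 20 = s.reg 46 := by simp [hs₂, e46]
  set s₃ := reach.run s₂ with hs₃
  have f43 : s₃.reg 43 = s.reg 43 := by
    rw [hs₃, run_reg _ _ rfl, hs₂, State.setR_reg, if_neg (by decide), hs₁, run_reg _ _ rfl]
  have f45 : s₃.reg 45 = s.reg 45 := by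
    rw [hs₃, run_reg _ _ rfl, hs₂, State.setR_reg, if_neg (by decide), hs₁, run_reg _ _ rfl]
  have f46 : s₃.reg 46 = s.reg 46 := by
    rw [hs₃, run_reg _ _ rfl, hs₂, State.setR_reg, if_neg (by decide), e46]
  have hr : s₃.arr 6 (s.reg 43) ≠ 0 ↔
      IsNext A (fun v => s.arr 4 v ≠ 0) (s.reg 41) (s.reg 43) (s.reg 46) := by
    rw [hs₃, reach_spec hc₂ (by rw [e20]; exact h46) _ h43, e20]
    have : (fun a b => A a b ∧ s₂.arr 5 b ≠ 0) = fun a b => A a b ∧ (b = s.reg 46 ∨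
        ¬ s.arr 4 b ≠ 0 ∧ b ≠ s.reg 41 ∧ ¬ A (s.reg 41) b) := by
      funext a b
      exact propext (and_congr_right fun hab => hm b (h.inst.lt a b hab).2)
    rw [this]
    exact ⟨fun h1 => ⟨hcond.2, not_not.2 hcond.1, h1⟩, fun h1 => h1.2.2⟩
  rw [f43]
  refine ⟨fun h1 => ?_, fun h1 => ?_⟩
  · rw [if_pos (hr.2 h1)]; simp [f46]
  · rw [if_neg (fun h2 => h1 (hr.1 h2)), f45]

/-- If an end is deleted, distinct consecutive anchors are neighbours in the solution, and the
default, the target itself, is right. Otherwise later successful candidates overwrite earlier ones;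
`IsNext.mem_path` applies to each of them, so uniqueness is not needed. -/
theorem findNext_spec (h : Ctx n A P s) (h41 : s.reg 41 < n) (h43 : s.reg 43 < n) :
    ((s.arr 4 (s.reg 41) ≠ 0 ∨ s.arr 4 (s.reg 43) ≠ 0) → (findNext.run s).reg 45 = s.reg 43) ∧
    (s.arr 4 (s.reg 41) = 0 → s.arr 4 (s.reg 43) = 0 →
      (∃ f, IsNext A (fun v => s.arr 4 v ≠ 0) (s.reg 41) (s.reg 43) f) →
      IsNext A (fun v => s.arr 4 v ≠ 0) (s.reg 41) (s.reg 43) ((findNext.run s).reg 45)) := by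
  rw [findNext, run_seq, run_assign, Expr.eval_var]
  set s₀ := s.setR 45 (s.reg 43) with hs₀
  have hc₀ : Ctx n A P s₀ := h.setR _ _
  have hcond : (Expr.and (.not (.get 4 (.var 41))) (.not (.get 4 (.var 43)))).Holds s₀ ↔
      s.arr 4 (s.reg 41) = 0 ∧ s.arr 4 (s.reg 43) = 0 := by
    simp [hs₀]
  rw [run_when]
  constructor
  · intro h1
    rw [if_neg (by rw [hcond]; tauto)]
    simp [hs₀]
  · intro h1 h2 ⟨f, hf⟩
    rw [if_pos (hcond.2 ⟨h1, h2⟩)]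
    have key := run_for_inv (c := nextTry) (x := 46) (b := 0) (s := s₀)
      (fun i s' => ∀ f < i, IsNext A (fun v => s.arr 4 v ≠ 0) (s.reg 41) (s.reg 43) f →
        IsNext A (fun v => s.arr 4 v ≠ 0) (s.reg 41) (s.reg 43) (s'.reg 45)) (by simp) ?_
    · rw [hc₀.num] at key
      exact key f (h.inst.lt _ _ hf.1).2 hf
    intro i s' hi hx hfr ih f' hf' hN
    rw [hc₀.num] at hi
    have hc' := hc₀.frame hfr
    have e41 : s'.reg 41 = s.reg 41 := hfr.reg 41
    have e43 : s'.reg 43 = s.reg 43 := hfr.reg 43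
    have e4 : s'.arr 4 = s.arr 4 := hfr.arr 4
    obtain ⟨t1, t2⟩ := nextTry_spec hc' (by rwa [e41]) (by rwa [e43]) (by rwa [hx])
    rw [e41, e43, e4, hx] at t1 t2
    rw [State.setR_reg, if_neg (by decide)]
    by_cases hi' : IsNext A (fun v => s.arr 4 v ≠ 0) (s.reg 41) (s.reg 43) i
    · rw [t1 hi']; exact hi'
    · rw [t2 hi']
      rcases Nat.lt_succ_iff_lt_or_eq.1 hf' with h4 | rfl
      · exact ih f' h4 hN
      · exact absurd hN hi'

/-- One step of the route to `x₄₃`. -/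
def routeStep : Cmd :=
  .when (.not (.eq (.var 41) (.var 43))) (.seq findNext (.seq (.store 7 (.var 40) (.var 45))
    (.seq (.assign 40 (.add (.var 40) (.const 1))) (.assign 41 (.var 45)))))

/-- The guessed vertices are `x₃, …, x₂ - 1` in array `3`. Write a route through them to
array `7`, and its length to `x₄₀`. -/
def route : Cmd :=
  .seq (.assign 41 (.get 3 (.var 3))) (.seq (.store 7 (.const 0) (.var 41))
    (.seq (.assign 40 (.const 1)) (.for 42 2 (.when (.lt (.var 3) (.var 42))
      (.seq (.assign 43 (.get 3 (.var 42))) (.for 44 0 routeStep))))))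

/-- The part of the sequence `p` from position `a` to position `b` is an edge, or outside of `W`
with all inner vertices adjacent to both ends. -/
structure Gap (A : ℕ → ℕ → Prop) (W : ℕ → Prop) (p : ℕ → ℕ) (a b : ℕ) : Prop where
  lt : a < b
  adj : A (p a) (p b)
  eq_of_mem : W (p a) ∨ W (p b) → b = a + 1
  inner : ∀ j, a < j → j < b → ¬ W (p j) ∧ A (p a) (p j) ∧ A (p j) (p b)

/-- The first `l` entries of `F` are a subsequence of `p` with gaps, ending at position `c`. -/
def IsRoute (A : ℕ → ℕ → Prop) (W : ℕ → Prop) (p F : ℕ → ℕ) (l c : ℕ) : Prop :=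
  ∃ pos : ℕ → ℕ, pos 0 = 0 ∧ 0 < l ∧ pos (l - 1) = c ∧ (∀ i < l, F i = p (pos i)) ∧
    ∀ i, i + 1 < l → Gap A W p (pos i) (pos (i + 1))

theorem IsRoute.extend {W : ℕ → Prop} {p F F' : ℕ → ℕ} {l c d : ℕ} (h : IsRoute A W p F l c)
    (hg : Gap A W p c d) (hF : ∀ i, F' i = if i = l then p d else F i) :
    IsRoute A W p F' (l + 1) d := by
  obtain ⟨pos, h0, hl, hc, hF', hgap⟩ := h
  refine ⟨fun i => if i = l then d else pos i, ?_, by omega, by simp, fun i hi => ?_, fun i hi => ?_⟩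
  · simp only; rw [if_neg (by omega)]; exact h0
  · rw [hF]; simp only
    split_ifs with h1
    · rfl
    · exact hF' i (by omega)
  · simp only
    rw [if_neg (by omega : i ≠ l)]
    split_ifs with h1
    · have : i = l - 1 := by omega
      rw [this, hc]; exact hg
    · exact hgap i (by omega)

/-- Every step moves forward in the solution by at least one position, so `n` rounds reach the
anchor `p d`; after that the step does nothing. -/
theorem routeStep_loop_spec {p : ℕ → ℕ} {cyc : Prop} {c d : ℕ} (h : Ctx n A P s)
    (hp : IsSolution n A P cyc p) (hL : LeavesBlocks A (fun v => s.arr 4 v ≠ 0))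
    (h41 : s.reg 41 = p c) (h43 : s.reg 43 = p d) (hd : d < n)
    (hstep : AnchorStep (fun v => s.arr 4 v ≠ 0) p c d)
    (hF : IsRoute A (fun v => s.arr 4 v ≠ 0) p (s.arr 7) (s.reg 40) c) :
    ((Cmd.for 44 0 routeStep).run s).reg 41 = p d ∧
    IsRoute A (fun v => s.arr 4 v ≠ 0) p (((Cmd.for 44 0 routeStep).run s).arr 7)
      (((Cmd.for 44 0 routeStep).run s).reg 40) d := by
  set W : ℕ → Prop := fun v => s.arr 4 v ≠ 0 with hWdef
  have hcd : c ≤ d := by rcases hstep with h1 | h1 | h1 <;> omega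
  have key := run_for_inv (c := routeStep) (x := 44) (b := 0) (s := s)
    (fun i s' => ∃ e, (e = d ∨ c + i ≤ e) ∧ c ≤ e ∧ e ≤ d ∧ s'.reg 41 = p e ∧
      IsRoute A W p (s'.arr 7) (s'.reg 40) e) ?_ ?_
  · obtain ⟨e, h1, h2, h3, h4, h5⟩ := key
    rw [h.num] at h1
    obtain rfl : e = d := by omega
    exact ⟨h4, h5⟩
  · exact ⟨c, Or.inr le_rfl, le_rfl, hcd, by simpa using h41, by simpa using hF⟩
  intro i s₁ _ hx hf ⟨e, h1, h2, h3, h4, h5⟩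
  have hc₁ := h.frame hf
  have e43 : s₁.reg 43 = p d := (hf.reg 43).trans h43
  have e4 : s₁.arr 4 = s.arr 4 := hf.arr 4
  have hcond : (Expr.not (.eq (.var 41) (.var 43))).Holds s₁ ↔ p e ≠ p d := by
    simp [h4, e43]
  simp only [routeStep, run_when]
  by_cases hed : e = d
  · rw [if_neg (by rw [hcond, hed]; simp)]
    exact ⟨e, Or.inl hed, h2, h3, by simpa using h4, by simpa using h5⟩
  have hlt : e < d := by omega
  have hne : p e ≠ p d := fun h6 => hed (hp.inj h.inst.refl (by omega) hd h6)
  rw [if_pos (hcond.2 hne)]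
  obtain ⟨n1, n2⟩ := findNext_spec hc₁ (by rw [h4]; exact hp.lt _ (by omega))
    (by rw [e43]; exact hp.lt _ hd)
  rw [h4, e43, e4] at n1 n2
  set s₂ := findNext.run s₁ with hs₂
  have e7 : s₂.arr 7 = s₁.arr 7 := run_arr _ _ rfl
  have e40 : s₂.reg 40 = s₁.reg 40 := run_reg _ _ rfl
  -- If `p e` or `p d` lies in `W`, then `d = e + 1` and the step goes straight to `p d`. Otherwise
  -- everything from `e` to `d` avoids `W`, and the vertex found lies on this part of the solution.
  have main : ∃ g, e < g ∧ g ≤ d ∧ s₂.reg 45 = p g ∧ Gap A W p e g := by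
    have inW : (W (p e) ∨ W (p d)) → d = e + 1 →
        ∃ g, e < g ∧ g ≤ d ∧ s₂.reg 45 = p g ∧ Gap A W p e g := by
      intro hW hde
      refine ⟨d, by omega, le_rfl, n1 hW, by omega, ?_, fun _ => hde, fun j h6 h7 => by omega⟩
      rw [hde]; exact hp.adj e (by omega)
    have out : (∀ j, e ≤ j → j ≤ d → ¬ W (p j)) →
        ∃ g, e < g ∧ g ≤ d ∧ s₂.reg 45 = p g ∧ Gap A W p e g := by
      intro hW
      have hN := n2 (not_not.1 (hW e le_rfl hlt.le)) (not_not.1 (hW d hlt.le le_rfl))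
        (exists_isNext hlt (fun j _ h7 h8 => hp.inj h.inst.refl (by omega) (by omega) h8)
          (fun j _ h7 => hp.adj j (by omega)) hW)
      obtain ⟨g, g1, g2, g3, g4⟩ := hN.mem_path h.inst.symm h.inst.irrefl hL hlt
        (fun i j _ h6 _ h7 h8 => hp.inj h.inst.refl (by omega) (by omega) h8)
        (fun j _ h7 => hp.adj j (by omega)) hW
      refine ⟨g, g1, g2, g3.symm, g1, ?_, ?_, fun j h6 h7 => ⟨hW j (by omega) (by omega), ?_⟩⟩
      · rw [g3]; exact hN.1
      · rintro (h6 | h6)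
        · exact absurd h6 (hW e le_rfl hlt.le)
        · exact absurd h6 (hW g (by omega) g2)
      · rw [g3]; exact g4 j h6 h7
    rcases hstep with h6 | h6 | ⟨_, h6⟩
    · omega
    · by_cases hW : W (p e) ∨ W (p d)
      · exact inW hW (by omega)
      · push Not at hW
        refine out fun j h7 h8 => ?_
        rcases (by omega : j = e ∨ j = d) with rfl | rfl
        · exact hW.1
        · exact hW.2
    · exact out fun j h7 h8 => h6 j (by omega) h8
  obtain ⟨g, g1, g2, g3, g4⟩ := main
  refine ⟨g, by omega, by omega, g2, by simp [← hs₂, g3], ?_⟩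
  have : ∀ F l, F = (fun j => if j = s₁.reg 40 then p g else s₁.arr 7 j) → l = s₁.reg 40 + 1 →
      IsRoute A W p F l g := by
    rintro F l rfl rfl
    exact h5.extend g4 fun _ => rfl
  refine this _ _ ?_ ?_
  · funext j
    simp [← hs₂, g3, e40, e7]
  · simp [← hs₂, e40]

theorem route_spec {p a : ℕ → ℕ} {cyc : Prop} (h : Ctx n A P s)
    (hp : IsSolution n A P cyc p) (hL : LeavesBlocks A (fun v => s.arr 4 v ≠ 0))
    (hm : s.reg 3 < s.reg 2) (ha0 : a 0 = 0)
    (hlt : ∀ j, a j < n) (hstep : ∀ j, AnchorStep (fun v => s.arr 4 v ≠ 0) p (a j) (a (j + 1)))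
    (hT : ∀ j, s.reg 3 + j < s.reg 2 → s.arr 3 (s.reg 3 + j) = p (a j)) :
    IsRoute A (fun v => s.arr 4 v ≠ 0) p ((route.run s).arr 7) ((route.run s).reg 40)
      (a (s.reg 2 - 1 - s.reg 3)) := by
  set W : ℕ → Prop := fun v => s.arr 4 v ≠ 0 with hWdef
  simp only [route, run_seq, run_assign, run_store, Expr.eval_const, Expr.eval_var, Expr.eval_get]
  set s₀ := ((State.setR s 41 (s.arr 3 (s.reg 3))).setA 7 0
    ((State.setR s 41 (s.arr 3 (s.reg 3))).reg 41)).setR 40 1 with hs₀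
  have hc₀ : Ctx n A P s₀ := h.congr rfl (by simp [hs₀, State.setA_arr_of_ne])
    (by simp [hs₀, State.setA_arr_of_ne]) (by simp [hs₀, State.setA_arr_of_ne])
  have e2 : s₀.reg 2 = s.reg 2 := rfl
  have e3 : s₀.reg 3 = s.reg 3 := rfl
  have e41 : s₀.reg 41 = p (a 0) := by
    have := hT 0 (by omega)
    simpa [hs₀] using this
  -- Before round `i` the route ends at the anchor with index `i - 1 - x₃`. Truncated subtraction
  -- makes this 0 during the rounds up to number `x₃`, which only skip the digits of the deleted set
  -- and the first anchor, already on the route.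
  have key := run_for_inv (c := .when (.lt (.var 3) (.var 42))
      (.seq (.assign 43 (.get 3 (.var 42))) (.for 44 0 routeStep))) (x := 42) (b := 2) (s := s₀)
    (fun i s' => s'.reg 41 = p (a (i - 1 - s.reg 3)) ∧
      IsRoute A W p (s'.arr 7) (s'.reg 40) (a (i - 1 - s.reg 3))) ?_ ?_
  · exact key.2
  · refine ⟨by simpa using e41, fun _ => 0, rfl, by simp [hs₀], by simp [ha0], fun i hi => ?_,
      fun i hi => ?_⟩
    · have hi0 : i = 0 := by simpa [hs₀] using hi
      subst hi0
      change s₀.arr 7 0 = p 0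
      rw [ha0] at e41
      rw [← e41]; simp [hs₀]
    · simp [hs₀] at hi
  · intro i s₁ hi hx hf ⟨h1, h2⟩
    have hc₁ := hc₀.frame hf
    have f3 : s₁.reg 3 = s.reg 3 := hf.reg 3
    have f4 : s₁.arr 4 = s.arr 4 := (hf.arr 4).trans (by simp [hs₀, State.setA_arr_of_ne])
    have fT : s₁.arr 3 = s.arr 3 := (hf.arr 3).trans (by simp [hs₀, State.setA_arr_of_ne])
    simp only [run_when, Expr.holds_lt, Expr.eval_var, hx, f3]
    by_cases hlt' : s.reg 3 < i
    · rw [if_pos hlt']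
      simp only [run_seq, run_assign, Expr.eval_get, Expr.eval_var, hx, fT]
      set s₂ := s₁.setR 43 (s.arr 3 i) with hs₂
      have hc₂ : Ctx n A P s₂ := hc₁.setR _ _
      have g4 : s₂.arr 4 = s.arr 4 := f4
      have hTi := hT (i - s.reg 3) (by omega)
      rw [show s.reg 3 + (i - s.reg 3) = i by omega] at hTi
      have := routeStep_loop_spec (s := s₂) (c := a (i - 1 - s.reg 3)) (d := a (i - s.reg 3))
        hc₂ hp (by rw [g4]; exact hL)
        (by rw [hs₂, State.setR_reg, if_neg (by decide), h1]) (by simp [hs₂, hTi]) (hlt _) (by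
          rw [g4]
          have := hstep (i - 1 - s.reg 3)
          rwa [show i - 1 - s.reg 3 + 1 = i - s.reg 3 by omega] at this)
        (by rw [g4, hs₂, State.setR_reg, if_neg (by decide)]; exact h2)
      rw [g4] at this
      rw [show i + 1 - 1 - s.reg 3 = i - s.reg 3 by omega]
      simpa using this
    · rw [if_neg hlt']
      rw [show i + 1 - 1 - s.reg 3 = i - 1 - s.reg 3 by omega]
      simpa using ⟨h1, h2⟩

end

/-! ### Greedy completion of the route -/

/-- Append vertex `x` to the sequence in array `10` of length `x₅₁`, and mark it in array `8`. -/
def append (x : ℕ) : Cmd :=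
  .seq (.store 10 (.var 51) (.var x))
    (.seq (.assign 51 (.add (.var 51) (.const 1))) (.store 8 (.var x) (.const 1)))

/-- Set `x₅₇` to a nonzero value if all other predecessors of `x₅₆` are marked. -/
def testPreds : Cmd :=
  .for 58 0 (.when (.and (ordE (.var 58) (.var 56)) (.and (.not (.get 8 (.var 58)))
    (.not (.eq (.var 58) (.var 56))))) (.assign 57 (.const 0)))

/-- Append `x₅₆` if it may stand between `x₅₂` and `x₅₃`. -/
def tryInsert : Cmd :=
  .when (.and (.not (.get 8 (.var 56))) (.and (.not (.get 9 (.var 56))) (.and (.not (.get 4 (.var 56)))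
      (.and (adjE (.var 52) (.var 56)) (adjE (.var 56) (.var 53))))))
    (.seq (.assign 57 (.const 1)) (.seq testPreds (.when (.var 57) (append 56))))

/-- Append all vertices that may stand between `x₅₂` and `x₅₃`. -/
def fillGap : Cmd := .for 55 0 (.for 56 0 tryInsert)

/-- Append the vertex with number `x₅₄` of the route, and all vertices that may follow. -/
def fillStep : Cmd :=
  .when (.lt (.var 54) (.var 40)) (.seq (.assign 52 (.get 7 (.var 54))) (.seq (append 52)
    (.when (.and (.lt (.add (.var 54) (.const 1)) (.var 40)) (.and (.not (.get 4 (.var 52)))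
        (.not (.get 4 (.get 7 (.add (.var 54) (.const 1)))))))
      (.seq (.assign 53 (.get 7 (.add (.var 54) (.const 1)))) fillGap))))

/-- Mark the vertices of the route in array `9`. -/
def markRoute : Cmd :=
  .seq (.for 49 0 (.store 9 (.var 49) (.const 0)))
    (.for 50 0 (.when (.lt (.var 50) (.var 40)) (.store 9 (.get 7 (.var 50)) (.const 1))))

/-- Complete the route to a sequence in array `10`. -/
def fill : Cmd :=
  .seq markRoute (.seq (.for 48 0 (.store 8 (.var 48) (.const 0)))
    (.seq (.assign 51 (.const 0)) (.for 54 0 fillStep)))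

/-- `S 0, …, S (c - 1)` is a path closed under predecessors, and its vertices are marked in `V`. -/
structure IsPartial (n : ℕ) (A P : ℕ → ℕ → Prop) (S V : ℕ → ℕ) (c : ℕ) : Prop where
  lt : ∀ j < c, S j < n
  marked : ∀ v < n, V v ≠ 0 ↔ ∃ j < c, S j = v
  inj : ∀ i j, i < c → j < c → S i = S j → i = j
  adj : ∀ j, j + 1 < c → A (S j) (S (j + 1))
  pred : ∀ j < c, ∀ u, P u (S j) → ∃ i ≤ j, S i = u

section
variable {n : ℕ} {A P : ℕ → ℕ → Prop} {s : State}

/-- The predecessors of the new vertex are marked and hence already listed. As the relation is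
reflexive, the vertex itself has to be excepted. -/
theorem IsPartial.append {S V S' V' : ℕ → ℕ} {c v : ℕ} (h : IsPartial n A P S V c) (hI : Inst n A P)
    (hv : v < n) (hV : V v = 0) (hadj : 0 < c → A (S (c - 1)) v)
    (hpred : ∀ u, P u v → u ≠ v → V u ≠ 0) (hS : ∀ i, S' i = if i = c then v else S i)
    (hV' : ∀ i, V' i = if i = v then 1 else V i) : IsPartial n A P S' V' (c + 1) := by
  have hold : ∀ j, j < c → S' j = S j := fun j hj => by rw [hS, if_neg (by omega)]
  have hnew : S' c = v := by rw [hS, if_pos rfl]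
  have hnot : ∀ j < c, S j ≠ v := fun j hj hjv => (h.marked v hv).2 ⟨j, hj, hjv⟩ hV
  have hcase : ∀ j, j < c + 1 → j < c ∨ j = c := fun j hj => by omega
  refine ⟨fun j hj => ?_, fun w hw => ?_, fun i j hi hj hij => ?_, fun j hj => ?_,
    fun j hj u hu => ?_⟩
  · rcases hcase j hj with h1 | rfl
    · rw [hold j h1]; exact h.lt j h1
    · rw [hnew]; exact hv
  · rw [hV']
    split_ifs with hwv
    · exact ⟨fun _ => ⟨c, by omega, hnew.trans hwv.symm⟩, fun _ => by simp⟩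
    · rw [h.marked w hw]
      constructor
      · rintro ⟨j, hj, rfl⟩; exact ⟨j, by omega, hold j hj⟩
      · rintro ⟨j, hj, rfl⟩
        rcases hcase j hj with h1 | rfl
        · exact ⟨j, h1, (hold j h1).symm⟩
        · exact absurd hnew hwv
  · rcases hcase i hi with h1 | rfl <;> rcases hcase j hj with h2 | rfl
    · rw [hold i h1, hold j h2] at hij; exact h.inj i j h1 h2 hij
    · rw [hold i h1, hnew] at hij; exact absurd hij (hnot i h1)
    · rw [hold j h2, hnew] at hij; exact absurd hij.symm (hnot j h2)
    · rfl
  · rw [hold j (by omega)]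
    rcases hcase _ hj with h1 | h1
    · rw [hold _ h1]; exact h.adj j h1
    · rw [h1, hnew]
      have := hadj (by omega)
      rwa [← h1] at this
  · rcases hcase j hj with h1 | rfl
    · rw [hold j h1] at hu
      obtain ⟨i, hi, hiu⟩ := h.pred j h1 u hu
      exact ⟨i, hi, (hold i (by omega)).trans hiu⟩
    · rw [hnew] at hu
      by_cases huv : u = v
      · exact ⟨j, le_rfl, hnew.trans huv.symm⟩
      · obtain ⟨i, hi, hiu⟩ := (h.marked u (hI.ordLt u v hu).1).1 (hpred u hu huv)
        exact ⟨i, by omega, (hold i hi).trans hiu⟩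

theorem testPreds_spec (h : Ctx n A P s) (h56 : s.reg 56 < n) :
    (testPreds.run s).reg 57 ≠ 0 ↔ s.reg 57 ≠ 0 ∧
      ∀ u, P u (s.reg 56) → u ≠ s.reg 56 → s.arr 8 u ≠ 0 := by
  classical
  rw [testPreds, run_for_flag (by decide)
    (fun u => P u (s.reg 56) → u ≠ s.reg 56 → s.arr 8 u ≠ 0), h.num]
  · exact and_congr_right fun _ => ⟨fun h1 u h2 => h1 u (h.inst.ordLt _ _ h2).1 h2,
      fun h1 u _ => h1 u⟩
  · intro u s' hu hx hf
    have hc' := h.frame hf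
    rw [h.num] at hu
    have e56 := hf.reg 56
    have a1 := hc'.holds_ordE (u := .var 58) (v := .var 56) (by simpa [hx] using hu)
      (by simpa [e56] using h56)
    simp only [Expr.eval_var, hx, e56] at a1
    simp only [run_when, Expr.holds_and, Expr.holds_not, Expr.holds_get, Expr.eval_var, a1,
      Expr.holds_eq, hx, e56, hf.arr 8, run_assign, Expr.eval_const]
    split_ifs with h1
    · simp only [State.setR_reg, if_true, ne_eq, not_true_eq_false, false_iff]
      exact fun h2 => h1.2.1 (h2.2 h1.1 h1.2.2)
    · refine ⟨fun h2 => ⟨h2, fun h3 h4 h5 => ?_⟩, fun h2 => h2.1⟩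
      exact h1 ⟨h3, not_not.2 h5, h4⟩

/-- The situation inside of a gap between `w` and `z`; `V₀` are the marks at its beginning. -/
structure InGap (n : ℕ) (A P : ℕ → ℕ → Prop) (V₀ : ℕ → ℕ) (w z x₀ : ℕ) (s : State) : Prop where
  part : IsPartial n A P (s.arr 10) (s.arr 8) (s.reg 51)
  pos : 0 < s.reg 51
  head : s.arr 10 0 = x₀
  last : s.arr 10 (s.reg 51 - 1) = w ∨ s.arr 4 (s.arr 10 (s.reg 51 - 1)) = 0 ∧
    A w (s.arr 10 (s.reg 51 - 1)) ∧ A (s.arr 10 (s.reg 51 - 1)) z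
  forced : ∀ v < n, s.arr 9 v ≠ 0 → s.arr 8 v ≠ 0 → V₀ v ≠ 0

theorem InGap.setR {V₀ : ℕ → ℕ} {w z x₀ : ℕ} (h : InGap n A P V₀ w z x₀ s) {x v : ℕ}
    (hx : 51 ≠ x) : InGap n A P V₀ w z x₀ (s.setR x v) := by
  obtain ⟨h1, h2, h3, h4, h5⟩ := h
  constructor <;> simpa [hx]

/-- The last vertex so far is `w` or, like the new one, a remaining common neighbour of `w` and `z`;
in the second case `LeavesBlocks.adj_of_common` gives the edge. So only the partial order can
prevent an insertion. -/
theorem tryInsert_spec {V₀ : ℕ → ℕ} {w z x₀ : ℕ} (h : Ctx n A P s)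
    (hL : LeavesBlocks A (fun v => s.arr 4 v ≠ 0))
    (hg : InGap n A P V₀ w z x₀ s) (h52 : s.reg 52 = w) (h53 : s.reg 53 = z)
    (hw : s.arr 4 w = 0) (hz : s.arr 4 z = 0) (hwz : A w z) (h56 : s.reg 56 < n) :
    InGap n A P V₀ w z x₀ (tryInsert.run s) ∧
    (∀ v < n, s.arr 8 v ≠ 0 → (tryInsert.run s).arr 8 v ≠ 0) ∧
    (s.arr 9 (s.reg 56) = 0 → s.arr 4 (s.reg 56) = 0 → A w (s.reg 56) → A (s.reg 56) z →
      (∀ u, P u (s.reg 56) → u ≠ s.reg 56 → s.arr 8 u ≠ 0) →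
      (tryInsert.run s).arr 8 (s.reg 56) ≠ 0) := by
  classical
  have hwn := (h.inst.lt _ _ hwz).1
  have hzn := (h.inst.lt _ _ hwz).2
  have a1 := h.holds_adjE (u := .var 52) (v := .var 56) (by simpa [h52] using hwn) h56
  have a2 := h.holds_adjE (u := .var 56) (v := .var 53) h56 (by simpa [h53] using hzn)
  simp only [Expr.eval_var, h52, h53] at a1 a2
  simp only [tryInsert, run_when, Expr.holds_and, Expr.holds_not, Expr.holds_get, Expr.eval_var, a1,
    a2, run_seq, run_assign, Expr.eval_const, Expr.holds_var]
  by_cases hcond : ¬s.arr 8 (s.reg 56) ≠ 0 ∧ ¬s.arr 9 (s.reg 56) ≠ 0 ∧ ¬s.arr 4 (s.reg 56) ≠ 0 ∧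
      A w (s.reg 56) ∧ A (s.reg 56) z
  swap
  · rw [if_neg hcond]
    refine ⟨hg, fun _ _ => id, fun h1 h2 h3 h4 _ => ?_⟩
    by_contra h5
    exact hcond ⟨not_not.2 h5, not_not.2 h1, not_not.2 h2, h3, h4⟩
  rw [if_pos hcond]
  obtain ⟨c8, c9, c4, cw, cz⟩ := hcond
  set s₁ := s.setR 57 1 with hs₁
  have hc₁ : Ctx n A P s₁ := h.setR _ _
  have ht := testPreds_spec hc₁ (by simpa [hs₁] using h56)
  set s₂ := testPreds.run s₁ with hs₂
  have e56 : s₂.reg 56 = s.reg 56 := run_reg testPreds s₁ rfl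
  have e51 : s₂.reg 51 = s.reg 51 := run_reg testPreds s₁ rfl
  have e4 : s₂.arr 4 = s.arr 4 := run_arr testPreds s₁ rfl
  have e8 : s₂.arr 8 = s.arr 8 := run_arr testPreds s₁ rfl
  have e9 : s₂.arr 9 = s.arr 9 := run_arr testPreds s₁ rfl
  have e10 : s₂.arr 10 = s.arr 10 := run_arr testPreds s₁ rfl
  have ht' : s₂.reg 57 ≠ 0 ↔ ∀ u, P u (s.reg 56) → u ≠ s.reg 56 → s.arr 8 u ≠ 0 := by
    rw [ht]; simp [hs₁]
  by_cases hpred : s₂.reg 57 ≠ 0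
  swap
  · rw [if_neg hpred]
    refine ⟨⟨?_, ?_, ?_, ?_, ?_⟩, fun v _ hv => ?_, fun _ _ _ _ h5 => absurd (ht'.2 h5) hpred⟩
    · rw [e10, e8, e51]; exact hg.part
    · rw [e51]; exact hg.pos
    · rw [e10]; exact hg.head
    · rw [e10, e51, e4]; exact hg.last
    · rw [e8, e9]; exact hg.forced
    · rw [e8]; exact hv
  rw [if_pos hpred]
  set s₃ := (append 56).run s₂ with hs₃
  have f51 : s₃.reg 51 = s.reg 51 + 1 := by simp [hs₃, append, e51]
  have f8 : ∀ i, s₃.arr 8 i = if i = s.reg 56 then 1 else s.arr 8 i := by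
    intro i
    simp [hs₃, append, e56, State.setA_arr_of_ne, e8]
  have f10 : ∀ i, s₃.arr 10 i = if i = s.reg 51 then s.reg 56 else s.arr 10 i := by
    intro i
    simp [hs₃, append, e56, e51, State.setA_arr_of_ne, e10]
  have f4 : s₃.arr 4 = s.arr 4 := by rw [hs₃, run_arr _ _ rfl, e4]
  have f9 : s₃.arr 9 = s.arr 9 := by rw [hs₃, run_arr _ _ rfl, e9]
  have hpos := hg.pos
  refine ⟨⟨?_, by omega, ?_, Or.inr ?_, ?_⟩, fun v hv h1 => ?_, fun _ _ _ _ _ => ?_⟩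
  · rw [f51]
    refine hg.part.append h.inst h56 (not_not.1 c8) (fun _ => ?_) (ht'.1 hpred) f10 f8
    rcases hg.last with h1 | ⟨h1, h2, h3⟩
    · rw [h1]; exact cw
    · refine hL.adj_of_common h.inst.irrefl (s := w) (t := z) (not_not.2 hw) (not_not.2 hz)
        (not_not.2 h1) c4 h2 cw h3 (h.inst.symm _ _ cz) ?_ ?_
      · intro h4
        refine c8 ((hg.part.marked _ h56).2 ⟨s.reg 51 - 1, by omega, h4⟩)
      · rintro rfl; exact h.inst.irrefl _ hwz
  · rw [f10, if_neg (by omega)]; exact hg.head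
  · rw [f51, Nat.add_sub_cancel, f10, if_pos rfl, f4]
    exact ⟨not_not.1 c4, cw, cz⟩
  · intro v hv h1 h2
    rw [f9] at h1
    rw [f8] at h2
    split_ifs at h2 with h3
    · rw [h3] at h1; exact absurd h1 c9
    · exact hg.forced v hv h1 h2
  · rw [f8]; split_ifs
    · simp
    · exact h1
  · rw [f8, if_pos rfl]; simp

theorem IsSolution.surj {cyc : Prop} {p : ℕ → ℕ} (h : IsSolution n A P cyc p)
    (hP : ∀ u < n, P u u) {u : ℕ} (hu : u < n) : ∃ j < n, p j = u := by
  have := Finset.surj_on_of_inj_on_of_card_le (s := Finset.range n) (t := Finset.range n)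
    (fun i _ => p i) (fun i hi => Finset.mem_range.2 (h.lt i (Finset.mem_range.1 hi)))
    (fun i j hi hj hij => h.inj hP (Finset.mem_range.1 hi) (Finset.mem_range.1 hj) hij) le_rfl u
    (Finset.mem_range.2 hu)
  obtain ⟨j, hj, hju⟩ := this
  exact ⟨j, Finset.mem_range.1 hj, hju.symm⟩

/-- After `i` passes the vertices of the solution up to position `a + i` within the gap are placed.
When the next pass comes to `p (a + i + 1)`, the predecessors of this vertex stand earlier in `p`
and are placed, so it is inserted if it has not been before. Common neighbours that `p` visits
elsewhere may be inserted too. -/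
theorem fillGap_spec {V₀ p : ℕ → ℕ} {cyc : Prop} {x₀ a b : ℕ} (h : Ctx n A P s)
    (hL : LeavesBlocks A (fun v => s.arr 4 v ≠ 0)) (hp : IsSolution n A P cyc p)
    (hg : InGap n A P V₀ (p a) (p b) x₀ s) (h52 : s.reg 52 = p a) (h53 : s.reg 53 = p b)
    (hw : s.arr 4 (p a) = 0) (hz : s.arr 4 (p b) = 0)
    (hgap : Gap A (fun v => s.arr 4 v ≠ 0) p a b) (hb : b < n)
    (hfree : ∀ j, a < j → j < b → s.arr 9 (p j) = 0)
    (hvis : ∀ j ≤ a, s.arr 8 (p j) ≠ 0) :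
    InGap n A P V₀ (p a) (p b) x₀ (fillGap.run s) ∧
      ∀ j < b, (fillGap.run s).arr 8 (p j) ≠ 0 := by
  have outer := run_for_inv (c := .for 56 0 tryInsert) (x := 55) (b := 0) (s := s)
    (fun i s' => InGap n A P V₀ (p a) (p b) x₀ s' ∧
      ∀ j, j ≤ a + i → j < b → s'.arr 8 (p j) ≠ 0) ?_ ?_
  · rw [h.num] at outer
    exact ⟨outer.1, fun j hj => outer.2 j (by omega) hj⟩
  · exact ⟨hg.setR (by decide), fun j hj _ => hvis j hj⟩
  intro i s₁ _ _ hf ⟨ih1, ih2⟩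
  have hc₁ := h.frame hf
  have inner := run_for_inv (c := tryInsert) (x := 56) (b := 0) (s := s₁)
    (fun v s' => InGap n A P V₀ (p a) (p b) x₀ s' ∧
      (∀ j, j ≤ a + i → j < b → s'.arr 8 (p j) ≠ 0) ∧
      (a + i + 1 < b → p (a + i + 1) < v → s'.arr 8 (p (a + i + 1)) ≠ 0)) ?_ ?_
  · rw [hc₁.num] at inner
    refine ⟨inner.1.setR (by decide), fun j hj hjb => ?_⟩
    rw [State.setR_arr]
    by_cases hj' : j ≤ a + i
    · exact inner.2.1 j hj' hjb
    · obtain rfl : j = a + i + 1 := by omega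
      exact inner.2.2 hjb (hp.lt _ (by omega))
  · exact ⟨ih1.setR (by decide), ih2, by simp⟩
  intro v s₂ hv hx hf2 ⟨jh1, jh2, jh3⟩
  have hc₂ := hc₁.frame hf2
  rw [hc₁.num] at hv
  have e4 : s₂.arr 4 = s.arr 4 := (hf2.arr 4).trans (hf.arr 4)
  have e9 : s₂.arr 9 = s.arr 9 := (hf2.arr 9).trans (hf.arr 9)
  have e52 : s₂.reg 52 = p a := ((hf2.reg 52).trans (hf.reg 52)).trans h52
  have e53 : s₂.reg 53 = p b := ((hf2.reg 53).trans (hf.reg 53)).trans h53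
  obtain ⟨t1, t2, t3⟩ := tryInsert_spec hc₂ (by rw [e4]; exact hL) jh1 e52 e53 (by rwa [e4])
    (by rwa [e4]) hgap.adj (by rwa [hx])
  rw [hx, e9, e4] at t3
  refine ⟨t1.setR (by decide), ?_, ?_⟩ <;> rw [State.setR_arr]
  · exact fun j hj hjb => t2 _ (hp.lt _ (by omega)) (jh2 j hj hjb)
  intro h1 h2
  rcases Nat.lt_succ_iff_lt_or_eq.1 h2 with h3 | h3
  · exact t2 _ (hp.lt _ (by omega)) (jh3 h1 h3)
  · have hin := hgap.inner (a + i + 1) (by omega) h1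
    rw [← h3] at t3
    refine t3 (hfree _ (by omega) h1) (not_not.1 hin.1) hin.2.1 hin.2.2 fun u hu hne => ?_
    obtain ⟨j, hj, rfl⟩ := hp.surj h.inst.refl (h.inst.ordLt _ _ hu).1
    have hj' : j ≤ a + i := by
      by_contra hlt
      rcases (by omega : a + i + 1 = j ∨ a + i + 1 < j) with h4 | h4
      · rw [h4] at hne; exact hne rfl
      · exact hp.ord _ _ h4 hj hu
    exact jh2 j hj' (by omega)

theorem markRoute_spec (h : Ctx n A P s) (hl : s.reg 40 ≤ n) (v : ℕ) (hv : v < n) :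
    (markRoute.run s).arr 9 v ≠ 0 ↔ ∃ i < s.reg 40, s.arr 7 i = v := by
  rw [markRoute, run_seq]
  set s₁ := (Cmd.for 49 0 (.store 9 (.var 49) (.const 0))).run s with hs₁
  have hc₁ : Ctx n A P s₁ := h.run _
  have h9 : s₁.arr 9 v = 0 := by
    rw [hs₁, run_for_fill (fun _ => 0) (fun _ _ _ _ _ => rfl), h.num, if_pos hv]
  have e40 : s₁.reg 40 = s.reg 40 := run_reg _ _ rfl
  have e7 : s₁.arr 7 = s.arr 7 := run_arr _ _ rfl
  have key := run_for_inv (c := .when (.lt (.var 50) (.var 40))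
    (.store 9 (.get 7 (.var 50)) (.const 1))) (x := 50) (b := 0) (s := s₁)
    (fun i s' => s'.arr 9 v ≠ 0 ↔ ∃ j, j < i ∧ j < s.reg 40 ∧ s.arr 7 j = v) ?_ ?_
  · rw [hc₁.num] at key
    rw [key]
    exact ⟨fun ⟨j, _, h2, h3⟩ => ⟨j, h2, h3⟩, fun ⟨j, h2, h3⟩ => ⟨j, by omega, h2, h3⟩⟩
  · simp [h9]
  · intro i s' _ hx hf ih
    simp only [run_when, Expr.holds_lt, Expr.eval_var, hx, hf.reg 40, e40, State.setR_arr]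
    split_ifs with h1
    · simp only [run_store, Expr.eval_get, Expr.eval_var, hx, hf.arr 7, e7, State.setA_arr_self,
        Expr.eval_const]
      split_ifs with h2
      · exact ⟨fun _ => ⟨i, by omega, h1, h2.symm⟩, fun _ => by simp⟩
      · rw [ih]
        constructor
        · rintro ⟨j, h3, h4⟩; exact ⟨j, by omega, h4⟩
        · rintro ⟨j, h3, h4⟩
          refine ⟨j, ?_, h4⟩
          rcases Nat.lt_succ_iff_lt_or_eq.1 h3 with h5 | rfl
          · exact h5
          · exact absurd h4.2.symm h2
    · rw [ih]
      constructor
      · rintro ⟨j, h3, h4⟩; exact ⟨j, by omega, h4⟩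
      · rintro ⟨j, h3, h4⟩; exact ⟨j, by omega, h4⟩

/-- The situation before vertex number `i` of a route of length `l` is appended. -/
structure InFill (n : ℕ) (A P : ℕ → ℕ → Prop) (p pos : ℕ → ℕ) (l i : ℕ) (s : State) : Prop where
  part : IsPartial n A P (s.arr 10) (s.arr 8) (s.reg 51)
  zero : i = 0 → s.reg 51 = 0
  head : 0 < i → 0 < s.reg 51 ∧ s.arr 10 0 = p 0
  forced : ∀ j < l, s.arr 8 (p (pos j)) ≠ 0 → j < i
  done : ∀ j < n, (i < l → j < pos i) → s.arr 8 (p j) ≠ 0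
  link : 0 < i → i < l → A (s.arr 10 (s.reg 51 - 1)) (p (pos i))
  last : l ≤ i → s.arr 10 (s.reg 51 - 1) = p (n - 1)

theorem InFill.setR {p pos : ℕ → ℕ} {l i : ℕ} (h : InFill n A P p pos l i s) {x v : ℕ}
    (hx : 51 ≠ x) : InFill n A P p pos l i (s.setR x v) := by
  obtain ⟨h1, h2, h3, h4, h5, h6, h7⟩ := h
  constructor <;> simpa [hx]

/-- The route vertex can be appended: its predecessors precede it in `p` and are placed by `done`,
and it is itself still missing by `forced`, since greedy insertion skips the vertices of the route.
-/
theorem fillStep_spec {p pos : ℕ → ℕ} {cyc : Prop} {l i : ℕ} (h : Ctx n A P s)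
    (hL : LeavesBlocks A (fun v => s.arr 4 v ≠ 0)) (hp : IsSolution n A P cyc p)
    (h54 : s.reg 54 = i) (h40 : s.reg 40 = l) (hl : 0 < l)
    (hpos0 : pos 0 = 0) (hposl : pos (l - 1) = n - 1) (hposn : ∀ j < l, pos j < n)
    (hmono : ∀ j k, j < k → k < l → pos j < pos k)
    (hF : ∀ j < l, s.arr 7 j = p (pos j))
    (hgap : ∀ j, j + 1 < l → Gap A (fun v => s.arr 4 v ≠ 0) p (pos j) (pos (j + 1)))
    (h9 : ∀ v < n, s.arr 9 v ≠ 0 ↔ ∃ j < l, p (pos j) = v)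
    (hi : InFill n A P p pos l i s) : InFill n A P p pos l (i + 1) (fillStep.run s) := by
  simp only [fillStep, run_when, Expr.holds_lt, Expr.eval_var, h54, h40]
  by_cases hil : i < l
  swap
  · rw [if_neg hil]
    obtain ⟨i1, i2, i3, i4, i5, i6, i7⟩ := hi
    exact ⟨i1, by omega, fun _ => i3 (by omega), fun j hj hv => (i4 j hj hv).trans (by omega),
      fun j hj h1 => i5 j hj (by omega), by omega, fun _ => i7 (by omega)⟩
  rw [if_pos hil]
  simp only [run_seq, run_assign, Expr.eval_get, Expr.eval_var, h54, run_when]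
  set s₁ := s.setR 52 (s.arr 7 i) with hs₁
  have hFi : s₁.reg 52 = p (pos i) := by simp [hs₁, hF i hil]
  have hpin := hp.lt _ (hposn i hil)
  set s₂ := (append 52).run s₁ with hs₂
  have hc₂ : Ctx n A P s₂ := (h.setR 52 _).run _
  have f51 : s₂.reg 51 = s.reg 51 + 1 := by simp [hs₂, append, hs₁]
  have f8 : ∀ j, s₂.arr 8 j = if j = p (pos i) then 1 else s.arr 8 j := by
    intro j
    simp [hs₂, append, hFi, State.setA_arr_of_ne]
    simp [hs₁]
  have f10 : ∀ j, s₂.arr 10 j = if j = s.reg 51 then p (pos i) else s.arr 10 j := by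
    intro j
    simp [hs₂, append, hFi, State.setA_arr_of_ne]
    simp [hs₁]
  have f4 : s₂.arr 4 = s.arr 4 := by rw [hs₂, run_arr _ _ rfl, hs₁, State.setR_arr]
  have f7 : s₂.arr 7 = s.arr 7 := by rw [hs₂, run_arr _ _ rfl, hs₁, State.setR_arr]
  have f9 : s₂.arr 9 = s.arr 9 := by rw [hs₂, run_arr _ _ rfl, hs₁, State.setR_arr]
  have f54 : s₂.reg 54 = i := by
    rw [hs₂, run_reg _ _ rfl, hs₁, State.setR_reg, if_neg (by decide), h54]
  have f40 : s₂.reg 40 = l := by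
    rw [hs₂, run_reg _ _ rfl, hs₁, State.setR_reg, if_neg (by decide), h40]
  have f52 : s₂.reg 52 = p (pos i) := by rw [hs₂, run_reg _ _ rfl, hFi]
  have hpart : IsPartial n A P (s₂.arr 10) (s₂.arr 8) (s₂.reg 51) := by
    rw [f51]
    refine hi.part.append h.inst hpin ?_ ?_ ?_ f10 f8
    · by_contra h1
      exact absurd (hi.forced i hil h1) (lt_irrefl _)
    · intro h1
      refine hi.link ?_ hil
      by_contra h2
      have := hi.zero (by omega)
      omega
    · intro u hu hne
      obtain ⟨j, hj, rfl⟩ := hp.surj h.inst.refl (h.inst.ordLt _ _ hu).1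
      refine hi.done j hj fun _ => ?_
      by_contra hlt
      rcases (by omega : pos i = j ∨ pos i < j) with h4 | h4
      · rw [h4] at hne; exact hne rfl
      · exact hp.ord _ _ h4 hj hu
  have hhead : s₂.arr 10 0 = p 0 := by
    rw [f10]
    by_cases h0 : i = 0
    · rw [if_pos (hi.zero h0).symm, h0, hpos0]
    · have := hi.head (by omega)
      rw [if_neg (by omega)]; exact this.2
  have hlast : s₂.arr 10 (s₂.reg 51 - 1) = p (pos i) := by
    rw [f51, Nat.add_sub_cancel, f10, if_pos rfl]
  have hforced : ∀ j < l, s₂.arr 8 (p (pos j)) ≠ 0 → j < i + 1 := by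
    intro j hj h1
    rw [f8] at h1
    split_ifs at h1 with h2
    · have h3 := hp.inj h.inst.refl (hposn j hj) (hposn i hil) h2
      by_contra h4
      have := hmono i j (by omega) hj
      omega
    · exact (hi.forced j hj h1).trans (by omega)
  have hdone : ∀ j ≤ pos i, s₂.arr 8 (p j) ≠ 0 := by
    intro j hj
    rw [f8]
    split_ifs with h1
    · simp
    · refine hi.done j (hj.trans_lt (hposn i hil)) fun _ => lt_of_le_of_ne hj ?_
      rintro rfl; exact h1 rfl
  have hcond : (Expr.and (.lt (.add (.var 54) (.const 1)) (.var 40)) (.and (.not (.get 4 (.var 52)))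
      (.not (.get 4 (.get 7 (.add (.var 54) (.const 1))))))).Holds s₂ ↔
      i + 1 < l ∧ s.arr 4 (p (pos i)) = 0 ∧ s.arr 4 (s.arr 7 (i + 1)) = 0 := by
    simp [f54, f40, f52, f4, f7]
  by_cases hc : i + 1 < l ∧ s.arr 4 (p (pos i)) = 0 ∧ s.arr 4 (s.arr 7 (i + 1)) = 0
  swap
  -- There is no gap to fill: the route ends here, at position `n - 1`, or an end of the gap lies in
  -- `W` and the next route vertex is also the next vertex of `p`.
  · rw [if_neg (by rw [hcond]; exact hc)]
    refine ⟨hpart, by omega, fun _ => ⟨by omega, hhead⟩, hforced, fun j hj h1 => ?_, fun _ h1 => ?_,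
      fun h1 => ?_⟩
    · refine hdone j ?_
      by_cases h2 : i + 1 < l
      · have hg := hgap i h2
        rw [hF _ h2] at hc
        have := hg.eq_of_mem (by
          by_contra h3
          push Not at h3
          exact hc ⟨h2, h3.1, h3.2⟩)
        have := h1 h2
        omega
      · have : i = l - 1 := by omega
        rw [this, hposl]; omega
    · rw [hlast]; exact (hgap i h1).adj
    · have : i = l - 1 := by omega
      rw [hlast, this, hposl]
  · rw [if_pos (hcond.2 hc)]
    simp only [Expr.eval_add, Expr.eval_var, Expr.eval_const, f54, f7]
    obtain ⟨hil', hw, hz⟩ := hc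
    rw [hF _ hil'] at hz ⊢
    have hg := hgap i hil'
    set s₃ := s₂.setR 53 (p (pos (i + 1))) with hs₃
    have hc₃ : Ctx n A P s₃ := hc₂.setR _ _
    -- With the current marks as `V₀`, the field `forced` will say that filling the gap adds no
    -- vertex of the route.
    have hin : InGap n A P (s₂.arr 8) (p (pos i)) (p (pos (i + 1))) (p 0) s₂ :=
      ⟨hpart, by omega, hhead, Or.inl hlast, fun v _ _ => id⟩
    obtain ⟨r1, r2⟩ := fillGap_spec (a := pos i) (b := pos (i + 1)) hc₃
      (by rw [hs₃, State.setR_arr, f4]; exact hL) hp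
      (hin.setR (x := 53) (by decide)) (by rw [hs₃, State.setR_reg, if_neg (by decide), f52])
      (by simp [hs₃]) (by rw [hs₃, State.setR_arr, f4]; exact hw)
      (by rw [hs₃, State.setR_arr, f4]; exact hz) (by rw [hs₃, State.setR_arr, f4]; exact hg)
      (hposn _ hil') (by
        -- Positions increase along the route, so none of its vertices lies strictly inside a gap.
        intro j h1 h2
        rw [hs₃, State.setR_arr, f9]
        by_contra h3
        have hjn : j < n := h2.trans (hposn _ hil')
        obtain ⟨m, hm, hmj⟩ := (h9 _ (hp.lt j hjn)).1 h3
        have h4 := hp.inj h.inst.refl (hposn m hm) hjn hmj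
        rcases lt_trichotomy m i with h5 | h5 | h5
        · have := hmono m i h5 hil; omega
        · subst h5; omega
        · rcases (by omega : m = i + 1 ∨ i + 1 < m) with h6 | h6
          · subst h6; omega
          · have := hmono _ _ h6 hm; omega)
      (by intro j hj; rw [hs₃, State.setR_arr]; exact hdone j hj)
    have e9 : (fillGap.run s₃).arr 9 = s.arr 9 := by
      rw [run_arr _ _ rfl, hs₃, State.setR_arr, f9]
    refine ⟨r1.part, by omega, fun _ => ⟨r1.pos, r1.head⟩, fun j hj h1 => ?_,
      fun j hj h1 => r2 j (h1 hil'), fun _ _ => ?_, fun h1 => by omega⟩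
    · refine hforced j hj (r1.forced _ (hp.lt _ (hposn j hj)) ?_ h1)
      rw [e9]
      exact (h9 _ (hp.lt _ (hposn j hj))).2 ⟨j, hj, rfl⟩
    · rcases r1.last with h1 | h1
      · rw [h1]; exact hg.adj
      · exact h1.2.2

/-- The completion of a route of a solution is a solution. -/
theorem fill_spec {p : ℕ → ℕ} {cyc : Prop} (h : Ctx n A P s)
    (hn : 0 < n) (hL : LeavesBlocks A (fun v => s.arr 4 v ≠ 0)) (hp : IsSolution n A P cyc p)
    (hr : IsRoute A (fun v => s.arr 4 v ≠ 0) p (s.arr 7) (s.reg 40) (n - 1)) :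
    IsSolution n A P cyc ((fill.run s).arr 10) := by
  obtain ⟨pos, hpos0, hl, hposl, hF, hgap⟩ := hr
  have hmono : ∀ j k, j < k → k < s.reg 40 → pos j < pos k := by
    intro j k hjk
    induction k, hjk using Nat.le_induction with
    | base => exact fun hk => (hgap j hk).lt
    | succ k _ ih => exact fun hk => (ih (by omega)).trans (hgap k hk).lt
  have hposn : ∀ j < s.reg 40, pos j < n := by
    intro j hj
    rcases (by omega : j = s.reg 40 - 1 ∨ j < s.reg 40 - 1) with h1 | h1
    · rw [h1, hposl]; omega
    · have := hmono j _ h1 (by omega); omega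
  -- It follows that the route has at most `n` entries, so loops up to `n` see all of it.
  have hge : ∀ j < s.reg 40, j ≤ pos j := by
    intro j
    induction j with
    | zero => omega
    | succ j ih => intro hj; have := ih (by omega); have := hmono j (j + 1) (by omega) hj; omega
  have hln : s.reg 40 ≤ n := by have := hge (s.reg 40 - 1) (by omega); omega
  rw [fill, run_seq, run_seq, run_seq, run_assign, Expr.eval_const]
  have hmark := markRoute_spec h hln
  set s₁ := markRoute.run s with hs₁
  have hc₁ : Ctx n A P s₁ := h.run _
  set s₂ := (Cmd.for 48 0 (.store 8 (.var 48) (.const 0))).run s₁ with hs₂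
  have hc₂ : Ctx n A P s₂ := hc₁.run _
  have h8 : ∀ v < n, s₂.arr 8 v = 0 := by
    intro v hv
    rw [hs₂, run_for_fill (fun _ => 0) (fun _ _ _ _ _ => rfl), hc₁.num, if_pos hv]
  set s₃ := s₂.setR 51 0 with hs₃
  have hc₃ : Ctx n A P s₃ := hc₂.setR _ _
  have g4 : s₃.arr 4 = s.arr 4 := by
    rw [hs₃, State.setR_arr, hs₂, run_arr _ _ rfl, hs₁, run_arr _ _ rfl]
  have g7 : s₃.arr 7 = s.arr 7 := by
    rw [hs₃, State.setR_arr, hs₂, run_arr _ _ rfl, hs₁, run_arr _ _ rfl]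
  have g9 : s₃.arr 9 = s₁.arr 9 := by
    rw [hs₃, State.setR_arr, hs₂, run_arr _ _ rfl]
  have g40 : s₃.reg 40 = s.reg 40 := by
    rw [hs₃, State.setR_reg, if_neg (by decide), hs₂, run_reg _ _ rfl, hs₁, run_reg _ _ rfl]
  have key := run_for_inv (c := fillStep) (x := 54) (b := 0) (s := s₃)
    (fun i s' => InFill n A P p pos (s.reg 40) i s') ?_ ?_
  · rw [hc₃.num] at key
    set t := (Cmd.for 54 0 fillStep).run s₃
    obtain ⟨k1, -, k3, -, k5, -, k7⟩ := key
    -- At most `n` because the entries are distinct; at least `n` because every vertex of the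
    -- solution is marked.
    have hcount : t.reg 51 = n := by
      have hmaps : ∀ i ∈ Finset.range (t.reg 51), t.arr 10 i ∈ Finset.range n := fun i hi =>
        Finset.mem_range.2 (k1.lt i (Finset.mem_range.1 hi))
      have hinj : Set.InjOn (t.arr 10) (Finset.range (t.reg 51) : Finset ℕ) := fun i hi j hj hij =>
        k1.inj i j (by simpa using hi) (by simpa using hj) hij
      have h1 := Finset.card_le_card_of_injOn _ hmaps hinj
      have h2 : Finset.range n ⊆ (Finset.range (t.reg 51)).image (t.arr 10) := by
        intro v hv
        have hv := Finset.mem_range.1 hv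
        obtain ⟨j, hj, rfl⟩ := hp.surj h.inst.refl hv
        obtain ⟨i, hi, hij⟩ := (k1.marked _ hv).1 (k5 j hj (by omega))
        exact Finset.mem_image.2 ⟨i, Finset.mem_range.2 hi, hij⟩
      have h3 := (Finset.card_le_card h2).trans Finset.card_image_le
      simp only [Finset.card_range] at h1 h3
      omega
    rw [hcount] at k1 k7
    refine ⟨k1.lt, k1.adj, fun i j hij hj hP => ?_, fun hc => ?_⟩
    -- A predecessor of entry `i` already stands at a position `m ≤ i`, so it cannot be entry `j`.
    · obtain ⟨m, hm, hmj⟩ := k1.pred i (by omega) _ hP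
      have := k1.inj m j (by omega) hj hmj
      omega
    · rw [k7 hln, (k3 hn).2]; exact hp.closed hc
  · have h51 : s₃.reg 51 = 0 := by simp [hs₃]
    refine InFill.setR ?_ (by decide)
    refine ⟨?_, fun _ => h51, by omega, fun j hj h1 => absurd (h8 _ (hp.lt _ (hposn j hj))) h1,
      fun j hj h1 => ?_, by omega, by omega⟩
    · rw [h51]
      refine ⟨by simp, fun v hv => ?_, by simp, by simp, by simp⟩
      simp [hs₃, h8 v hv]
    · have := h1 hl
      omega
  · intro i s' hi hx hf ih
    refine InFill.setR ?_ (by decide)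
    have e4 := (hf.arr 4).trans g4
    refine fillStep_spec (hc₃.frame hf) (by rw [e4]; exact hL) hp hx ((hf.reg 40).trans g40) hl hpos0
      hposl hposn hmono ?_ ?_ ?_ ih
    · rw [(hf.arr 7).trans g7]; exact hF
    · rw [e4]; exact hgap
    · intro v hv
      rw [(hf.arr 9).trans g9, hmark v hv]
      exact ⟨fun ⟨j, hj, h1⟩ => ⟨j, hj, (hF j hj) ▸ h1⟩, fun ⟨j, hj, h1⟩ => ⟨j, hj, (hF j hj).trans h1⟩⟩

end

/-! ### Verification of a sequence -/

/-- Check entry `x₆₁` of the sequence in array `10`. -/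
def verifyEntry : Cmd :=
  .seq (.when (.not (.lt (.get 10 (.var 61)) (.var 0))) (.assign 60 (.const 0)))
    (.seq (.when (.and (.lt (.add (.var 61) (.const 1)) (.var 0))
        (.not (adjE (.get 10 (.var 61)) (.get 10 (.add (.var 61) (.const 1))))))
        (.assign 60 (.const 0)))
      (.for 62 0 (.when (.and (.lt (.var 61) (.var 62))
        (ordE (.get 10 (.var 62)) (.get 10 (.var 61)))) (.assign 60 (.const 0)))))

/-- Set `x₅` to `1` if array `10` holds a solution. -/
def verify (cyc : Bool) : Cmd :=
  .seq (.assign 60 (.const 1)) (.seq (.for 61 0 verifyEntry)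
    (.seq (.when (.and (.const cyc.toNat) (.not (adjE (.get 10 (.sub (.var 0) (.const 1)))
        (.get 10 (.const 0))))) (.assign 60 (.const 0)))
      (.when (.var 60) (.assign 5 (.const 1)))))

section
variable {n : ℕ} {A P : ℕ → ℕ → Prop} {s : State}

theorem run_reject (e : Expr) (fl : ℕ) (s : State) :
    ((Cmd.when e (.assign fl (.const 0))).run s).reg fl ≠ 0 ↔ s.reg fl ≠ 0 ∧ ¬ e.Holds s := by
  rw [run_when]
  split_ifs with h
  · simp [h]
  · simp [h]

theorem verifyEntry_spec {i : ℕ} (h0 : s.reg 0 = n) (hi : s.reg 61 = i) :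
    (verifyEntry.run s).reg 60 ≠ 0 ↔ s.reg 60 ≠ 0 ∧ s.arr 10 i < n ∧
      (i + 1 < n → s.arr 0 (s.arr 2 (s.arr 10 i) + s.arr 10 (i + 1)) ≠ 0) ∧
      ∀ j < n, i < j → s.arr 1 (s.arr 2 (s.arr 10 j) + s.arr 10 i) = 0 := by
  rw [verifyEntry, run_seq, run_seq]
  set s₁ := (Cmd.when (.not (.lt (.get 10 (.var 61)) (.var 0))) (.assign 60 (.const 0))).run s
    with hs₁
  set s₂ := (Cmd.when (.and (.lt (.add (.var 61) (.const 1)) (.var 0))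
        (.not (adjE (.get 10 (.var 61)) (.get 10 (.add (.var 61) (.const 1))))))
        (.assign 60 (.const 0))).run s₁ with hs₂
  have a1 : ∀ a, s₁.arr a = s.arr a := fun a => run_arr _ _ rfl
  have a2 : ∀ a, s₂.arr a = s.arr a := fun a => (run_arr _ _ rfl).trans (a1 a)
  have r1 : s₁.reg 0 = n := (run_reg _ _ rfl).trans h0
  have r2 : s₂.reg 0 = n := (run_reg _ _ rfl).trans r1
  have q1 : s₁.reg 61 = i := (run_reg _ _ rfl).trans hi
  have q2 : s₂.reg 61 = i := (run_reg _ _ rfl).trans q1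
  rw [run_for_flag (by decide)
    (fun j => i < j → s.arr 1 (s.arr 2 (s.arr 10 j) + s.arr 10 i) = 0), r2, hs₂, run_reject, hs₁,
    run_reject, ← hs₁]
  · have e1 : (Expr.not (.lt (.get 10 (.var 61)) (.var 0))).Holds s ↔ ¬ s.arr 10 i < n := by
      simp [hi, h0]
    have e2 : (Expr.and (.lt (.add (.var 61) (.const 1)) (.var 0))
        (.not (adjE (.get 10 (.var 61)) (.get 10 (.add (.var 61) (.const 1)))))).Holds s₁ ↔
        i + 1 < n ∧ ¬ s.arr 0 (s.arr 2 (s.arr 10 i) + s.arr 10 (i + 1)) ≠ 0 := by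
      simp [adjE, q1, r1, a1]
    rw [e1, e2]
    simp only [not_and, not_not, and_assoc]
  · intro j s' _ hx hf
    rw [run_reject]
    have : (Expr.and (.lt (.var 61) (.var 62))
        (ordE (.get 10 (.var 62)) (.get 10 (.var 61)))).Holds s' ↔
        i < j ∧ s.arr 1 (s.arr 2 (s.arr 10 j) + s.arr 10 i) ≠ 0 := by
      simp [ordE, hx, hf.reg 61, q2, hf.arr 1, hf.arr 2, hf.arr 10, a2]
    rw [this]
    simp only [not_and, not_not, ne_eq]

/-- This makes the program sound: whatever a wrong guess leaves in array `10`, only a genuine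
solution sets `x₅`. Distinctness is not checked separately, as the order condition and reflexivity
imply it. -/
theorem verify_spec {cyc : Bool} (h : Ctx n A P s) (hn : 0 < n) :
    ((verify cyc).run s).reg 5 ≠ 0 ↔
      s.reg 5 ≠ 0 ∨ IsSolution n A P (cyc = true) (s.arr 10) := by
  rw [verify, run_seq, run_seq, run_seq, run_assign, Expr.eval_const]
  set s₀ := s.setR 60 1 with hs₀
  have hc₀ : Ctx n A P s₀ := h.setR _ _
  set s₁ := (Cmd.for 61 0 verifyEntry).run s₀ with hs₁
  have hc₁ : Ctx n A P s₁ := hc₀.run _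
  have a1 : ∀ a, s₁.arr a = s.arr a := fun a => run_arr _ _ rfl
  have k1 : s₁.reg 60 ≠ 0 ↔ ∀ i < n, s.arr 10 i < n ∧
      (i + 1 < n → s.arr 0 (s.arr 2 (s.arr 10 i) + s.arr 10 (i + 1)) ≠ 0) ∧
      ∀ j < n, i < j → s.arr 1 (s.arr 2 (s.arr 10 j) + s.arr 10 i) = 0 := by
    rw [hs₁, run_for_flag (by decide) (fun i => s.arr 10 i < n ∧
      (i + 1 < n → s.arr 0 (s.arr 2 (s.arr 10 i) + s.arr 10 (i + 1)) ≠ 0) ∧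
      ∀ j < n, i < j → s.arr 1 (s.arr 2 (s.arr 10 j) + s.arr 10 i) = 0), hc₀.num]
    · simp [hs₀]
    · intro i s' _ hx hf
      rw [verifyEntry_spec ((hf.reg 0).trans hc₀.num) hx, hf.arr 0, hf.arr 1, hf.arr 2, hf.arr 10]
      simp [hs₀]
  set s₂ := (Cmd.when (.and (.const cyc.toNat) (.not (adjE (.get 10 (.sub (.var 0) (.const 1)))
        (.get 10 (.const 0))))) (.assign 60 (.const 0))).run s₁ with hs₂
  have r5 : s₂.reg 5 = s.reg 5 := by
    rw [hs₂, run_reg _ _ rfl, hs₁, run_reg _ _ rfl, hs₀, State.setR_reg, if_neg (by decide)]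
  have k2 : s₂.reg 60 ≠ 0 ↔ s₁.reg 60 ≠ 0 ∧
      (cyc = true → s.arr 0 (s.arr 2 (s.arr 10 (n - 1)) + s.arr 10 0) ≠ 0) := by
    rw [hs₂, run_reject]
    have : (Expr.and (.const cyc.toNat) (.not (adjE (.get 10 (.sub (.var 0) (.const 1)))
        (.get 10 (.const 0))))).Holds s₁ ↔
        cyc = true ∧ ¬ s.arr 0 (s.arr 2 (s.arr 10 (n - 1)) + s.arr 10 0) ≠ 0 := by
      cases cyc <;> simp [adjE, hc₁.num, a1]
    rw [this]
    simp only [not_and, not_not]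
  have main : s₂.reg 60 ≠ 0 ↔ IsSolution n A P (cyc = true) (s.arr 10) := by
    rw [k2, k1]
    constructor
    · rintro ⟨h1, h2⟩
      have hlt : ∀ i < n, s.arr 10 i < n := fun i hi => (h1 i hi).1
      refine ⟨hlt, fun i hi => ?_, fun i j hij hj => ?_, fun hc => ?_⟩
      · exact (h.adj _ _ (hlt _ (by omega)) (hlt _ hi)).1 ((h1 i (by omega)).2.1 hi)
      · rw [← h.ord _ _ (hlt _ hj) (hlt _ (by omega)), not_not]
        exact (h1 i (by omega)).2.2 j hj hij
      · exact (h.adj _ _ (hlt _ (by omega)) (hlt _ hn)).1 (h2 hc)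
    · intro hs
      refine ⟨fun i hi => ⟨hs.lt i hi, fun h1 => ?_, fun j hj hij => ?_⟩, fun hc => ?_⟩
      · exact (h.adj _ _ (hs.lt _ hi) (hs.lt _ h1)).2 (hs.adj i h1)
      · by_contra h1
        exact hs.ord i j hij hj ((h.ord _ _ (hs.lt _ hj) (hs.lt _ hi)).1 h1)
      · exact (h.adj _ _ (hs.lt _ (by omega)) (hs.lt _ hn)).2 (hs.closed hc)
  rw [run_when, ← main]
  by_cases h60 : s₂.reg 60 ≠ 0
  · rw [if_pos (by simpa using h60)]
    simp [h60]
  · rw [if_neg (by simpa using h60), r5]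
    exact ⟨Or.inl, fun h1 => h1.resolve_right h60⟩

/-! ### Enumeration of the guesses -/

/-- Divide `x₁₁` by the number of vertices, with quotient `x₁₂` and remainder `x₁₁`. -/
def divide : Cmd :=
  .seq (.assign 12 (.const 0)) (.for 13 1 (.when (.not (.lt (.var 11) (.var 0)))
    (.seq (.assign 11 (.sub (.var 11) (.var 0))) (.assign 12 (.add (.var 12) (.const 1))))))

/-- Write the first `x₂` digits of `x₈` in base `n` to array `3`. -/
def decode : Cmd :=
  .seq (.assign 11 (.var 8)) (.for 10 2 (.seq divide
    (.seq (.store 3 (.var 10) (.var 11)) (.assign 11 (.var 12)))))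

/-- Mark the first `x₃` entries of array `3` in array `4`. -/
def markDeleted : Cmd :=
  .seq (.for 14 0 (.store 4 (.var 14) (.const 0)))
    (.for 15 2 (.when (.lt (.var 15) (.var 3)) (.store 4 (.get 3 (.var 15)) (.const 1))))

/-- Division by repeated subtraction. The loop bound `x₁` suffices because the quotient is at most
the dividend, which is smaller than `x₁`. -/
theorem divide_spec (hn : 0 < n) (h0 : s.reg 0 = n) (hN : s.reg 11 < s.reg 1) :
    (divide.run s).reg 11 = s.reg 11 % n ∧ (divide.run s).reg 12 = s.reg 11 / n := by
  rw [divide, run_seq, run_assign, Expr.eval_const]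
  set s₀ := s.setR 12 0 with hs₀
  have key := run_for_inv (c := .when (.not (.lt (.var 11) (.var 0)))
    (.seq (.assign 11 (.sub (.var 11) (.var 0))) (.assign 12 (.add (.var 12) (.const 1)))))
    (x := 13) (b := 1) (s := s₀)
    (fun i s' => s'.reg 11 + n * s'.reg 12 = s.reg 11 ∧ (s'.reg 11 < n ∨ i ≤ s'.reg 12)) ?_ ?_
  · set t := (Cmd.for 13 1 (.when (.not (.lt (.var 11) (.var 0)))
      (.seq (.assign 11 (.sub (.var 11) (.var 0))) (.assign 12 (.add (.var 12) (.const 1)))))).run s₀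
    obtain ⟨k1, k2⟩ := key
    have e1 : s₀.reg 1 = s.reg 1 := rfl
    have hlt : t.reg 11 < n := by
      rcases k2 with k2 | k2
      · exact k2
      · have h1 : t.reg 12 ≤ n * t.reg 12 := Nat.le_mul_of_pos_left _ hn
        omega
    have := (Nat.div_mod_unique hn).2 ⟨k1, hlt⟩
    exact ⟨this.2.symm, this.1.symm⟩
  · simp [hs₀]
  · intro i s' _ hx hf ⟨ih1, ih2⟩
    have e0 : s'.reg 0 = n := (hf.reg 0).trans h0
    have hcond : (Expr.not (.lt (.var 11) (.var 0))).Holds s' ↔ ¬ s'.reg 11 < n := by simp [e0]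
    rw [run_when]
    by_cases hc : s'.reg 11 < n
    · rw [if_neg (by rw [hcond]; exact not_not.2 hc)]
      exact ⟨by simpa using ih1, Or.inl (by simpa using hc)⟩
    · rw [if_pos (hcond.2 hc)]
      have g11 : ((((Cmd.seq (.assign 11 (.sub (.var 11) (.var 0)))
        (.assign 12 (.add (.var 12) (.const 1)))).run s').setR 13 (i + 1)).reg 11) =
          s'.reg 11 - n := by simp [e0]
      have g12 : ((((Cmd.seq (.assign 11 (.sub (.var 11) (.var 0)))
        (.assign 12 (.add (.var 12) (.const 1)))).run s').setR 13 (i + 1)).reg 12) =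
          s'.reg 12 + 1 := by simp
      rw [g11, g12]
      refine ⟨?_, Or.inr (by omega)⟩
      rw [Nat.mul_add, Nat.mul_one]
      omega

theorem decode_spec (hn : 0 < n) (h0 : s.reg 0 = n) (hN : s.reg 8 < s.reg 1) :
    ∀ j < s.reg 2, (decode.run s).arr 3 j = s.reg 8 / n ^ j % n := by
  rw [decode, run_seq, run_assign, Expr.eval_var]
  set s₀ := s.setR 11 (s.reg 8) with hs₀
  have key := run_for_inv (c := .seq divide
    (.seq (.store 3 (.var 10) (.var 11)) (.assign 11 (.var 12)))) (x := 10) (b := 2) (s := s₀)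
    (fun i s' => s'.reg 11 = s.reg 8 / n ^ i ∧ ∀ j < i, s'.arr 3 j = s.reg 8 / n ^ j % n) ?_ ?_
  · exact key.2
  · simp [hs₀]
  · intro i s' _ hx hf ⟨ih1, ih2⟩
    have e0 : s'.reg 0 = n := (hf.reg 0).trans h0
    have e1 : s'.reg 1 = s.reg 1 := hf.reg 1
    obtain ⟨d1, d2⟩ := divide_spec hn e0 (by
      rw [ih1, e1]; exact (Nat.div_le_self _ _).trans_lt hN)
    have e10 : (divide.run s').reg 10 = i := (run_reg _ _ rfl).trans hx
    have e3 : (divide.run s').arr 3 = s'.arr 3 := run_arr _ _ rfl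
    refine ⟨?_, fun j hj => ?_⟩
    · simp [d2, ih1, Nat.div_div_eq_div_mul, pow_succ]
    · simp only [run_seq, run_store, run_assign, State.setR_arr, Expr.eval_var, State.setA_arr_self,
        e10, d1, ih1, e3]
      split_ifs with h1
      · rw [h1]
      · exact ih2 j (by omega)

/-- Horner's scheme, with the least significant digit first. -/
theorem exists_digits (t : ℕ → ℕ) (m : ℕ) (ht : ∀ j < m, t j < n) :
    ∃ x < n ^ m, ∀ j < m, x / n ^ j % n = t j := by
  induction m generalizing t with
  | zero => exact ⟨0, by simp, by simp⟩
  | succ m ih =>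
    obtain ⟨x, hx, hxt⟩ := ih (fun j => t (j + 1)) fun j hj => ht (j + 1) (by omega)
    have h0 := ht 0 (by omega)
    refine ⟨t 0 + n * x, ?_, fun j hj => ?_⟩
    · rw [pow_succ]
      calc t 0 + n * x < n + n * x := by omega
        _ = (x + 1) * n := by ring
        _ ≤ n ^ m * n := Nat.mul_le_mul_right _ hx
    · cases j with
      | zero => simp [Nat.mod_eq_of_lt h0]
      | succ j =>
        have h1 : (t 0 + n * x) / n = x := by
          rw [Nat.add_mul_div_left _ _ (by omega), Nat.div_eq_of_lt h0, Nat.zero_add]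
        rw [pow_succ', ← Nat.div_div_eq_div_mul, h1]
        exact hxt j (by omega)

theorem markDeleted_spec (h : Ctx n A P s) (hk : s.reg 3 ≤ s.reg 2) (v : ℕ) (hv : v < n) :
    (markDeleted.run s).arr 4 v ≠ 0 ↔ ∃ i < s.reg 3, s.arr 3 i = v := by
  rw [markDeleted, run_seq]
  set s₁ := (Cmd.for 14 0 (.store 4 (.var 14) (.const 0))).run s with hs₁
  have h4 : s₁.arr 4 v = 0 := by
    rw [hs₁, run_for_fill (fun _ => 0) (fun _ _ _ _ _ => rfl), h.num, if_pos hv]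
  have e3 : s₁.reg 3 = s.reg 3 := run_reg _ _ rfl
  have e2 : s₁.reg 2 = s.reg 2 := run_reg _ _ rfl
  have a3 : s₁.arr 3 = s.arr 3 := run_arr _ _ rfl
  have key := run_for_inv (c := .when (.lt (.var 15) (.var 3))
    (.store 4 (.get 3 (.var 15)) (.const 1))) (x := 15) (b := 2) (s := s₁)
    (fun i s' => s'.arr 4 v ≠ 0 ↔ ∃ j, j < i ∧ j < s.reg 3 ∧ s.arr 3 j = v) ?_ ?_
  · rw [key, e2]
    exact ⟨fun ⟨j, _, h2, h3⟩ => ⟨j, h2, h3⟩, fun ⟨j, h2, h3⟩ => ⟨j, by omega, h2, h3⟩⟩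
  · simp [h4]
  · intro i s' _ hx hf ih
    have hstep : (∃ j, j < i + 1 ∧ j < s.reg 3 ∧ s.arr 3 j = v) ↔
        (i < s.reg 3 ∧ s.arr 3 i = v) ∨ ∃ j, j < i ∧ j < s.reg 3 ∧ s.arr 3 j = v := by
      constructor
      · rintro ⟨j, h3, h4⟩
        rcases Nat.lt_succ_iff_lt_or_eq.1 h3 with h5 | rfl
        · exact Or.inr ⟨j, h5, h4⟩
        · exact Or.inl h4
      · rintro (h3 | ⟨j, h3, h4⟩)
        · exact ⟨i, by omega, h3⟩
        · exact ⟨j, by omega, h4⟩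
    rw [hstep, ← ih]
    simp only [run_when, Expr.holds_lt, Expr.eval_var, hx, hf.reg 3, e3, State.setR_arr]
    split_ifs with h1
    · simp only [run_store, Expr.eval_get, Expr.eval_var, hx, hf.arr 3, a3, State.setA_arr_self,
        Expr.eval_const]
      split_ifs with h2
      · simp [h1, h2.symm]
      · have : s.arr 3 i ≠ v := fun h3 => h2 h3.symm
        simp [this]
    · simp [h1]

/-- Treat the guess with number `x₈`. -/
def guess (cyc : Bool) : Cmd :=
  .seq decode (.seq markDeleted (.seq testBlocks
    (.when (.var 30) (.seq (.assign 4 (.const 1)) (.seq route (.seq fill (verify cyc)))))))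

/-- Array `4` is controlled only below `n`, which is enough because `A` has no edges elsewhere. -/
theorem LeavesBlocks.congr {W W' : ℕ → Prop} (hI : Inst n A P) (h : ∀ v < n, W v ↔ W' v)
    (hL : LeavesBlocks A W) : LeavesBlocks A W' := by
  intro s u v hs hu hv hsu hsv huv hr
  obtain ⟨h1, h2⟩ := hI.lt _ _ hsu
  obtain ⟨_, h3⟩ := hI.lt _ _ hsv
  refine hL s u v (by rwa [h _ h1]) (by rwa [h _ h2]) (by rwa [h _ h3]) hsu hsv huv
    (ReflTransGen.mono (fun a b hab => ⟨hab.1, ?_⟩) _ _ hr)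
  rw [h _ (hI.lt _ _ hab.1).2]
  exact hab.2

/-- The set of the first `k` digits of `x` in base `n`. -/
def digitSet (n k x v : ℕ) : Prop := ∃ j < k, x / n ^ j % n = v

/-- The number `x` encodes a set that leaves a block graph and suitable vertices of a solution. -/
def GoodGuess (n : ℕ) (A P : ℕ → ℕ → Prop) (cyc : Prop) (k x : ℕ) : Prop :=
  LeavesBlocks A (digitSet n k x) ∧ ∃ p a : ℕ → ℕ, IsSolution n A P cyc p ∧ a 0 = 0 ∧
    a (3 * k + 1) = n - 1 ∧ (∀ j, a j < n) ∧
    (∀ j, AnchorStep (digitSet n k x) p (a j) (a (j + 1))) ∧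
    ∀ j < 3 * k + 2, x / n ^ (k + j) % n = p (a j)

/-- `x₄` records that the current size suffices. That `x₅` is set only rightly is due to `verify`
alone; the route and its greedy completion matter only for the last claim, that a good guess is
recognized. -/
theorem guess_spec {cyc : Bool} {k : ℕ} (h : Ctx n A P s) (hn : 0 < n) (h3 : s.reg 3 = k)
    (h2 : s.reg 2 = 4 * k + 2) (h8 : s.reg 8 < s.reg 1) :
    (((guess cyc).run s).reg 4 ≠ 0 ↔ s.reg 4 ≠ 0 ∨ LeavesBlocks A (digitSet n k (s.reg 8))) ∧
    (((guess cyc).run s).reg 5 ≠ 0 → s.reg 5 ≠ 0 ∨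
      LeavesBlocks A (digitSet n k (s.reg 8)) ∧ ∃ q, IsSolution n A P (cyc = true) q) ∧
    ((s.reg 5 ≠ 0 ∨ GoodGuess n A P (cyc = true) k (s.reg 8)) →
      ((guess cyc).run s).reg 5 ≠ 0) := by
  rw [guess, run_seq, run_seq, run_seq]
  have hdec := decode_spec hn h.num h8
  set s₁ := decode.run s with hs₁
  have hc₁ : Ctx n A P s₁ := h.run _
  have b2 : s₁.reg 2 = 4 * k + 2 := (run_reg _ _ rfl).trans h2
  have b3 : s₁.reg 3 = k := (run_reg _ _ rfl).trans h3
  have hmark := markDeleted_spec hc₁ (by omega)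
  set s₂ := markDeleted.run s₁ with hs₂
  have hc₂ : Ctx n A P s₂ := hc₁.run _
  have hW : ∀ v < n, s₂.arr 4 v ≠ 0 ↔ digitSet n k (s.reg 8) v := by
    intro v hv
    rw [hmark v hv, b3, digitSet]
    refine exists_congr fun j => and_congr_right fun hj => ?_
    rw [hdec j (by omega)]
  have htest := testBlocks_spec hc₂
  set s₃ := testBlocks.run s₂ with hs₃
  have hc₃ : Ctx n A P s₃ := hc₂.run _
  have d4 : s₃.arr 4 = s₂.arr 4 := run_arr _ _ rfl
  have d3 : s₃.arr 3 = s₁.arr 3 := (run_arr _ _ rfl).trans (run_arr _ _ rfl)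
  have r2 : s₃.reg 2 = 4 * k + 2 := by rw [hs₃, run_reg _ _ rfl, hs₂, run_reg _ _ rfl, b2]
  have r3 : s₃.reg 3 = k := by rw [hs₃, run_reg _ _ rfl, hs₂, run_reg _ _ rfl, b3]
  have r4 : s₃.reg 4 = s.reg 4 := by
    rw [hs₃, run_reg _ _ rfl, hs₂, run_reg _ _ rfl, hs₁, run_reg _ _ rfl]
  have r5 : s₃.reg 5 = s.reg 5 := by
    rw [hs₃, run_reg _ _ rfl, hs₂, run_reg _ _ rfl, hs₁, run_reg _ _ rfl]
  have htest' : s₃.reg 30 ≠ 0 ↔ LeavesBlocks A (digitSet n k (s.reg 8)) :=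
    htest.trans ⟨fun hL => hL.congr h.inst hW, fun hL => hL.congr h.inst fun v hv => (hW v hv).symm⟩
  rw [run_when]
  by_cases h30 : s₃.reg 30 ≠ 0
  swap
  · rw [if_neg (by simpa using h30), r4, r5, ← htest']
    exact ⟨⟨Or.inl, fun h1 => h1.resolve_right h30⟩, Or.inl,
      fun h1 => h1.elim id fun h2 => absurd (htest'.2 h2.1) h30⟩
  rw [if_pos (by simpa using h30)]
  simp only [run_seq, run_assign, Expr.eval_const]
  set s₄ := s₃.setR 4 1 with hs₄
  have hc₄ : Ctx n A P s₄ := hc₃.setR _ _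
  set s₅ := route.run s₄ with hs₅
  have hc₅ : Ctx n A P s₅ := hc₄.run _
  set s₆ := fill.run s₅ with hs₆
  have hc₆ : Ctx n A P s₆ := hc₅.run _
  have v5 : s₆.reg 5 = s.reg 5 := by
    rw [hs₆, run_reg _ _ rfl, hs₅, run_reg _ _ rfl, hs₄, State.setR_reg, if_neg (by decide), r5]
  have hver := verify_spec (cyc := cyc) hc₆ hn
  rw [v5] at hver
  refine ⟨?_, fun h1 => ?_, ?_⟩
  · rw [run_reg (verify cyc) _ rfl, hs₆, run_reg _ _ rfl, hs₅, run_reg _ _ rfl, hs₄, ← htest']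
    simp [h30]
  · exact (hver.1 h1).imp id fun h2 => ⟨htest'.1 h30, _, h2⟩
  · rw [hver]
    refine Or.imp id ?_
    rintro ⟨_, p, a, hp, ha0, hal, han, hstep, hdig⟩
    have c4 : s₄.arr 4 = s₂.arr 4 := d4
    have hstep' : ∀ j, AnchorStep (fun v => s₄.arr 4 v ≠ 0) p (a j) (a (j + 1)) := by
      intro j
      rcases hstep j with h1 | h1 | ⟨h1, h2⟩
      · exact Or.inl h1
      · exact Or.inr (Or.inl h1)
      · refine Or.inr (Or.inr ⟨h1, fun i h3 h4 => ?_⟩)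
        beta_reduce
        rw [c4, hW _ (hp.lt _ (by have := han (j + 1); omega))]
        exact h2 i h3 h4
    have hL : LeavesBlocks A (fun v => s₄.arr 4 v ≠ 0) := by rw [c4]; exact htest.1 h30
    have q2 : s₄.reg 2 = 4 * k + 2 := r2
    have q3 : s₄.reg 3 = k := r3
    have hroute := route_spec hc₄ hp hL (by omega) ha0 han hstep' (by
      intro j hj
      rw [q2, q3] at hj
      rw [q3]
      change s₃.arr 3 (k + j) = _
      rw [d3, hdec _ (by omega)]
      exact hdig j (by omega))
    rw [q2, q3, show 4 * k + 2 - 1 - k = 3 * k + 1 by omega, hal] at hroute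
    have c45 : s₅.arr 4 = s₄.arr 4 := run_arr _ _ rfl
    exact fill_spec hc₅ hn (by rw [c45]; exact hL) hp (by rw [c45]; exact hroute)

/-- Some set of at most `k` vertices leaves a block graph. -/
def DistLe (n : ℕ) (A : ℕ → ℕ → Prop) (k : ℕ) : Prop :=
  ∃ w : ℕ → ℕ, (∀ j < k, w j < n) ∧ LeavesBlocks A (fun v => ∃ j < k, w j = v)

theorem DistLe.exists_digitSet {k : ℕ} (hI : Inst n A P) (hn : 0 < n) (h : DistLe n A k) :
    ∃ x < n ^ (4 * k + 2), LeavesBlocks A (digitSet n k x) := by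
  obtain ⟨w, hw, hL⟩ := h
  -- The digits for the anchors play no part here and are set to 0.
  obtain ⟨x, hx, hxt⟩ := exists_digits (n := n) (fun j => if j < k then w j else 0) (4 * k + 2)
    (fun j _ => by split_ifs with h1; exacts [hw j h1, hn])
  refine ⟨x, hx, hL.congr hI fun v _ => exists_congr fun j => and_congr_right fun hj => ?_⟩
  rw [hxt j (by omega), if_pos hj]

/-- The first `k` digits list the deleted set, the other 3k + 2 the anchors of `p`. -/
theorem DistLe.exists_goodGuess {k : ℕ} {cyc : Prop} {p : ℕ → ℕ} (hI : Inst n A P) (hn : 0 < n)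
    (h : DistLe n A k) (hp : IsSolution n A P cyc p) :
    ∃ x < n ^ (4 * k + 2), GoodGuess n A P cyc k x := by
  obtain ⟨w, hw, hL⟩ := h
  obtain ⟨a, ha0, hal, han, hstep⟩ := exists_anchors (W := fun v => ∃ j < k, w j = v) (w := w)
    (p := p) (k := k) hn (fun i _ => id) fun i j hi hj => hp.inj hI.refl hi hj
  obtain ⟨x, hx, hxt⟩ := exists_digits (n := n) (fun j => if j < k then w j else p (a (j - k)))
    (4 * k + 2) (fun j _ => by split_ifs with h1; exacts [hw j h1, hp.lt _ (han _)])
  have hset : digitSet n k x = fun v => ∃ j < k, w j = v := by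
    funext v
    refine propext (exists_congr fun j => and_congr_right fun hj => ?_)
    rw [hxt j (by omega), if_pos hj]
  refine ⟨x, hx, by rw [hset]; exact hL, p, a, hp, ha0, hal, han, by rw [hset]; exact hstep,
    fun j hj => ?_⟩
  rw [hxt _ (by omega), if_neg (by omega), Nat.add_sub_cancel_left]

theorem DistLe.of_digitSet {k x : ℕ} (hn : 0 < n) (h : LeavesBlocks A (digitSet n k x)) :
    DistLe n A k :=
  ⟨fun j => x / n ^ j % n, fun _ _ => Nat.mod_lt _ hn, h⟩

/-- The loop continues after a suitable set has been found, so at the first successful size all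
guesses are examined, among them a good one if a solution exists. For `n = 0` there are no guesses,
hence the condition `0 < n`. -/
theorem guesses_spec {cyc : Bool} {k : ℕ} (h : Ctx n A P s) (h3 : s.reg 3 = k)
    (h2 : s.reg 2 = 4 * k + 2) (h1 : s.reg 1 = n ^ (4 * k + 2)) (h4 : s.reg 4 = 0)
    (h5 : s.reg 5 = 0) :
    (0 < n → (((Cmd.for 8 1 (guess cyc)).run s).reg 4 ≠ 0 ↔ DistLe n A k)) ∧
    (((Cmd.for 8 1 (guess cyc)).run s).reg 5 ≠ 0 →
      ((Cmd.for 8 1 (guess cyc)).run s).reg 4 ≠ 0 ∧ 0 < n ∧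
        ∃ q, IsSolution n A P (cyc = true) q) ∧
    (((Cmd.for 8 1 (guess cyc)).run s).reg 4 ≠ 0 → (∃ q, IsSolution n A P (cyc = true) q) →
      ((Cmd.for 8 1 (guess cyc)).run s).reg 5 ≠ 0) := by
  rcases Nat.eq_zero_or_pos n with hn | hn
  · have hrun : (Cmd.for 8 1 (guess cyc)).run s = s.setR 8 0 := by
      have : s.reg 1 = 0 := by rw [h1, hn]; exact Nat.zero_pow (by omega)
      rw [Cmd.run, this]; rfl
    rw [hrun]
    simp [hn, h4, h5]
  have key := run_for_inv (c := guess cyc) (x := 8) (b := 1) (s := s)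
    (fun i s' => (s'.reg 4 ≠ 0 ↔ ∃ x < i, LeavesBlocks A (digitSet n k x)) ∧
      (s'.reg 5 ≠ 0 → s'.reg 4 ≠ 0 ∧ ∃ q, IsSolution n A P (cyc = true) q) ∧
      ∀ x < i, GoodGuess n A P (cyc = true) k x → s'.reg 5 ≠ 0) ?_ ?_
  · set t := (Cmd.for 8 1 (guess cyc)).run s
    rw [h1] at key
    obtain ⟨k1, k2, k3⟩ := key
    have k4 : t.reg 4 ≠ 0 ↔ DistLe n A k := by
      rw [k1]
      exact ⟨fun ⟨x, _, hx⟩ => DistLe.of_digitSet hn hx, fun hd => hd.exists_digitSet h.inst hn⟩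
    refine ⟨fun _ => k4, fun h6 => ⟨(k2 h6).1, hn, (k2 h6).2⟩, fun h6 ⟨q, hq⟩ => ?_⟩
    obtain ⟨x, hx, hg⟩ := (k4.1 h6).exists_goodGuess h.inst hn hq
    exact k3 x hx hg
  · simp [h4, h5]
  · intro i s' hi hx hf ⟨ih1, ih2, ih3⟩
    obtain ⟨g1, g2, g3⟩ := guess_spec (cyc := cyc) (h.frame hf) hn ((hf.reg 3).trans h3)
      ((hf.reg 2).trans h2) (by rw [hx, hf.reg 1]; exact hi)
    rw [hx] at g1 g2 g3
    have hex : ∀ Q : ℕ → Prop, (∃ x < i + 1, Q x) ↔ (∃ x < i, Q x) ∨ Q i := by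
      intro Q
      constructor
      · rintro ⟨x, h6, h7⟩
        rcases Nat.lt_succ_iff_lt_or_eq.1 h6 with h8 | rfl
        · exact Or.inl ⟨x, h8, h7⟩
        · exact Or.inr h7
      · rintro (⟨x, h6, h7⟩ | h7)
        · exact ⟨x, by omega, h7⟩
        · exact ⟨i, by omega, h7⟩
    set t := (guess cyc).run s'
    have t4 : (t.setR 8 (i + 1)).reg 4 = t.reg 4 := rfl
    have t5 : (t.setR 8 (i + 1)).reg 5 = t.reg 5 := rfl
    rw [t4, t5, hex, ← ih1, g1]
    refine ⟨Iff.rfl, fun h6 => ?_, fun x h6 h7 => g3 ?_⟩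
    · rcases g2 h6 with h7 | h7
      · exact ⟨Or.inl (ih2 h7).1, (ih2 h7).2⟩
      · exact ⟨Or.inr h7.1, h7.2⟩
    · rcases Nat.lt_succ_iff_lt_or_eq.1 h6 with h8 | rfl
      · exact Or.inl (ih3 x h8 h7)
      · exact Or.inr h7

end

/-! ### The whole program -/

/-- Multiply `x₁` by the number of vertices. -/
def mulNum : Cmd :=
  .seq (.assign 16 (.const 0)) (.seq (.for 17 0 (.assign 16 (.add (.var 16) (.var 1))))
    (.assign 1 (.var 16)))

/-- Pass to sets with one more vertex. -/
def advance : Cmd :=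
  .seq (.assign 3 (.add (.var 3) (.const 1))) (.seq (.assign 2 (.add (.var 2) (.const 4)))
    (.seq mulNum (.seq mulNum (.seq mulNum mulNum))))

/-- Treat all guesses with sets of `x₃` vertices, unless an earlier round was successful. -/
def level (cyc : Bool) : Cmd :=
  .when (.not (.var 4)) (.seq (.for 8 1 (guess cyc)) (.when (.not (.var 4)) advance))

/-- Initialization. -/
def setup : Cmd :=
  .seq (.assign 18 (.const 0)) (.seq (.for 19 0 (.seq (.store 2 (.var 19) (.var 18))
      (.assign 18 (.add (.var 18) (.var 0)))))
    (.seq (.assign 1 (.const 1)) (.seq mulNum (.seq mulNum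
      (.seq (.assign 2 (.const 2)) (.assign 6 (.add (.var 0) (.const 1))))))))

/-- The program for the path problem or, if `cyc` is true, the cycle problem. -/
def solver (cyc : Bool) : Cmd :=
  .seq setup (.seq (.for 7 6 (level cyc)) (.assign 0 (.lt (.const 0) (.var 5))))

section
variable {n : ℕ} {A P : ℕ → ℕ → Prop} {s : State}

theorem mulNum_spec (h0 : s.reg 0 = n) : (mulNum.run s).reg 1 = s.reg 1 * n := by
  rw [mulNum]
  simp only [run_seq, run_assign, Expr.eval_const, Expr.eval_var]
  set s₀ := s.setR 16 0 with hs₀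
  have e0 : s₀.reg 0 = n := h0
  have key := run_for_inv (c := .assign 16 (.add (.var 16) (.var 1))) (x := 17) (b := 0) (s := s₀)
    (fun i s' => s'.reg 16 = s.reg 1 * i) (by simp [hs₀]) (by
      intro i s' _ _ hf ih
      have e1 : s'.reg 1 = s.reg 1 := hf.reg 1
      simp [ih, e1, Nat.mul_add])
  rw [e0] at key
  simpa using key

theorem advance_spec (h0 : s.reg 0 = n) : (advance.run s).reg 3 = s.reg 3 + 1 ∧
    (advance.run s).reg 2 = s.reg 2 + 4 ∧ (advance.run s).reg 1 = s.reg 1 * n ^ 4 := by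
  rw [advance]
  simp only [run_seq, run_assign, Expr.eval_add, Expr.eval_var, Expr.eval_const]
  set s₁ := (s.setR 3 (s.reg 3 + 1)).setR 2 ((s.setR 3 (s.reg 3 + 1)).reg 2 + 4) with hs₁
  have e0 : s₁.reg 0 = n := h0
  have f0 : (mulNum.run s₁).reg 0 = n := (run_reg mulNum _ rfl).trans e0
  have g0 : (mulNum.run (mulNum.run s₁)).reg 0 = n := (run_reg mulNum _ rfl).trans f0
  have i0 : (mulNum.run (mulNum.run (mulNum.run s₁))).reg 0 = n := (run_reg mulNum _ rfl).trans g0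
  refine ⟨?_, ?_, ?_⟩
  · rw [run_reg mulNum _ rfl, run_reg mulNum _ rfl, run_reg mulNum _ rfl, run_reg mulNum _ rfl]
    simp [hs₁]
  · rw [run_reg mulNum _ rfl, run_reg mulNum _ rfl, run_reg mulNum _ rfl, run_reg mulNum _ rfl]
    simp [hs₁]
  · rw [mulNum_spec i0, mulNum_spec g0, mulNum_spec f0, mulNum_spec e0]
    have : s₁.reg 1 = s.reg 1 := rfl
    rw [this]; ring

/-- The situation before the guesses with sets of `i` vertices are treated. -/
structure InSearch (n : ℕ) (A P : ℕ → ℕ → Prop) (cyc : Prop) (i : ℕ) (s : State) : Prop where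
  ctx : Ctx n A P s
  size : s.reg 4 = 0 → s.reg 3 = i ∧ s.reg 2 = 4 * i + 2 ∧ s.reg 1 = n ^ (4 * i + 2) ∧ s.reg 5 = 0
  fail : s.reg 4 = 0 → 0 < n → ∀ k < i, ¬ DistLe n A k
  sound : s.reg 5 ≠ 0 → 0 < n ∧ ∃ q, IsSolution n A P cyc q
  complete : s.reg 4 ≠ 0 → (∃ q, IsSolution n A P cyc q) → s.reg 5 ≠ 0

theorem InSearch.setR {cyc : Prop} {i x v : ℕ} (h : InSearch n A P cyc i s)
    (hx : x = 7) : InSearch n A P cyc i (s.setR x v) := by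
  subst hx
  exact ⟨h.ctx.setR _ _, h.size, h.fail, h.sound, h.complete⟩

/-- Once `x₄` is nonzero, nothing changes any more and `x₅` holds the answer. Otherwise no set of
size `i` works, and the registers pass to the next size. -/
theorem level_spec {cyc : Bool} {i : ℕ} (h : InSearch n A P (cyc = true) i s) :
    InSearch n A P (cyc = true) (i + 1) ((level cyc).run s) := by
  have hc' : Ctx n A P ((level cyc).run s) := h.ctx.run _
  have hcond : (Expr.not (.var 4)).Holds s ↔ s.reg 4 = 0 := by simp
  by_cases h4 : s.reg 4 = 0
  swap
  · have : (level cyc).run s = s := by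
      rw [level, run_when, if_neg (by rw [hcond]; exact h4)]
    rw [this]
    exact ⟨h.ctx, fun h1 => absurd h1 h4, fun h1 => absurd h1 h4, h.sound, h.complete⟩
  obtain ⟨h3, h2, h1, h5⟩ := h.size h4
  obtain ⟨g1, g2, g3⟩ := guesses_spec (cyc := cyc) h.ctx h3 h2 h1 h4 h5
  have hrun : (level cyc).run s = (Cmd.when (.not (.var 4)) advance).run
      ((Cmd.for 8 1 (guess cyc)).run s) := by
    rw [level, run_when, if_pos (hcond.2 h4), run_seq]
  set t := (Cmd.for 8 1 (guess cyc)).run s with ht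
  have hct : Ctx n A P t := h.ctx.run _
  have t1 : t.reg 1 = s.reg 1 := run_reg _ _ rfl
  have t2 : t.reg 2 = s.reg 2 := run_reg _ _ rfl
  have t3 : t.reg 3 = s.reg 3 := run_reg _ _ rfl
  have hcond' : (Expr.not (.var 4)).Holds t ↔ t.reg 4 = 0 := by simp
  rw [hrun] at hc' ⊢
  rw [run_when] at hc' ⊢
  by_cases t4 : t.reg 4 = 0
  swap
  · rw [if_neg (by rw [hcond']; exact t4)]
    exact ⟨hct, fun h6 => absurd h6 t4, fun h6 => absurd h6 t4, fun h6 => (g2 h6).2, g3⟩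
  · rw [if_pos (hcond'.2 t4)] at hc' ⊢
    obtain ⟨a1, a2, a3⟩ := advance_spec hct.num
    have b4 : (advance.run t).reg 4 = t.reg 4 := run_reg _ _ rfl
    have b5 : (advance.run t).reg 5 = t.reg 5 := run_reg _ _ rfl
    have t5 : t.reg 5 = 0 := by
      by_contra h6
      exact (g2 h6).1 t4
    refine ⟨hc', fun _ => ⟨by omega, by omega, ?_, by omega⟩, fun _ hn k hk hd => ?_,
      fun h6 => absurd (b5.trans t5) h6, fun h6 => absurd (b4.trans t4) h6⟩
    · rw [a3, t1, h1, ← pow_add]; ring_nf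
    · rcases Nat.lt_succ_iff_lt_or_eq.1 hk with h6 | rfl
      · exact h.fail h4 hn k h6 hd
      · exact (g1 hn).2 hd t4

/-- Guesses of size `i` are treated only if all smaller sizes failed. Size `K` cannot fail, so `i ≤
K`; for `n = 0` only `i = 0` occurs. This is why the running time depends on the distance to block
without the program being told it. -/
theorem level_Bnd {cyc : Bool} {i M K : ℕ} (h : InSearch n A P (cyc = true) i s)
    (hi : i < n + 1) (hK : DistLe n A K) (hn : n ≤ M) (hM : ∀ k ≤ K, 4 * k + 2 ≤ M)
    (hN : ∀ k ≤ K, n ^ (4 * k + 2) ≤ M) : (level cyc).Bnd M s := by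
  refine ⟨fun h4 => ?_, fun _ => trivial⟩
  have h4' : s.reg 4 = 0 := by
    have : (Expr.not (.var 4)).Holds s := h4
    simpa using this
  obtain ⟨h3, h2, h1, -⟩ := h.size h4'
  have hiK : i ≤ K := by
    rcases Nat.eq_zero_or_pos n with h0 | h0
    · omega
    · by_contra hlt
      exact h.fail h4' h0 K (by omega) hK
  refine ⟨Bnd_of_boundsIn (l := [0, 1, 2]) _ _ rfl ?_, Bnd_of_boundsIn (l := [0]) _ _ rfl ?_⟩
  · simp only [List.mem_cons, List.not_mem_nil, or_false, forall_eq_or_imp, forall_eq]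
    exact ⟨by rw [h.ctx.num]; exact hn, by rw [h1]; exact hN i hiK, by rw [h2]; exact hM i hiK⟩
  · simp only [List.mem_cons, List.not_mem_nil, or_false, forall_eq]
    rw [run_reg _ _ rfl, h.ctx.num]; exact hn

/-! ### The initial memory -/

theorem matrixArray_ne_zero {R : Fin n → Fin n → Prop} {u v : ℕ} (hu : u < n) (hv : v < n) :
    matrixArray R (u * n + v) ≠ 0 ↔ natRel R u v := by
  have hn : 0 < n := by omega
  unfold matrixArray natRel
  constructor
  · intro h
    split_ifs at h with hex
    · obtain ⟨a, b, hab, hR⟩ := hex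
      have h1 : (u * n + v) / n = u := by
        rw [Nat.mul_comm, Nat.mul_add_div hn, Nat.div_eq_of_lt hv, Nat.add_zero]
      have h2 : (a * n + b : ℕ) / n = a := by
        rw [Nat.mul_comm, Nat.mul_add_div hn, Nat.div_eq_of_lt b.2, Nat.add_zero]
      have hua : u = a := by rw [← h1, hab, h2]
      subst hua
      have hvb : v = b := by omega
      subst hvb
      exact ⟨hu, hv, hR⟩
    · exact absurd rfl h
  · rintro ⟨_, _, hR⟩
    rw [if_pos ⟨⟨u, hu⟩, ⟨v, hv⟩, rfl, hR⟩]
    exact one_ne_zero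

theorem inst_of_isPartialOrder (G : SimpleGraph (Fin n)) (π : Fin n → Fin n → Prop)
    [IsPartialOrder (Fin n) π] : Inst n (natRel G.Adj) (natRel π) where
  lt := fun _ _ ⟨hu, hv, _⟩ => ⟨hu, hv⟩
  symm := fun _ _ ⟨hu, hv, h⟩ => ⟨hv, hu, h.symm⟩
  irrefl := fun _ ⟨_, _, h⟩ => G.loopless.irrefl _ h
  ordLt := fun _ _ ⟨hu, hv, _⟩ => ⟨hu, hv⟩
  refl := fun _ hu => ⟨hu, hu, refl_of π _⟩

theorem setup_spec (G : SimpleGraph (Fin n)) (π : Fin n → Fin n → Prop)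
    [IsPartialOrder (Fin n) π] (cyc : Prop) :
    InSearch n (natRel G.Adj) (natRel π) cyc 0 (setup.run (input G π)) ∧
      (setup.run (input G π)).reg 6 = n + 1 := by
  have hinst := inst_of_isPartialOrder G π
  rw [setup, run_seq, run_seq, run_assign, Expr.eval_const]
  set s₀ := (input G π).setR 18 0 with hs₀
  have z0 : s₀.reg 0 = n := rfl
  have key := run_for_inv (c := .seq (.store 2 (.var 19) (.var 18))
      (.assign 18 (.add (.var 18) (.var 0)))) (x := 19) (b := 0) (s := s₀)
    (fun i s' => s'.reg 18 = i * n ∧ ∀ j < i, s'.arr 2 j = j * n) (by simp [hs₀]) (by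
      intro i s' _ hx hf ⟨ih1, ih2⟩
      have e0 : s'.reg 0 = n := hf.reg 0
      refine ⟨by simp [ih1, e0, Nat.add_mul], fun j hj => ?_⟩
      simp only [run_seq, run_store, run_assign, State.setR_arr, Expr.eval_var, State.setA_arr_self,
        hx, ih1]
      split_ifs with h1
      · rw [h1]
      · exact ih2 j (by omega))
  rw [z0] at key
  set s₁ := (Cmd.for 19 0 (.seq (.store 2 (.var 19) (.var 18))
      (.assign 18 (.add (.var 18) (.var 0))))).run s₀ with hs₁
  have e0 : s₁.reg 0 = n := (run_reg _ _ rfl).trans z0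
  have a0 : s₁.arr 0 = matrixArray G.Adj := run_arr _ _ rfl
  have a1 : s₁.arr 1 = matrixArray π := run_arr _ _ rfl
  have hc₁ : Ctx n (natRel G.Adj) (natRel π) s₁ := by
    refine ⟨hinst, e0, fun u v hu hv => ?_, fun u v hu hv => ?_⟩
    · rw [a0, key.2 u hu]; exact matrixArray_ne_zero hu hv
    · rw [a1, key.2 u hu]; exact matrixArray_ne_zero hu hv
  have r3 : s₁.reg 3 = 0 := run_reg _ _ rfl
  have r4 : s₁.reg 4 = 0 := run_reg _ _ rfl
  have r5 : s₁.reg 5 = 0 := run_reg _ _ rfl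
  simp only [run_seq, run_assign, Expr.eval_add, Expr.eval_var, Expr.eval_const]
  set s₂ := s₁.setR 1 1 with hs₂
  have m1 := mulNum_spec (s := s₂) (n := n) e0
  set s₃ := mulNum.run s₂ with hs₃
  have f0 : s₃.reg 0 = n := (run_reg mulNum _ rfl).trans e0
  have m2 := mulNum_spec (s := s₃) (n := n) f0
  set s₄ := mulNum.run s₃ with hs₄
  have g0 : s₄.reg 0 = n := (run_reg mulNum _ rfl).trans f0
  have hc₄ : Ctx n (natRel G.Adj) (natRel π) s₄ := ((hc₁.setR 1 1).run mulNum).run mulNum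
  have g1 : s₄.reg 1 = n ^ 2 := by
    rw [m2, m1, show s₂.reg 1 = 1 from rfl]; ring
  have g3 : s₄.reg 3 = 0 := by
    rw [hs₄, run_reg _ _ rfl, hs₃, run_reg _ _ rfl, hs₂, State.setR_reg, if_neg (by decide), r3]
  have g4 : s₄.reg 4 = 0 := by
    rw [hs₄, run_reg _ _ rfl, hs₃, run_reg _ _ rfl, hs₂, State.setR_reg, if_neg (by decide), r4]
  have g5 : s₄.reg 5 = 0 := by
    rw [hs₄, run_reg _ _ rfl, hs₃, run_reg _ _ rfl, hs₂, State.setR_reg, if_neg (by decide), r5]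
  refine ⟨⟨(hc₄.setR 2 2).setR 6 _, fun _ => ⟨g3, rfl, g1, g5⟩, by omega, fun h => absurd g5 h,
    fun h => absurd g4 h⟩, ?_⟩
  simp [g0]

/-- The bound by `n` ensures that the sizes 0, …, `n` provided for in `solver` include the distance
to block. -/
theorem distLe_distanceToBlock (G : SimpleGraph (Fin n)) :
    DistLe n (natRel G.Adj) (distanceToBlock G) ∧ distanceToBlock G ≤ n := by
  obtain ⟨X, hX, hB⟩ := exists_card_eq_distanceToBlock G
  rw [← hX]
  refine ⟨⟨fun j => if h : j < X.card then (X.equivFin.symm ⟨j, h⟩ : Fin n) else 0, ?_, ?_⟩, ?_⟩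
  · intro j hj
    simp [hj]
  · refine leavesBlocks_of_isBlockGraph hB fun x => ⟨?_, fun hx => ?_⟩
    · rintro ⟨j, hj, hjx⟩
      simp only [dif_pos hj] at hjx
      rw [← Fin.ext hjx]
      exact (X.equivFin.symm ⟨j, hj⟩).2
    · refine ⟨X.equivFin ⟨x, hx⟩, Fin.is_lt _, ?_⟩
      simp
  · simpa using X.card_le_univ

theorem solver_solvesInTime (cyc : Bool) (G : SimpleGraph (Fin n)) (π : Fin n → Fin n → Prop)
    [IsPartialOrder (Fin n) π] : ∃ (t : ℕ) (s : State),
      Exec (solver cyc).compile (input G π) t s ∧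
      t ≤ (max n 2) ^ (((solver cyc).weight + 7 * (solver cyc).depth) *
        max (distanceToBlock G) 1) ∧
      ((0 < n ∧ ∃ q, IsSolution n (natRel G.Adj) (natRel π) (cyc = true) q) → s.reg 0 = 1) ∧
      (¬ (0 < n ∧ ∃ q, IsSolution n (natRel G.Adj) (natRel π) (cyc = true) q) → s.reg 0 = 0) := by
  set K := distanceToBlock G with hK
  set b := max n 2 with hb
  -- Since 4K + 2 ≤ 6 * max K 1, `M` bounds the number of guesses. It also bounds the other loop
  -- bounds, `n + 1` and 4K + 2.
  set M := b ^ (6 * max K 1) with hM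
  have hb2 : 2 ≤ b := le_max_right _ _
  have hnb : n ≤ b := le_max_left _ _
  have hsq : b ^ 2 ≤ M := Nat.pow_le_pow_right (by omega) (by omega)
  have hnM : n + 1 ≤ M := by nlinarith
  have hKM : ∀ k ≤ K, 4 * k + 2 ≤ M := by
    intro k hk
    have h1 : 6 * max K 1 < 2 ^ (6 * max K 1) := Nat.lt_two_pow_self
    have h2 : 2 ^ (6 * max K 1) ≤ M := Nat.pow_le_pow_left hb2 _
    omega
  have hNM : ∀ k ≤ K, n ^ (4 * k + 2) ≤ M := fun k hk =>
    (Nat.pow_le_pow_left hnb _).trans (Nat.pow_le_pow_right (by omega) (by omega))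
  obtain ⟨h0, h6⟩ := setup_spec G π (cyc = true)
  set s₁ := setup.run (input G π) with hs₁
  have hbnd : (solver cyc).Bnd M (input G π) := by
    refine ⟨Bnd_of_boundsIn (l := [0]) _ _ rfl ?_, ?_, trivial⟩
    · simp only [List.mem_cons, List.not_mem_nil, or_false, forall_eq]
      change n ≤ M
      omega
    · refine Bnd_for (fun i s' => InSearch n (natRel G.Adj) (natRel π) (cyc = true) i s')
        (by rw [← hs₁, h6]; exact hnM) (h0.setR rfl) fun i s' hi hx hf ih => ?_
      rw [← hs₁, h6] at hi
      exact ⟨level_Bnd ih hi (distLe_distanceToBlock G).1 (by omega) hKM hNM, (level_spec ih).setR rfl⟩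
  obtain ⟨t, ht, htb⟩ := Cmd.exec (solver cyc) (input G π) rfl hbnd
  refine ⟨t, _, ht, htb.trans ?_, ?_⟩
  -- A further factor `b ^ max K 1`, which is at least 2, absorbs the 1; hence the 7.
  · have h1 : M + 1 ≤ b ^ (7 * max K 1) := by
      have h2 : b ^ (7 * max K 1) = M * b ^ (max K 1) := by rw [hM, ← pow_add]; ring_nf
      have h3 : b ^ 1 ≤ b ^ (max K 1) := Nat.pow_le_pow_right (by omega) (by omega)
      rw [h2]
      nlinarith
    -- As `b` is at least 2, the constant factor can be moved into the exponent.
    have h2 : (solver cyc).weight ≤ b ^ ((solver cyc).weight * max K 1) :=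
      calc (solver cyc).weight ≤ 2 ^ (solver cyc).weight := Nat.lt_two_pow_self.le
        _ ≤ b ^ (solver cyc).weight := Nat.pow_le_pow_left hb2 _
        _ ≤ _ := Nat.pow_le_pow_right (by omega) (Nat.le_mul_of_pos_right _ (by omega))
    calc (solver cyc).weight * (M + 1) ^ (solver cyc).depth
        ≤ b ^ ((solver cyc).weight * max K 1) * (b ^ (7 * max K 1)) ^ (solver cyc).depth :=
          Nat.mul_le_mul h2 (Nat.pow_le_pow_left h1 _)
      _ = _ := by rw [← pow_mul, ← pow_add]; ring_nf
  · have hfin := run_for_inv (c := level cyc) (x := 7) (b := 6) (s := s₁)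
      (fun i s' => InSearch n (natRel G.Adj) (natRel π) (cyc = true) i s') (h0.setR rfl)
      fun i s' _ _ _ ih => (level_spec ih).setR rfl
    rw [h6] at hfin
    have hres : ((solver cyc).run (input G π)).reg 0 =
        if 0 < ((Cmd.for 7 6 (level cyc)).run s₁).reg 5 then 1 else 0 := by
      rw [solver, run_seq, run_seq, run_assign, ← hs₁]
      simp only [Expr.eval, State.setR_reg, if_true]
      congr
    rw [hres]
    set t := (Cmd.for 7 6 (level cyc)).run s₁
    constructor
    · rintro ⟨hn, hq⟩
      -- If all sizes up to `n` had failed, so would `K ≤ n`.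
      have h4 : t.reg 4 ≠ 0 := by
        intro h4
        have h7 := distLe_distanceToBlock G
        exact hfin.fail h4 hn K (by omega) h7.1
      rw [if_pos (Nat.pos_of_ne_zero (hfin.complete h4 hq))]
    · intro hq
      rw [if_neg]
      intro h7
      exact hq (hfin.sound (by omega))

/-- For `n = 0` every sequence satisfies `IsSolution` vacuously, while a walk has at least one
vertex; hence the conjunct `0 < n`. -/
theorem POHPP_iff (G : SimpleGraph (Fin n)) (π : Fin n → Fin n → Prop)
    [IsPartialOrder (Fin n) π] : POHPP G π ↔
      0 < n ∧ ∃ q, IsSolution n (natRel G.Adj) (natRel π) (false = true) q := by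
  constructor
  · rintro ⟨u, v, p, hp, he⟩
    exact ⟨u.pos, exists_isSolution_of_walk p hp he _ (by simp)⟩
  · rintro ⟨hn, q, hq⟩
    obtain ⟨u, v, p, hp, -, he⟩ := exists_walk_of_isSolution hn (refl_of π) hq
    exact ⟨u, v, p, hp, he⟩

theorem POHCP_iff (G : SimpleGraph (Fin n)) (π : Fin n → Fin n → Prop)
    [IsPartialOrder (Fin n) π] : POHCP G π ↔
      0 < n ∧ ∃ q, IsSolution n (natRel G.Adj) (natRel π) (true = true) q := by
  constructor
  · rintro ⟨u, v, p, hp, huv, he⟩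
    exact ⟨u.pos, exists_isSolution_of_walk p hp he _ fun _ => huv⟩
  · rintro ⟨hn, q, hq⟩
    obtain ⟨u, v, p, hp, huv, he⟩ := exists_walk_of_isSolution hn (refl_of π) hq
    exact ⟨u, v, p, hp, huv rfl, he⟩

end

end POHam

/-- One program for each problem, which is not told `k`, works for all graphs; the running time
is at most `n ^ (c * k)` where `k` is the distance to block (with `k` read as `1` on block graphs,
and `n` as `2` on graphs with fewer than two vertices). -/
theorem mainTheorem9 :
    ∃ c : ℕ,
      (∃ P : POHam.Prog,
        POHam.SolvesInTime P (fun _ G π => POHam.POHPP G π)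
          (fun n G => (max n 2) ^ (c * max (POHam.distanceToBlock G) 1))) ∧
      (∃ P : POHam.Prog,
        POHam.SolvesInTime P (fun _ G π => POHam.POHCP G π)
          (fun n G => (max n 2) ^ (c * max (POHam.distanceToBlock G) 1))) := by
  refine ⟨max ((POHam.solver false).weight + 7 * (POHam.solver false).depth)
    ((POHam.solver true).weight + 7 * (POHam.solver true).depth),
    ⟨(POHam.solver false).compile, fun n G π hπ => ?_⟩,
    ⟨(POHam.solver true).compile, fun n G π hπ => ?_⟩⟩
  · obtain ⟨t, s, h1, h2, h3, h4⟩ := POHam.solver_solvesInTime false G π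
    rw [← POHam.POHPP_iff] at h3 h4
    exact ⟨t, s, h1, h2.trans (Nat.pow_le_pow_right (by omega)
      (Nat.mul_le_mul_right _ (le_max_left _ _))), h3, h4⟩
  · obtain ⟨t, s, h1, h2, h3, h4⟩ := POHam.solver_solvesInTime true G π
    rw [← POHam.POHCP_iff] at h3 h4
    exact ⟨t, s, h1, h2.trans (Nat.pow_le_pow_right (by omega)
      (Nat.mul_le_mul_right _ (le_max_right _ _))), h3, h4⟩
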